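/- **Setting.** Let $\Gamma\subset\mathbb{R}^3$ be a full-rank lattice. Let $(V_\Lambda,\Lambda)$ be a mesoscopic lattice: a simple undirected graph whose vertex set $V_\Lambda\subset\mathbb{R}^3$ is locally finite, which has bounded degree, and which is invariant under the translations of some full-rank lattice of $\mathbb{R}^3$; $\Lambda$ is its edge set. Every edge carries a counting direction, with unit vector $n_e$ and signed incidence matrix $s_{ve}\in\{1,-1,0\}$ ($1$ if $e$ enters $v$, $-1$ if $e$ leaves $v$), and $\lambda_e$ is the one-dimensional Lebesgue measure on the segment of $e$. Let $\varphi:\mathbb{R}^3\to[0,\infty)$ be smooth and compactly supported with $\int\varphi=1$ and $\varphi(0)>0$. For finite $E\Subset\Lambda$ let $$\mathcal I(E)=\Big\{I\in\Gamma^E:\ \sum_{e\in E}s_{ve}I_e=0\ \text{ for all } v\in V_\Lambda\Big\},$$ and for $I\in\mathcal I(E)$ let $b(I)$ be the field with $$b_{ijk}(I)=\sum_{l=1}^3\epsilon_{ijl}\,\varphi*\sum_{e\in E}(n_e)_l(I_e)_k\lambda_e .$$ For real $\lambda,\mu$ with $\mu>0$ and $\mu+3\lambda/2>0$ put $F(U)=\frac\lambda2(\operatorname{tr}U)^2+\mu|U|^2$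 and $H_{\rm el}(w)=\int_{\mathbb{R}^3}F(w(x)+w(x)^t)\,dx$. With $(d_1w)_{ijk}=\partial_iw_{jk}-\partial_jw_{ik}$ let $$H^*_{\rm el}(I)=\inf\{H_{\rm el}(w):\ w\in C_c^\infty(\mathbb{R}^3,\mathbb{R}^{3\times3}),\ d_1w=b(I)\}.$$ Let $w^*(\cdot,I)$ be the bounded smooth function in $L^2(\mathbb{R}^3,\mathbb{R}^{3\times 3})$ that is the $L^2$-limit of every sequence $(w^n)$ in $C_c^\infty(\mathbb{R}^3,\mathbb{R}^{3\times3})$ with $d_1w^n=b(I)$ and $H_{\rm el}(w^n)\to H^*_{\rm el}(I)$. Let $H_{\rm disl}(I)=\mathcal H_{\rm disl}(b(I))\in[0,\infty]$ for a function $\mathcal H_{\rm disl}$ of the field $b$, such that for all $E\Subset\Lambda$ and $I,I_1,I_2\in\mathcal I(E)$: - $H_{\rm disl}(I)=H_{\rm disl}(-I)$; - $H_{\rm disl}(0)=0$, and $H_{\rm disl}(I_1+I_2)=H_{\rm disl}(I_1)+H_{\rm disl}(I_2)$ whenever no edge in $\operatorname{supp}I_1$ has a common vertex with an edge in $\operatorname{supp}I_2$;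 - $H_{\rm disl}(I)\ge c\sum_{e\in E}|I_e|$, with a constant $c>0$. Let $P_{\beta,E}$ be the Gibbs measure on $\mathcal I(E)$ giving $I$ the weight $Z_{\beta,E}^{-1}e^{-\beta(H^*_{\rm el}(I)+H_{\rm disl}(I))}$, where $e^{-\infty}=0$ and $Z_{\beta,E}$ is the sum of $e^{-\beta(H^*_{\rm el}(I)+H_{\rm disl}(I))}$ over $I\in\mathcal I(E)$. **Theorem (Spontaneous breaking of linearized rotational symmetry).** For every $E\Subset\Lambda$ and $I\in\mathcal I(E)$ the function $w^*(\cdot,I)$ exists and is unique. There are constants $c_2>0$ and $\beta_0$, depending only on $\Gamma$, $(V_\Lambda,\Lambda)$, $c$ and $\varphi$, such that for all $\beta>\beta_0$ the following holds for all $E\Subset\Lambda$, all $x,y\in\mathbb{R}^3$ and all $i,j\in\{1,2,3\}$. For all $t\in\mathbb{R}$ the characteristic function $\mathrm{E}_{P_{\beta,E}}\big[e^{\mathrm{i}t(w^*_{ij}(x,I)-w^*_{ij}(y,I))}\big]$ is real and $$\mathrm{E}_{P_{\beta,E}}\Big[e^{\mathrm{i}t(w^*_{ij}(x,I)-w^*_{ij}(y,I))}\Big]\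 \ge\ \exp\Big\{-\frac{t^2}{2}e^{-c_2\beta}\Big\}.$$ Consequently $w^*_{ij}(x,I)-w^*_{ij}(y,I)$ is square integrable under $P_{\beta,E}$ and $$\operatorname{Var}_{P_{\beta,E}}\big(w^*_{ij}(x,I)-w^*_{ij}(y,I)\big)\le e^{-c_2\beta}.$$ -/

import Mathlib

open MeasureTheory ProbabilityTheory Filter Topology
open scoped ENNReal ContDiff

namespace DislocationLines

noncomputable section

/-- Euclidean three-space. -/
abbrev E3 : Type := EuclideanSpace ℝ (Fin 3)

/-- Matrix-valued fields `w : ℝ³ → ℝ^{3×3}`. -/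
abbrev MatrixField : Type := E3 → Matrix (Fin 3) (Fin 3) ℝ

/-- Fields `b : ℝ³ → ℝ^{3×3×3}`. -/
abbrev TensorField : Type := E3 → Fin 3 → Fin 3 → Fin 3 → ℝ

/-! ### Linearized elasticity -/

/-- The partial derivative `∂ᵢ f` of a scalar function. -/
def partialDeriv (i : Fin 3) (f : E3 → ℝ) (x : E3) : ℝ :=
  fderiv ℝ f x (EuclideanSpace.single i 1)

/-- `(d₁ w)_{ijk} = ∂ᵢ w_{jk} - ∂ⱼ w_{ik}`. -/
def d1 (w : MatrixField) : TensorField := fun x i j k =>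
  partialDeriv i (fun y => w y j k) x - partialDeriv j (fun y => w y i k) x

/-- The isotropic quadratic form `F(U) = (λ/2) (tr U)² + μ |U|²`. -/
def quadForm (lam mu : ℝ) (U : Matrix (Fin 3) (Fin 3) ℝ) : ℝ :=
  lam / 2 * U.trace ^ 2 + mu * ∑ i, ∑ j, U i j ^ 2

/-- The elastic energy `H_el(w) = ∫ F(w(x) + w(x)ᵗ) dx`, with values in `[0, ∞]`
(the form `F` is nonnegative for the admissible Lamé coefficients). -/
def elasticEnergy (lam mu : ℝ) (w : MatrixField) : ℝ≥0∞ :=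
  ∫⁻ x, ENNReal.ofReal (quadForm lam mu (w x + (w x).transpose))

/-- All entries of the matrix field are smooth. -/
def IsSmoothField (w : MatrixField) : Prop :=
  ∀ i j, ContDiff ℝ ∞ (fun x => w x i j)

/-- `w ∈ C_c^∞(ℝ³, ℝ^{3×3})` and `d₁ w = b`. -/
def IsAdmissible (b : TensorField) (w : MatrixField) : Prop :=
  IsSmoothField w ∧ HasCompactSupport w ∧ d1 w = b

/-- The infimum of the elastic energy over smooth compactly supported fields `w`
with Burgers vector density `d₁ w = b`. -/
def minElasticEnergy (lam mu : ℝ) (b : TensorField) : ℝ≥0∞ :=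
  ⨅ (w : MatrixField) (_ : IsAdmissible b w), elasticEnergy lam mu w

/-- `w` is a bounded smooth function in `L²(ℝ³, ℝ^{3×3})` which is the `L²`-limit of every
sequence of smooth compactly supported fields with Burgers vector density `b`
whose elastic energies converge to the infimum. -/
structure IsEnergyMinimizer (lam mu : ℝ) (b : TensorField) (w : MatrixField) : Prop where
  smooth : IsSmoothField w
  bounded : ∃ C : ℝ, ∀ x i j, |w x i j| ≤ C
  memLp : ∀ i j, MemLp (fun x => w x i j) 2 volume
  tendsto : ∀ u : ℕ → MatrixField, (∀ n, IsAdmissible b (u n)) →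
    Tendsto (fun n => elasticEnergy lam mu (u n)) atTop (𝓝 (minElasticEnergy lam mu b)) →
    ∀ i j, Tendsto (fun n => eLpNorm (fun x => u n x i j - w x i j) 2 volume) atTop (𝓝 0)

open Classical in
/-- The field `w*` belonging to the Burgers vector density `b`. -/
def wStar (lam mu : ℝ) (b : TensorField) : MatrixField :=
  if h : ∃ w, IsEnergyMinimizer lam mu b w then h.choose else 0

/-! ### Dislocation lines -/

/-- A mesoscopic lattice in `ℝ³`: a graph with a locally finite vertex set in `ℝ³`, of bounded
degree, and invariant under the translations of some full-rank lattice. -/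
structure MesoscopicLattice where
  /-- the vertex set `V_Λ` -/
  verts : Set E3
  /-- the adjacency relation; its edge set is `Λ` -/
  graph : SimpleGraph E3
  mem_verts_of_adj : ∀ x y, graph.Adj x y → x ∈ verts
  locallyFinite : ∀ r : ℝ, (verts ∩ Metric.closedBall 0 r).Finite
  boundedDegree : ∃ M : ℕ, ∀ x, (graph.neighborSet x).encard ≤ M
  periodic : ∃ a : Module.Basis (Fin 3) ℝ E3, ∀ k,
    (∀ x, a k + x ∈ verts ↔ x ∈ verts) ∧
    ∀ x y, graph.Adj (a k + x) (a k + y) ↔ graph.Adj x y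

/-- The set `Λ` of undirected edges. -/
abbrev MesoscopicLattice.Edge (Λ : MesoscopicLattice) : Type := Λ.graph.edgeSet

/-- A choice of counting direction for every edge: it goes from `src e` to `tgt e`. -/
structure CountingDirection (Λ : MesoscopicLattice) where
  src : Λ.Edge → E3
  tgt : Λ.Edge → E3
  mk_src_tgt : ∀ e : Λ.Edge, s(src e, tgt e) = (e : Sym2 E3)

/-- The form function `φ`: smooth, compactly supported, nonnegative, of total mass one,
and positive at the origin. -/
structure IsFormFunction (φ : E3 → ℝ) : Prop where
  smooth : ContDiff ℝ ∞ φ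
  compactSupport : HasCompactSupport φ
  nonneg : ∀ x, 0 ≤ φ x
  integral_eq_one : ∫ x, φ x = 1
  pos_zero : 0 < φ 0

variable {Λ : MesoscopicLattice}

open Classical in
/-- The signed incidence matrix `s_{ve}`. -/
def incidence (o : CountingDirection Λ) (v : E3) (e : Λ.Edge) : ℝ :=
  if o.tgt e = v then 1 else if o.src e = v then -1 else 0

/-- The set `𝓘(E)` of currents `I ∈ Γ^E` fulfilling Kirchhoff's node law. -/
def currents (Γ : Submodule ℤ E3) (o : CountingDirection Λ) (E : Finset Λ.Edge) :
    Set (E → E3) :=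
  {I | (∀ e, I e ∈ Γ) ∧ ∀ v ∈ Λ.verts, ∑ e : E, incidence o v e • I e = 0}

/-- The one-dimensional Lebesgue measure `λ_e` on the segment of the edge `e`,
with total mass the length of `e`. -/
def edgeMeasure (o : CountingDirection Λ) (e : Λ.Edge) : Measure E3 :=
  ENNReal.ofReal ‖o.tgt e - o.src e‖ •
    Measure.map (fun t : ℝ => o.src e + t • (o.tgt e - o.src e))
      (volume.restrict (Set.Icc 0 1))

/-- The unit vector `n_e` pointing in the counting direction. -/
def unitVec (o : CountingDirection Λ) (e : Λ.Edge) : E3 :=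
  ‖o.tgt e - o.src e‖⁻¹ • (o.tgt e - o.src e)

/-- The convolution `φ * J(I)` of the form function with the matrix-valued measure
`J_{jk}(I) = ∑_e (n_e)_j (I_e)_k λ_e`. -/
def smoothedCurrent (o : CountingDirection Λ) (φ : E3 → ℝ) {E : Finset Λ.Edge} (I : E → E3) :
    MatrixField := fun x =>
  Matrix.of fun j k => ∑ e : E, unitVec o e j * I e k * ∫ y, φ (x - y) ∂(edgeMeasure o e)

/-- `ε_{ijl} = det(e_i, e_j, e_l)`. -/
def leviCivita (i j l : Fin 3) : ℝ :=
  Matrix.det (Matrix.of ![Pi.single i 1, Pi.single j 1, Pi.single l 1])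

/-- The Burgers vector density `b(I)`. -/
def burgers (o : CountingDirection Λ) (φ : E3 → ℝ) {E : Finset Λ.Edge} (I : E → E3) :
    TensorField := fun x i j k =>
  ∑ l, leviCivita i j l * smoothedCurrent o φ I x l k

/-- The assumptions on the local dislocation energy `H_disl(I) = 𝓗(b(I))`: symmetry, locality
and the lower bound `H_disl(I) ≥ c ‖I‖₁`. -/
structure IsDislocationEnergy (Γ : Submodule ℤ E3) (o : CountingDirection Λ) (φ : E3 → ℝ)
    (c : ℝ) (Hd : TensorField → ℝ≥0∞) : Prop where
  symm : ∀ E : Finset Λ.Edge, ∀ I ∈ currents Γ o E, Hd (burgers o φ I) = Hd (burgers o φ (-I))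
  locality : ∀ E : Finset Λ.Edge, ∀ I₁ ∈ currents Γ o E, ∀ I₂ ∈ currents Γ o E,
    (∀ e f : E, I₁ e ≠ 0 → I₂ f ≠ 0 → ∀ v : E3, v ∈ (e : Sym2 E3) → v ∉ (f : Sym2 E3)) →
    Hd (burgers o φ (I₁ + I₂)) = Hd (burgers o φ I₁) + Hd (burgers o φ I₂)
  zero : ∀ E : Finset Λ.Edge, Hd (burgers o φ (0 : E → E3)) = 0
  lower : ∀ E : Finset Λ.Edge, ∀ I ∈ currents Γ o E,
    ENNReal.ofReal (c * ∑ e, ‖I e‖) ≤ Hd (burgers o φ I)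

/-! ### The Gibbs measure -/

/-- The weight `exp(-β (H*_el(I) + H_disl(I)))`, where `exp(-∞) = 0`. -/
def gibbsWeight (o : CountingDirection Λ) (φ : E3 → ℝ) (Hd : TensorField → ℝ≥0∞)
    (lam mu β : ℝ) {E : Finset Λ.Edge} (I : E → E3) : ℝ≥0∞ :=
  EReal.exp (-((β : EReal) *
    ((minElasticEnergy lam mu (burgers o φ I) + Hd (burgers o φ I) : ℝ≥0∞) : EReal)))

/-- The partition sum `Z_{β,E}`. -/
def partitionSum (Γ : Submodule ℤ E3) (o : CountingDirection Λ) (φ : E3 → ℝ)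
    (Hd : TensorField → ℝ≥0∞) (lam mu β : ℝ) (E : Finset Λ.Edge) : ℝ≥0∞ :=
  ∑' I : currents Γ o E, gibbsWeight o φ Hd lam mu β I.1

/-- The Gibbs measure `P_{β,E}` on `𝓘(E)`. -/
def gibbsMeasure (Γ : Submodule ℤ E3) (o : CountingDirection Λ) (φ : E3 → ℝ)
    (Hd : TensorField → ℝ≥0∞) (lam mu β : ℝ) (E : Finset Λ.Edge) :
    Measure (currents Γ o E) :=
  (partitionSum Γ o φ Hd lam mu β E)⁻¹ •
    Measure.sum fun I : currents Γ o E =>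
      gibbsWeight o φ Hd lam mu β I.1 • Measure.dirac I

/-- The observable `I ↦ w*_{ij}(x, I) - w*_{ij}(y, I)`. -/
def observable (Γ : Submodule ℤ E3) (o : CountingDirection Λ) (φ : E3 → ℝ) (lam mu : ℝ)
    (E : Finset Λ.Edge) (x y : E3) (i j : Fin 3) (I : currents Γ o E) : ℝ :=
  wStar lam mu (burgers o φ I.1) x i j - wStar lam mu (burgers o φ I.1) y i j

end

end DislocationLines

/-! The Boltzmann weight is a product of a local and a long-range factor. By the lower bound on
`Hd`, the factor of the dislocation energy makes every occupied edge exponentially expensive in β.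
The elastic factor is long ranged, but on currents the minimal elastic energy is a positive
semidefinite quadratic form, so that exp(-β H*_el(I)) is the average of cos⟨θ, I⟩ over a Gaussian
random field θ (`exists_gaussian_mixture`). For frozen θ there remains a dilute gas of currents with
local weights K(I), and an estimate that is uniform in θ survives the averaging.

Let Z(θ) = ∑ K(I) exp(i⟨θ, I⟩). A polymer expansion over the supports of currents shows that Z has
no zero when all |Im θ_a| ≤ 1, and that inserting a coordinate I_a costs at most a factor δ = q 4^D.
Here q is the activity of an edge and D bounds the number of edges touching an edge
(`norm_polymerSum_erase_le`, `norm_sum_insertion_le`). Cauchy's estimate on a complex line through a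
real θ turns this into an ℓ¹ bound on the rows of truncated two-point functions, and a Schur test
gives |∂_t² log Z(θ + tσ)| ≤ δ|σ|² (`IsCurrentGas.norm_variance_le`). Hence log Z(θ + tσ) +
δ|σ|²t²/2 is convex in t, and by the inequality between the two means (Z(θ + tσ) + Z(θ - tσ))/2 ≥
exp(-δ|σ|²t²/2) Z(θ). The left side is the sum over I of K(I) cos⟨θ, I⟩ cos(t⟨σ, I⟩); averaging over
θ bounds the characteristic function of ⟨σ, I⟩ from below (`IsCurrentGas.sum_gaussian_cos_ge`). The
variance bound follows by letting t tend to 0.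

Two facts about linearized elasticity are needed. First, the minimizer is explicit in Fourier space,
with a symbol of order |b̂(ξ)|/|ξ|: it solves the Euler–Lagrange equations, any admissible field
differs from it by a longitudinal part with which it has no cross energy, and such parts are
approximated by gradients of test functions. An admissible field exists at all because cones over
the edges provide a compactly supported vector potential (`isAdmissible_coneField`). So w* is linear
in I and the energy is quadratic. Second, the coefficients σ of the observable are square summable,
uniformly in E, x and y: |w*(x)| is controlled by an H¹ norm of b(I), which the finite overlap of
the smeared edges bounds by the ℓ² norm of I; inserting I proportional to σ closes the estimate
(`exists_sum_observableCoeff_sq_le`).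

Finally q decays exponentially in β, and half of the exponent absorbs all constants. The elastic
moduli enter only through positivity and |λ/(λ + 2μ)| ≤ 1, which is why the constants do not depend
on them. -/

namespace DislocationLines

noncomputable section

set_option linter.unusedSectionVars false

/-! ### Polymer expansions on a finite set with an incompatibility relation -/

section Polymer

variable {E : Type*} [Fintype E] [DecidableEq E]

/-- Every nonempty part of `S` can be reached inside `S` from `B`. -/
def GeneratedFrom (R : E → E → Prop) (B S : Finset E) : Prop :=
  ∀ T ⊆ S, B ∩ S ⊆ T → (∀ t ∈ T, ∀ s ∈ S, R t s → s ∈ T) → T = S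

open Classical in
/-- The elements related to some element of `C`. -/
def relNhd (R : E → E → Prop) (C : Finset E) : Finset E :=
  Finset.univ.filter fun f => ∃ c ∈ C, R c f

theorem mem_relNhd {R : E → E → Prop} {C : Finset E} {f : E} :
    f ∈ relNhd R C ↔ ∃ c ∈ C, R c f := by
  classical
  simp [relNhd]

theorem card_relNhd_le {R : E → E → Prop} {D : ℕ} (hD : ∀ e, (relNhd R {e}).card ≤ D)
    (C : Finset E) : (relNhd R C).card ≤ D * C.card := by
  have h : relNhd R C ⊆ C.biUnion fun e => relNhd R {e} := by
    intro f hf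
    obtain ⟨c, hc, hcf⟩ := mem_relNhd.1 hf
    exact Finset.mem_biUnion.2 ⟨c, hc, mem_relNhd.2 ⟨c, by simp, hcf⟩⟩
  refine (Finset.card_le_card h).trans ?_
  rw [mul_comm]
  exact Finset.card_biUnion_le_card_mul _ _ _ fun e _ => hD e

theorem GeneratedFrom.eq_empty {R : E → E → Prop} {B S : Finset E} (h : GeneratedFrom R B S)
    (hBS : B ∩ S = ∅) : S = ∅ :=
  (h ∅ (by simp) (by simp [hBS]) (by simp)).symm

/-- One exploration step: once b has been revealed, whatever was reachable through b is reachable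
from the neighbours of b. -/
theorem GeneratedFrom.of_insert {R : E → E → Prop} {B S : Finset E} {b : E}
    (h : GeneratedFrom R B (insert b S)) (hb : b ∉ S) :
    GeneratedFrom R (B ∪ relNhd R {b}) S := by
  intro T hT hBT hcl
  have h1 : insert b T = insert b S := by
    refine h _ (Finset.insert_subset_insert _ hT) ?_ ?_
    · intro x hx
      rw [Finset.mem_inter, Finset.mem_insert] at hx
      rcases hx with ⟨hxB, rfl | hxS⟩
      · simp
      · exact Finset.mem_insert_of_mem
          (hBT (Finset.mem_inter.2 ⟨Finset.mem_union_left _ hxB, hxS⟩))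
    · intro t ht s hs hts
      rw [Finset.mem_insert] at ht hs ⊢
      rcases hs with rfl | hs
      · exact Or.inl rfl
      right
      rcases ht with rfl | ht
      · exact hBT (Finset.mem_inter.2
          ⟨Finset.mem_union_right _ (mem_relNhd.2 ⟨_, by simp, hts⟩), hs⟩)
      · exact hcl t ht s hs hts
  have hbT : b ∉ T := fun h' => hb (hT h')
  rw [← Finset.erase_insert hbT, h1, Finset.erase_insert hb]

-- Induction on the size of A by revealing a point b of B ∩ A. Sets avoiding b contribute half of
-- the bound. Sets containing b pay q and gain at most D new starting points, and q 2^D ≤ 1 makes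
-- their contribution at most the other half. If B misses A, only the empty set is generated.
open Classical in
theorem sum_generatedFrom_le {R : E → E → Prop} {D : ℕ} (hD : ∀ e, (relNhd R {e}).card ≤ D)
    {q : ℝ} (hq : 0 ≤ q) (hqD : q * 2 ^ D ≤ 1) (A B : Finset E) :
    ∑ S ∈ A.powerset, (if GeneratedFrom R B S then q ^ S.card else 0) ≤ 2 ^ (B ∩ A).card := by
  induction hn : A.card generalizing A B with
  | zero =>
    rw [Finset.card_eq_zero] at hn
    subst hn
    simp only [Finset.powerset_empty, Finset.sum_singleton, Finset.inter_empty, Finset.card_empty,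
      pow_zero]
    split_ifs <;> simp
  | succ n ih =>
    by_cases hBA : B ∩ A = ∅
    · rw [hBA, Finset.card_empty, pow_zero, Finset.sum_eq_single ∅]
      · split_ifs <;> simp
      · intro S hS hne
        rw [if_neg]
        intro hg
        refine hne (hg.eq_empty ?_)
        rw [← Finset.subset_empty, ← hBA]
        exact Finset.inter_subset_inter_left (Finset.mem_powerset.1 hS)
      · simp
    · obtain ⟨b, hb⟩ := Finset.nonempty_iff_ne_empty.2 hBA
      rw [Finset.mem_inter] at hb
      have hbA' : b ∉ A.erase b := Finset.notMem_erase _ _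
      have hcard : (A.erase b).card = n := by rw [Finset.card_erase_of_mem hb.2, hn]; rfl
      have hcB : (B ∩ A.erase b).card + 1 = (B ∩ A).card := by
        rw [Finset.inter_erase, Finset.card_erase_add_one (Finset.mem_inter.2 hb)]
      have hsplit : ∑ S ∈ A.powerset, (if GeneratedFrom R B S then q ^ S.card else 0)
          = ∑ S ∈ (A.erase b).powerset, (if GeneratedFrom R B S then q ^ S.card else 0)
          + ∑ S ∈ (A.erase b).powerset,
            (if GeneratedFrom R B (insert b S) then q ^ (insert b S).card else 0) := by
        conv_lhs => rw [← Finset.insert_erase hb.2]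
        rw [Finset.sum_powerset_insert hbA']
      rw [hsplit]
      have h1 := ih (A.erase b) B hcard
      have h2 := ih (A.erase b) (B ∪ relNhd R {b}) hcard
      have h3 : ∑ S ∈ (A.erase b).powerset,
            (if GeneratedFrom R B (insert b S) then q ^ (insert b S).card else 0)
          ≤ q * ∑ S ∈ (A.erase b).powerset,
            (if GeneratedFrom R (B ∪ relNhd R {b}) S then q ^ S.card else 0) := by
        rw [Finset.mul_sum]
        refine Finset.sum_le_sum fun S hS => ?_
        have hbS : b ∉ S := fun h => hbA' (Finset.mem_powerset.1 hS h)
        by_cases hg : GeneratedFrom R B (insert b S)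
        · rw [if_pos hg, if_pos (hg.of_insert hbS), Finset.card_insert_of_notMem hbS, pow_succ,
            mul_comm]
        · rw [if_neg hg]
          split_ifs <;> positivity
      have h4 : ((B ∪ relNhd R {b}) ∩ A.erase b).card ≤ (B ∩ A.erase b).card + D := by
        rw [Finset.union_inter_distrib_right]
        refine (Finset.card_union_le _ _).trans (Nat.add_le_add_left ?_ _)
        exact (Finset.card_le_card Finset.inter_subset_left).trans (hD b)
      have h5 : (2 : ℝ) ^ ((B ∪ relNhd R {b}) ∩ A.erase b).card
          ≤ 2 ^ (B ∩ A.erase b).card * 2 ^ D := by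
        rw [← pow_add]; exact pow_le_pow_right₀ (by norm_num) h4
      rw [← hcB, pow_succ]
      have h6 : q * ((2 : ℝ) ^ (B ∩ A.erase b).card * 2 ^ D) ≤ 2 ^ (B ∩ A.erase b).card := by
        calc q * ((2 : ℝ) ^ (B ∩ A.erase b).card * 2 ^ D)
            = (q * 2 ^ D) * 2 ^ (B ∩ A.erase b).card := by ring
          _ ≤ 1 * 2 ^ (B ∩ A.erase b).card := by gcongr
          _ = _ := one_mul _
      have h7 := h3.trans ((mul_le_mul_of_nonneg_left (h2.trans h5) hq).trans h6)
      linarith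

/-- Connected sets rooted at `e₀`. -/
def IsPolymer (R : E → E → Prop) (e₀ : E) (C : Finset E) : Prop :=
  e₀ ∈ C ∧ GeneratedFrom R {e₀} C

open Classical in
/-- The connected sets rooted at `e₀` inside `A`. -/
def polymers (R : E → E → Prop) (A : Finset E) (e₀ : E) : Finset (Finset E) :=
  A.powerset.filter (IsPolymer R e₀)

/-- Revealing the root costs q; the rest is generated from the at most D neighbours of the root,
whence the factor 2^D. -/
theorem sum_polymers_le {R : E → E → Prop} {D : ℕ} (hD : ∀ e, (relNhd R {e}).card ≤ D)
    {q : ℝ} (hq : 0 ≤ q) (hqD : q * 2 ^ D ≤ 1) (A : Finset E) (e₀ : E) (he : R e₀ e₀) :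
    ∑ C ∈ polymers R A e₀, q ^ C.card ≤ q * 2 ^ D := by
  classical
  by_cases hA : e₀ ∈ A
  · have hn : e₀ ∉ A.erase e₀ := Finset.notMem_erase _ _
    rw [polymers, Finset.sum_filter]
    conv_lhs => rw [← Finset.insert_erase hA]
    rw [Finset.sum_powerset_insert hn]
    have h1 : ∑ S ∈ (A.erase e₀).powerset, (if IsPolymer R e₀ S then q ^ S.card else 0) = 0 :=
      Finset.sum_eq_zero fun S hS => if_neg fun h => hn (Finset.mem_powerset.1 hS h.1)
    rw [h1, zero_add]
    have h2 := sum_generatedFrom_le hD hq hqD (A.erase e₀) ({e₀} ∪ relNhd R {e₀})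
    have h3 : (({e₀} ∪ relNhd R {e₀}) ∩ A.erase e₀).card ≤ D := by
      refine (Finset.card_le_card Finset.inter_subset_left).trans ?_
      rw [Finset.union_eq_right.2]
      · exact hD e₀
      · simpa using mem_relNhd.2 ⟨e₀, by simp, he⟩
    calc _ ≤ q * ∑ S ∈ (A.erase e₀).powerset,
            (if GeneratedFrom R ({e₀} ∪ relNhd R {e₀}) S then q ^ S.card else 0) := by
          rw [Finset.mul_sum]
          refine Finset.sum_le_sum fun S hS => ?_
          have hbS : e₀ ∉ S := fun h => hn (Finset.mem_powerset.1 hS h)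
          by_cases hg : IsPolymer R e₀ (insert e₀ S)
          · rw [if_pos hg, if_pos (hg.2.of_insert hbS), Finset.card_insert_of_notMem hbS,
              pow_succ, mul_comm]
          · rw [if_neg hg]
            split_ifs <;> positivity
      _ ≤ q * 2 ^ D := by
          refine mul_le_mul_of_nonneg_left (h2.trans ?_) hq
          exact pow_le_pow_right₀ (by norm_num) h3
  · rw [Finset.sum_eq_zero]
    · positivity
    · intro C hC
      rw [polymers, Finset.mem_filter, Finset.mem_powerset] at hC
      exact absurd (hC.1 hC.2.1) hA

open Classical in
/-- The connected component of `e₀` in `S`. -/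
def component (R : E → E → Prop) (S : Finset E) (e₀ : E) : Finset E :=
  S.filter fun s => Relation.ReflTransGen (fun a b => R a b ∧ b ∈ S) e₀ s

theorem component_subset (R : E → E → Prop) (S : Finset E) (e₀ : E) : component R S e₀ ⊆ S := by
  classical
  exact Finset.filter_subset _ _

theorem component_closed {R : E → E → Prop} {S : Finset E} {e₀ t s : E}
    (ht : t ∈ component R S e₀) (hs : s ∈ S) (hts : R t s) : s ∈ component R S e₀ := by
  classical
  rw [component, Finset.mem_filter] at ht ⊢
  exact ⟨hs, ht.2.tail ⟨hts, hs⟩⟩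

theorem mem_component_self {R : E → E → Prop} {S : Finset E} {e₀ : E} (h : e₀ ∈ S) :
    e₀ ∈ component R S e₀ := by
  classical
  exact Finset.mem_filter.2 ⟨h, .refl⟩

theorem component_subset_of_closed {R : E → E → Prop} {S T : Finset E} {e₀ : E} (h : e₀ ∈ T)
    (hcl : ∀ t ∈ T, ∀ s ∈ component R S e₀, R t s → s ∈ T) : component R S e₀ ⊆ T := by
  classical
  have key : ∀ s, Relation.ReflTransGen (fun a b => R a b ∧ b ∈ S) e₀ s → s ∈ T := by
    intro s hs
    induction hs with
    | refl => exact h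
    | tail hab hbc ih =>
      exact hcl _ ih _ (Finset.mem_filter.2 ⟨hbc.2, hab.tail hbc⟩) hbc.1
  intro s hs
  exact key s (Finset.mem_filter.1 hs).2

theorem isPolymer_component {R : E → E → Prop} {S : Finset E} {e₀ : E} (h : e₀ ∈ S) :
    IsPolymer R e₀ (component R S e₀) := by
  refine ⟨mem_component_self h, fun T hT hB hcl => ?_⟩
  refine hT.antisymm (component_subset_of_closed ?_ hcl)
  exact hB (Finset.mem_inter.2 ⟨by simp, mem_component_self h⟩)

/-- Inverse of splitting off a component: adding points unrelated to C does not enlarge the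
component of the root. -/
theorem component_union {R : E → E → Prop} {C S : Finset E} {e₀ : E}
    (hC : IsPolymer R e₀ C)
    (hS : Disjoint S (relNhd R C)) : component R (C ∪ S) e₀ = C := by
  have hsub : component R (C ∪ S) e₀ ⊆ C := by
    refine component_subset_of_closed hC.1 fun t ht s hs hts => ?_
    rcases Finset.mem_union.1 (component_subset _ _ _ hs) with h | h
    · exact h
    · exact absurd (mem_relNhd.2 ⟨t, ht, hts⟩) (Finset.disjoint_left.1 hS h)
  refine hC.2 _ hsub ?_ fun t ht s hs hts => component_closed ht (Finset.mem_union_left _ hs) hts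
  intro x hx
  rw [Finset.mem_inter, Finset.mem_singleton] at hx
  rw [hx.1]
  exact mem_component_self (Finset.mem_union_left _ hC.1)

/-- A set containing the root is the disjoint union of the root's component C and a remainder that
avoids the neighbourhood of C, and this decomposition is a bijection. -/
theorem sum_powerset_eq_sum_polymers {M : Type*} [AddCommMonoid M] {R : E → E → Prop}
    (hR : ∀ e, R e e) (A : Finset E) (e₀ : E) (f : Finset E → M) :
    ∑ S ∈ A.powerset with e₀ ∈ S, f S
      = ∑ C ∈ polymers R A e₀, ∑ S ∈ (A \ relNhd R C).powerset, f (C ∪ S) := by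
  classical
  have hself : ∀ C : Finset E, C ⊆ relNhd R C := fun C c hc => mem_relNhd.2 ⟨c, hc, hR c⟩
  rw [Finset.sum_sigma']
  refine Finset.sum_bij' (fun S _ => ⟨component R S e₀, S \ component R S e₀⟩)
    (fun p _ => p.1 ∪ p.2) ?_ ?_ ?_ ?_ ?_
  · intro S hS
    rw [Finset.mem_filter, Finset.mem_powerset] at hS
    rw [Finset.mem_sigma, polymers, Finset.mem_filter, Finset.mem_powerset, Finset.mem_powerset]
    refine ⟨⟨(component_subset _ _ _).trans hS.1, isPolymer_component hS.2⟩, fun s hs => ?_⟩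
    rw [Finset.mem_sdiff] at hs ⊢
    refine ⟨hS.1 hs.1, fun h => hs.2 ?_⟩
    obtain ⟨c, hc, hcs⟩ := mem_relNhd.1 h
    exact component_closed hc hs.1 hcs
  · rintro ⟨C, S⟩ h
    rw [Finset.mem_sigma, polymers, Finset.mem_filter, Finset.mem_powerset,
      Finset.mem_powerset] at h
    rw [Finset.mem_filter, Finset.mem_powerset]
    exact ⟨Finset.union_subset h.1.1 (h.2.trans Finset.sdiff_subset),
      Finset.mem_union_left _ h.1.2.1⟩
  · intro S hS
    exact Finset.union_sdiff_of_subset (component_subset _ _ _)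
  · rintro ⟨C, S⟩ h
    rw [Finset.mem_sigma, polymers, Finset.mem_filter, Finset.mem_powerset,
      Finset.mem_powerset] at h
    have hd : Disjoint S (relNhd R C) :=
      (Finset.sdiff_disjoint).mono_left h.2
    have h1 := component_union h.1.2 hd
    simp only [h1]
    congr 1
    rw [Finset.union_sdiff_left, Finset.sdiff_eq_self_iff_disjoint]
    exact hd.mono_right (hself C)
  · intro S hS
    simp only
    rw [Finset.union_sdiff_of_subset (component_subset _ _ _)]

/-- The partition sum of a set function over the subsets of `A`. -/
def polymerSum (ζ : Finset E → ℂ) (A : Finset E) : ℂ := ∑ S ∈ A.powerset, ζ S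

theorem sum_eq_sum_polymers {R : E → E → Prop} (hR : ∀ e, R e e) {ζ ξ : Finset E → ℂ} {e₀ : E}
    (hmul : ∀ C S, e₀ ∈ C → Disjoint S (relNhd R C) → ξ (C ∪ S) = ξ C * ζ S) (A : Finset E) :
    ∑ S ∈ A.powerset with e₀ ∈ S, ξ S
      = ∑ C ∈ polymers R A e₀, ξ C * polymerSum ζ (A \ relNhd R C) := by
  classical
  rw [sum_powerset_eq_sum_polymers hR]
  refine Finset.sum_congr rfl fun C hC => ?_
  rw [polymers, Finset.mem_filter] at hC
  rw [polymerSum, Finset.mul_sum]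
  refine Finset.sum_congr rfl fun S hS => hmul _ _ hC.2.1 ?_
  exact (Finset.sdiff_disjoint).mono_left (Finset.mem_powerset.1 hS)

theorem polymerSum_erase_add (ζ : Finset E → ℂ) (A : Finset E) (e : E) :
    polymerSum ζ A = polymerSum ζ (A.erase e) + ∑ S ∈ A.powerset with e ∈ S, ζ S := by
  classical
  rw [polymerSum, ← Finset.sum_filter_not_add_sum_filter _ (fun S => e ∈ S), polymerSum]
  congr 1
  refine Finset.sum_congr ?_ fun _ _ => rfl
  ext S
  simp only [Finset.mem_filter, Finset.mem_powerset, Finset.subset_erase]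

/-- The neighbourhood of C has at most D|C| elements, so each polymer has effective activity (q
2^D)^|C|. Summing over rooted polymers costs another 2^D, which explains 4^D. -/
theorem norm_sum_polymers_le {R : E → E → Prop} (hR : ∀ e, R e e) {D : ℕ}
    (hD : ∀ e, (relNhd R {e}).card ≤ D) {q : ℝ} (hq : 0 ≤ q) (hqD : q * 4 ^ D ≤ 1)
    {ξ : Finset E → ℂ} (hξ : ∀ S, ‖ξ S‖ ≤ q ^ S.card) {ζ : Finset E → ℂ} {A : Finset E} {e₀ : E}
    {z : ℝ} (hz : 0 ≤ z)
    (hle : ∀ C ∈ polymers R A e₀,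
      ‖polymerSum ζ (A \ relNhd R C)‖ ≤ 2 ^ (relNhd R C).card * z) :
    ‖∑ C ∈ polymers R A e₀, ξ C * polymerSum ζ (A \ relNhd R C)‖ ≤ q * 4 ^ D * z := by
  have h4 : (4 : ℝ) ^ D = 2 ^ D * 2 ^ D := by rw [← mul_pow]; norm_num
  have h1 : ∑ C ∈ polymers R A e₀, (q * 2 ^ D) ^ C.card ≤ q * 2 ^ D * 2 ^ D :=
    sum_polymers_le hD (by positivity) (by rw [mul_assoc, ← h4]; exact hqD) A e₀ (hR e₀)
  calc _ ≤ ∑ C ∈ polymers R A e₀, (q * 2 ^ D) ^ C.card * z := by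
        refine (norm_sum_le _ _).trans (Finset.sum_le_sum fun C hC => ?_)
        rw [norm_mul]
        have h2 : (2 : ℝ) ^ (relNhd R C).card ≤ 2 ^ (D * C.card) :=
          pow_le_pow_right₀ (by norm_num) (card_relNhd_le hD C)
        calc ‖ξ C‖ * ‖polymerSum ζ (A \ relNhd R C)‖
            ≤ q ^ C.card * (2 ^ (D * C.card) * z) := by
              refine mul_le_mul (hξ C) ((hle C hC).trans ?_) (norm_nonneg _) (by positivity)
              gcongr
          _ = _ := by rw [mul_pow, pow_mul]; ring
    _ ≤ _ := by
        rw [← Finset.sum_mul, h4, ← mul_assoc]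
        gcongr

/-- Multiplicativity of a set function over unrelated sets. -/
def IsMultiplicative (R : E → E → Prop) (ζ : Finset E → ℂ) : Prop :=
  ζ ∅ = 1 ∧ ∀ C S, Disjoint S (relNhd R C) → ζ (C ∪ S) = ζ C * ζ S

/-- Points are removed one at a time, each at the price of a factor 2; points outside A cost
nothing. -/
theorem norm_polymerSum_sdiff_le {ζ : Finset E → ℂ} {A : Finset E}
    (h : ∀ B ⊆ A, ∀ e ∈ B, ‖polymerSum ζ (B.erase e)‖ ≤ 2 * ‖polymerSum ζ B‖) (N : Finset E) :
    ‖polymerSum ζ (A \ N)‖ ≤ 2 ^ N.card * ‖polymerSum ζ A‖ := by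
  induction N using Finset.induction_on with
  | empty => simp
  | insert a N ha ih =>
    rw [Finset.sdiff_insert, Finset.card_insert_of_notMem ha, pow_succ']
    by_cases haA : a ∈ A \ N
    · have := h _ Finset.sdiff_subset a haA
      calc _ ≤ _ := this
        _ ≤ 2 * (2 ^ N.card * ‖polymerSum ζ A‖) := by gcongr
        _ = _ := by ring
    · rw [Finset.erase_eq_of_notMem haA]
      refine ih.trans ?_
      rw [mul_assoc]
      have : 0 ≤ (2 : ℝ) ^ N.card * ‖polymerSum ζ A‖ := by positivity
      linarith

/-- The heart of the expansion, by strong induction on A. Expanding in the polymer C of e, the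
remaining partition sums live inside A without e, where the induction hypothesis bounds them by
2^|N(C)| times the sum for A without e. Hence restoring e changes the partition sum by at most half
the norm of the sum without e. -/
theorem norm_polymerSum_erase_le {R : E → E → Prop} (hR : ∀ e, R e e) {D : ℕ}
    (hD : ∀ e, (relNhd R {e}).card ≤ D) {q : ℝ} (hq : 0 ≤ q) (hqD : q * 4 ^ D ≤ 1 / 2)
    {ζ : Finset E → ℂ} (hζ : ∀ S, ‖ζ S‖ ≤ q ^ S.card) (hmul : IsMultiplicative R ζ)
    (A : Finset E) : ∀ e ∈ A, ‖polymerSum ζ (A.erase e)‖ ≤ 2 * ‖polymerSum ζ A‖ := by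
  induction A using Finset.strongInduction with
  | H A ih =>
    intro e he
    have h0 : ∀ N, ‖polymerSum ζ (A.erase e \ N)‖ ≤ 2 ^ N.card * ‖polymerSum ζ (A.erase e)‖ :=
      norm_polymerSum_sdiff_le fun B hB => ih B (hB.trans_ssubset (Finset.erase_ssubset he))
    have h1 := norm_sum_polymers_le hR hD hq (hqD.trans (by norm_num)) hζ (ζ := ζ) (A := A)
      (e₀ := e) (z := ‖polymerSum ζ (A.erase e)‖) (norm_nonneg _) (fun C hC => by
        -- The root e lies in its own neighbourhood by reflexivity, so the remainder sits in a
        -- proper subset of A, as the induction requires.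
        have : A \ relNhd R C = A.erase e \ relNhd R C := by
          classical
          rw [polymers, Finset.mem_filter] at hC
          ext x
          simp only [Finset.mem_sdiff, Finset.mem_erase]
          constructor
          · rintro ⟨hx, hn⟩
            refine ⟨⟨?_, hx⟩, hn⟩
            rintro rfl
            exact hn (mem_relNhd.2 ⟨_, hC.2.1, hR _⟩)
          · rintro ⟨⟨_, hx⟩, hn⟩
            exact ⟨hx, hn⟩
        rw [this]
        exact h0 _)
    rw [← sum_eq_sum_polymers hR (fun C S _ => hmul.2 C S) A] at h1
    have h2 := polymerSum_erase_add ζ A e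
    have h3 : polymerSum ζ (A.erase e)
        = polymerSum ζ A - ∑ S ∈ A.powerset with e ∈ S, ζ S := by rw [h2]; ring
    have h4 : ‖polymerSum ζ (A.erase e)‖
        ≤ ‖polymerSum ζ A‖ + ‖∑ S ∈ A.powerset with e ∈ S, ζ S‖ := by
      conv_lhs => rw [h3]
      exact norm_sub_le _ _
    have h5 : q * 4 ^ D * ‖polymerSum ζ (A.erase e)‖ ≤ 1 / 2 * ‖polymerSum ζ (A.erase e)‖ := by
      gcongr
    linarith

/-- Removing all points leads to the partition sum of the empty set, which equals 1; hence 1 ≤ 2^|A|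
|Z(A)|. -/
theorem polymerSum_ne_zero {R : E → E → Prop} (hR : ∀ e, R e e) {D : ℕ}
    (hD : ∀ e, (relNhd R {e}).card ≤ D) {q : ℝ} (hq : 0 ≤ q) (hqD : q * 4 ^ D ≤ 1 / 2)
    {ζ : Finset E → ℂ} (hζ : ∀ S, ‖ζ S‖ ≤ q ^ S.card) (hmul : IsMultiplicative R ζ)
    (A : Finset E) : polymerSum ζ A ≠ 0 := by
  have h := norm_polymerSum_sdiff_le (A := A)
    (fun B _ => norm_polymerSum_erase_le hR hD hq hqD hζ hmul B) A
  intro h0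
  rw [h0, Finset.sdiff_self] at h
  simp [polymerSum, hmul.1] at h
  linarith

/-- The bound on expectations of local insertions. -/
theorem norm_sum_insertion_le {R : E → E → Prop} (hR : ∀ e, R e e) {D : ℕ}
    (hD : ∀ e, (relNhd R {e}).card ≤ D) {q : ℝ} (hq : 0 ≤ q) (hqD : q * 4 ^ D ≤ 1 / 2)
    {ζ : Finset E → ℂ} (hζ : ∀ S, ‖ζ S‖ ≤ q ^ S.card) (hmul : IsMultiplicative R ζ)
    {ξ : Finset E → ℂ} (hξ : ∀ S, ‖ξ S‖ ≤ q ^ S.card) {e₀ : E}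
    (hξmul : ∀ C S, e₀ ∈ C → Disjoint S (relNhd R C) → ξ (C ∪ S) = ξ C * ζ S) (A : Finset E) :
    ‖∑ S ∈ A.powerset with e₀ ∈ S, ξ S‖ ≤ q * 4 ^ D * ‖polymerSum ζ A‖ := by
  -- Only the polymer of the root carries the modified weight; what is left is an ordinary partition
  -- sum, whose ratio to the full one is already controlled.
  rw [sum_eq_sum_polymers hR hξmul A]
  refine norm_sum_polymers_le hR hD hq (hqD.trans (by norm_num)) hξ (norm_nonneg _) fun C _ => ?_
  exact norm_polymerSum_sdiff_le
    (fun B _ => norm_polymerSum_erase_le hR hD hq hqD hζ hmul B) _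

end Polymer

/-! ### Gases of vector-valued currents -/

section Gas

variable {E : Type*} [Fintype E] [DecidableEq E]

open Classical in
/-- The support of a current. -/
def currentSupport (I : E → E3) : Finset E := Finset.univ.filter fun e => I e ≠ 0

theorem mem_currentSupport {I : E → E3} {e : E} : e ∈ currentSupport I ↔ I e ≠ 0 := by
  classical
  simp [currentSupport]

/-- Restriction of a current to a set of edges. -/
def restrictCurrent (I : E → E3) (C : Finset E) : E → E3 := fun e => if e ∈ C then I e else 0

/-- A finite family `𝓙` of currents with factorizing weights `K` and small activities. -/
structure IsCurrentGas (R : E → E → Prop) (𝓙 : Finset (E → E3)) (K : (E → E3) → ℝ)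
    (G : Finset E3) (b : ℝ) : Prop where
  zero_mem : 0 ∈ 𝓙
  weight_zero : K 0 = 1
  nonneg : ∀ I, 0 ≤ K I
  neg_mem : ∀ I ∈ 𝓙, -I ∈ 𝓙
  weight_neg : ∀ I ∈ 𝓙, K (-I) = K I
  restrict_mem : ∀ C S, Disjoint S (relNhd R C) → ∀ I ∈ 𝓙, currentSupport I = C ∪ S →
    restrictCurrent I C ∈ 𝓙 ∧ restrictCurrent I S ∈ 𝓙
  add_mem : ∀ I₁ ∈ 𝓙, ∀ I₂ ∈ 𝓙, Disjoint (currentSupport I₂) (relNhd R (currentSupport I₁)) →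
    I₁ + I₂ ∈ 𝓙
  weight_add : ∀ I₁ ∈ 𝓙, ∀ I₂ ∈ 𝓙,
    Disjoint (currentSupport I₂) (relNhd R (currentSupport I₁)) → K (I₁ + I₂) = K I₁ * K I₂
  values : ∀ I ∈ 𝓙, ∀ e, I e ≠ 0 → I e ∈ G
  weight_le : ∀ I ∈ 𝓙, K I ≤ Real.exp (-(b * ∑ e, ‖I e‖))

/-- The pairing `⟨θ, I⟩`. -/
def pairing (θ : E × Fin 3 → ℂ) (I : E → E3) : ℂ := ∑ a, θ a * (I a.1 a.2 : ℂ)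

theorem pairing_add_right (θ : E × Fin 3 → ℂ) (I₁ I₂ : E → E3) :
    pairing θ (I₁ + I₂) = pairing θ I₁ + pairing θ I₂ := by
  simp [pairing, mul_add, Finset.sum_add_distrib]

theorem pairing_line (θ η : E × Fin 3 → ℂ) (s : ℂ) (I : E → E3) :
    pairing (fun a => θ a + s * η a) I = pairing θ I + s * pairing η I := by
  simp only [pairing, add_mul, Finset.sum_add_distrib, Finset.mul_sum, mul_assoc]

/-- The real pairing `⟨θ, I⟩`. -/
def realPairing (θ : E × Fin 3 → ℝ) (I : E → E3) : ℝ := ∑ a, θ a * I a.1 a.2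

theorem pairing_ofReal (θ : E × Fin 3 → ℝ) (I : E → E3) :
    pairing (fun a => (θ a : ℂ)) I = (realPairing θ I : ℂ) := by
  simp [pairing, realPairing]

theorem realPairing_neg (θ : E × Fin 3 → ℝ) (I : E → E3) :
    realPairing θ (-I) = -realPairing θ I := by
  simp [realPairing]

theorem realPairing_line (θ σ : E × Fin 3 → ℝ) (t : ℝ) (I : E → E3) :
    realPairing (fun a => θ a + t * σ a) I = realPairing θ I + t * realPairing σ I := by
  simp only [realPairing, add_mul, Finset.sum_add_distrib, Finset.mul_sum, mul_assoc]

theorem abs_coord_le_norm (x : E3) (k : Fin 3) : |x k| ≤ ‖x‖ := by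
  simpa using PiLp.norm_apply_le x k

theorem abs_im_pairing_le {θ : E × Fin 3 → ℂ} (hθ : ∀ a, |(θ a).im| ≤ 1) (I : E → E3) :
    |(pairing θ I).im| ≤ 3 * ∑ e, ‖I e‖ := by
  rw [pairing, Complex.im_sum]
  refine (Finset.abs_sum_le_sum_abs _ _).trans ?_
  rw [Fintype.sum_prod_type, Finset.mul_sum]
  refine Finset.sum_le_sum fun e _ => ?_
  calc ∑ k : Fin 3, |(θ (e, k) * (I e k : ℂ)).im| ≤ ∑ _k : Fin 3, ‖I e‖ := by
        refine Finset.sum_le_sum fun k _ => ?_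
        rw [Complex.im_mul_ofReal, abs_mul]
        calc _ ≤ 1 * ‖I e‖ := by
              gcongr
              · exact hθ _
              · exact abs_coord_le_norm _ _
          _ = _ := one_mul _
    _ = _ := by simp

/-- The complex weight `K(I) exp(i⟨θ, I⟩)`. -/
def complexWeight (K : (E → E3) → ℝ) (θ : E × Fin 3 → ℂ) (I : E → E3) : ℂ :=
  K I * Complex.exp (Complex.I * pairing θ I)

theorem norm_complexWeight (K : (E → E3) → ℝ) (θ : E × Fin 3 → ℂ) (I : E → E3) :
    ‖complexWeight K θ I‖ = |K I| * Real.exp (-(pairing θ I).im) := by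
  rw [complexWeight, norm_mul, Complex.norm_exp, Complex.norm_real, Real.norm_eq_abs]
  simp

open Classical in
/-- The sum of `f` over the currents with support `S`. -/
def supportSum (𝓙 : Finset (E → E3)) (f : (E → E3) → ℂ) (S : Finset E) : ℂ :=
  ∑ I ∈ 𝓙 with currentSupport I = S, f I

/-- The one-edge activity. -/
def edgeActivity (G : Finset E3) (b : ℝ) : ℝ := ∑ g ∈ G, Real.exp (-((b - 4) * ‖g‖))

theorem edgeActivity_nonneg (G : Finset E3) (b : ℝ) : 0 ≤ edgeActivity G b :=
  Finset.sum_nonneg fun _ _ => (Real.exp_pos _).le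

variable {R : E → E → Prop} {𝓙 : Finset (E → E3)} {K : (E → E3) → ℝ} {G : Finset E3} {b : ℝ}

/-- The bound on f factorizes over edges. Enlarging the sum to all assignments with values in G on S
and 0 elsewhere turns it into a product of one-edge sums. -/
theorem IsCurrentGas.norm_supportSum_le (h : IsCurrentGas R 𝓙 K G b) {f : (E → E3) → ℂ}
    (hf : ∀ I ∈ 𝓙, ‖f I‖ ≤ Real.exp (-((b - 4) * ∑ e, ‖I e‖))) (S : Finset E) :
    ‖supportSum 𝓙 f S‖ ≤ edgeActivity G b ^ S.card := by
  classical
  let t : E → Finset E3 := fun e => if e ∈ S then G else {0}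
  let F : E → E3 → ℝ := fun e g => Real.exp (-((b - 4) * ‖g‖))
  have h1 : ∏ e, ∑ g ∈ t e, F e g = edgeActivity G b ^ S.card := by
    rw [← Finset.prod_const, ← Finset.prod_subset (Finset.subset_univ S)]
    · exact Finset.prod_congr rfl fun e he => by simp [t, he, edgeActivity, F]
    · intro e _ he
      simp [t, he, F]
  rw [← h1, Finset.prod_univ_sum]
  refine (norm_sum_le _ _).trans ?_
  refine (Finset.sum_le_sum (g := fun I => ∏ e, F e (I e)) fun I hI => ?_).trans ?_
  · refine (hf I (Finset.mem_filter.1 hI).1).trans_eq ?_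
    rw [← Real.exp_sum, Finset.mul_sum, Finset.sum_neg_distrib]
  · refine Finset.sum_le_sum_of_subset_of_nonneg ?_ fun I _ _ =>
      Finset.prod_nonneg fun e _ => (Real.exp_pos _).le
    intro I hI
    rw [Finset.mem_filter] at hI
    rw [Fintype.mem_piFinset]
    intro e
    by_cases he : e ∈ S
    · simp only [t, he, if_true]
      rw [← hI.2, mem_currentSupport] at he
      exact h.values I hI.1 e he
    · simp only [t, he, if_false, Finset.mem_singleton]
      rw [← hI.2, mem_currentSupport, not_not] at he
      exact he

theorem currentSupport_add {C S : Finset E} (hd : Disjoint C S) {I₁ I₂ : E → E3}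
    (h₁ : currentSupport I₁ = C) (h₂ : currentSupport I₂ = S) :
    currentSupport (I₁ + I₂) = C ∪ S := by
  ext e
  rw [mem_currentSupport, Finset.mem_union, Pi.add_apply]
  have he : e ∈ C → e ∉ S := fun h => Finset.disjoint_left.1 hd h
  rw [← h₁, ← h₂, mem_currentSupport, mem_currentSupport, not_not] at he
  rw [← h₁, ← h₂, mem_currentSupport, mem_currentSupport]
  by_cases hC : I₁ e = 0
  · simp [hC]
  · simp [hC, he hC]

theorem currentSupport_restrict {I : E → E3} {C : Finset E} (hC : C ⊆ currentSupport I) :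
    currentSupport (restrictCurrent I C) = C := by
  ext e
  rw [mem_currentSupport, restrictCurrent]
  by_cases he : e ∈ C
  · simpa [he] using mem_currentSupport.1 (hC he)
  · simp [he]

/-- Currents supported on C ∪ S correspond to pairs of currents supported on C and on S, by
restriction and addition. Three functions are allowed so that an insertion can be placed on the C
part alone. -/
theorem IsCurrentGas.supportSum_union (h : IsCurrentGas R 𝓙 K G b) (hR : ∀ e, R e e)
    {f g w : (E → E3) → ℂ} {C S : Finset E} (hd : Disjoint S (relNhd R C))
    (hf : ∀ I₁ ∈ 𝓙, ∀ I₂ ∈ 𝓙, currentSupport I₁ = C → currentSupport I₂ = S →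
      f (I₁ + I₂) = g I₁ * w I₂) :
    supportSum 𝓙 f (C ∪ S) = supportSum 𝓙 g C * supportSum 𝓙 w S := by
  classical
  have hCS : Disjoint C S := by
    refine (hd.mono_right fun c hc => ?_).symm
    exact mem_relNhd.2 ⟨c, hc, hR c⟩
  rw [supportSum, supportSum, supportSum, Finset.sum_mul_sum, ← Finset.sum_product']
  refine Finset.sum_bij' (fun I _ => (restrictCurrent I C, restrictCurrent I S))
    (fun p _ => p.1 + p.2) ?_ ?_ ?_ ?_ ?_
  · intro I hI
    rw [Finset.mem_filter] at hI
    have := h.restrict_mem C S hd I hI.1 hI.2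
    simp only [Finset.mem_product, Finset.mem_filter]
    exact ⟨⟨this.1, currentSupport_restrict (by rw [hI.2]; exact Finset.subset_union_left)⟩,
      this.2, currentSupport_restrict (by rw [hI.2]; exact Finset.subset_union_right)⟩
  · rintro ⟨I₁, I₂⟩ hI
    simp only [Finset.mem_product, Finset.mem_filter] at hI ⊢
    exact ⟨h.add_mem _ hI.1.1 _ hI.2.1 (by rw [hI.1.2, hI.2.2]; exact hd),
      currentSupport_add hCS hI.1.2 hI.2.2⟩
  · intro I hI
    rw [Finset.mem_filter] at hI
    ext1 e
    simp only [Pi.add_apply, restrictCurrent]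
    by_cases hC : e ∈ C
    · simp [hC, Finset.disjoint_left.1 hCS hC]
    · by_cases hS : e ∈ S
      · simp [hC, hS]
      · have : e ∉ currentSupport I := by rw [hI.2]; simp [hC, hS]
        rw [mem_currentSupport, not_not] at this
        simp [this]
  · rintro ⟨I₁, I₂⟩ hI
    simp only [Finset.mem_product, Finset.mem_filter] at hI
    have key : ∀ e, (e ∈ C → I₂ e = 0) ∧ (e ∉ C → I₁ e = 0) ∧ (e ∉ S → I₂ e = 0) ∧
        (e ∈ S → I₁ e = 0) := by
      intro e
      have h1 : ∀ e, e ∉ C → I₁ e = 0 := fun e he => by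
        rwa [← hI.1.2, mem_currentSupport, not_not] at he
      have h2 : ∀ e, e ∉ S → I₂ e = 0 := fun e he => by
        rwa [← hI.2.2, mem_currentSupport, not_not] at he
      exact ⟨fun he => h2 e (Finset.disjoint_left.1 hCS he), h1 e, h2 e,
        fun he => h1 e (Finset.disjoint_right.1 hCS he)⟩
    refine Prod.ext (funext fun e => ?_) (funext fun e => ?_)
    · simp only [restrictCurrent, Pi.add_apply]
      split_ifs with he
      · rw [(key e).1 he, add_zero]
      · rw [(key e).2.1 he]
    · simp only [restrictCurrent, Pi.add_apply]
      split_ifs with he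
      · rw [(key e).2.2.2 he, zero_add]
      · rw [(key e).2.2.1 he]
  · intro I hI
    rw [Finset.mem_filter] at hI
    have h1 := h.restrict_mem C S hd I hI.1 hI.2
    rw [← hf _ h1.1 _ h1.2 (currentSupport_restrict (by rw [hI.2]; exact Finset.subset_union_left))
      (currentSupport_restrict (by rw [hI.2]; exact Finset.subset_union_right))]
    congr 1
    ext1 e
    simp only [Pi.add_apply, restrictCurrent]
    by_cases hC : e ∈ C
    · simp [hC, Finset.disjoint_left.1 hCS hC]
    · by_cases hS : e ∈ S
      · simp [hC, hS]
      · have : e ∉ currentSupport I := by rw [hI.2]; simp [hC, hS]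
        rw [mem_currentSupport, not_not] at this
        simp [this]

/-- An imaginary field of size at most 1 in each of the three coordinates uses up 3 units of the
decay rate b. One more unit is reserved for insertions, hence the rate b - 4 in `edgeActivity`. -/
theorem IsCurrentGas.norm_complexWeight_le (h : IsCurrentGas R 𝓙 K G b) {θ : E × Fin 3 → ℂ}
    (hθ : ∀ a, |(θ a).im| ≤ 1) {I : E → E3} (hI : I ∈ 𝓙) :
    ‖complexWeight K θ I‖ ≤ Real.exp (-((b - 3) * ∑ e, ‖I e‖)) := by
  rw [norm_complexWeight, abs_of_nonneg (h.nonneg I)]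
  calc _ ≤ Real.exp (-(b * ∑ e, ‖I e‖)) * Real.exp (3 * ∑ e, ‖I e‖) := by
        gcongr
        · exact h.weight_le I hI
        · have := abs_im_pairing_le hθ I
          have := neg_abs_le (pairing θ I).im
          linarith
    _ = _ := by rw [← Real.exp_add]; ring_nf

theorem IsCurrentGas.weight_mul (h : IsCurrentGas R 𝓙 K G b) (θ : E × Fin 3 → ℂ)
    {I₁ I₂ : E → E3} (h₁ : I₁ ∈ 𝓙) (h₂ : I₂ ∈ 𝓙)
    (hd : Disjoint (currentSupport I₂) (relNhd R (currentSupport I₁))) :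
    complexWeight K θ (I₁ + I₂) = complexWeight K θ I₁ * complexWeight K θ I₂ := by
  rw [complexWeight, complexWeight, complexWeight, h.weight_add _ h₁ _ h₂ hd, pairing_add_right,
    mul_add, Complex.exp_add]
  push_cast
  ring

/-- The partition sum of the gas in the external field `θ`. -/
def gasSum (𝓙 : Finset (E → E3)) (K : (E → E3) → ℝ) (θ : E × Fin 3 → ℂ) (f : (E → E3) → ℂ) : ℂ :=
  ∑ I ∈ 𝓙, f I * complexWeight K θ I

theorem polymerSum_supportSum (f : (E → E3) → ℂ) :
    polymerSum (supportSum 𝓙 f) Finset.univ = ∑ I ∈ 𝓙, f I := by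
  classical
  rw [polymerSum]
  simp only [supportSum]
  exact Finset.sum_fiberwise_of_maps_to (fun I _ => Finset.mem_powerset.2 (Finset.subset_univ _)) _

theorem IsCurrentGas.isMultiplicative (h : IsCurrentGas R 𝓙 K G b) (hR : ∀ e, R e e)
    (θ : E × Fin 3 → ℂ) : IsMultiplicative R (supportSum 𝓙 (complexWeight K θ)) := by
  classical
  constructor
  · have : {I ∈ 𝓙 | currentSupport I = ∅} = {0} := by
      ext I
      rw [Finset.mem_filter, Finset.mem_singleton]
      constructor
      · rintro ⟨_, h2⟩
        ext1 e
        have : e ∉ currentSupport I := by simp [h2]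
        rwa [mem_currentSupport, not_not] at this
      · rintro rfl
        refine ⟨h.zero_mem, ?_⟩
        ext e
        simp [mem_currentSupport]
    have h0 : complexWeight K θ 0 = 1 := by simp [complexWeight, h.weight_zero, pairing]
    rw [supportSum, ← h0, ← Finset.sum_singleton (complexWeight K θ) 0]
    exact Finset.sum_congr (by convert this) fun _ _ => rfl
  · intro C S hd
    refine h.supportSum_union hR hd fun I₁ h₁ I₂ h₂ hC hS => ?_
    exact h.weight_mul θ h₁ h₂ (by rw [hC, hS]; exact hd)

theorem IsCurrentGas.norm_weight_le' (h : IsCurrentGas R 𝓙 K G b) {θ : E × Fin 3 → ℂ}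
    (hθ : ∀ a, |(θ a).im| ≤ 1) :
    ∀ I ∈ 𝓙, ‖complexWeight K θ I‖ ≤ Real.exp (-((b - 4) * ∑ e, ‖I e‖)) := by
  intro I hI
  refine (h.norm_complexWeight_le hθ hI).trans (Real.exp_le_exp.2 ?_)
  have : 0 ≤ ∑ e, ‖I e‖ := Finset.sum_nonneg fun _ _ => norm_nonneg _
  linarith

theorem gasSum_one (θ : E × Fin 3 → ℂ) :
    gasSum 𝓙 K θ 1 = polymerSum (supportSum 𝓙 (complexWeight K θ)) Finset.univ := by
  rw [polymerSum_supportSum, gasSum]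
  simp

variable {D : ℕ}

theorem IsCurrentGas.gasSum_ne_zero (h : IsCurrentGas R 𝓙 K G b) (hR : ∀ e, R e e)
    (hD : ∀ e, (relNhd R {e}).card ≤ D) (hqD : edgeActivity G b * 4 ^ D ≤ 1 / 2)
    {θ : E × Fin 3 → ℂ} (hθ : ∀ a, |(θ a).im| ≤ 1) : gasSum 𝓙 K θ 1 ≠ 0 := by
  rw [gasSum_one]
  exact polymerSum_ne_zero hR hD (edgeActivity_nonneg _ _) hqD
    (h.norm_supportSum_le (h.norm_weight_le' hθ)) (h.isMultiplicative hR θ) _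

/-- The insertion vanishes unless edge a.1 is occupied, so that edge serves as root of the polymer
expansion, with the factor I_a absorbed into the weight of the root polymer. -/
theorem IsCurrentGas.norm_insertion_le (h : IsCurrentGas R 𝓙 K G b) (hR : ∀ e, R e e)
    (hD : ∀ e, (relNhd R {e}).card ≤ D) (hqD : edgeActivity G b * 4 ^ D ≤ 1 / 2)
    {θ : E × Fin 3 → ℂ} (hθ : ∀ a, |(θ a).im| ≤ 1) (a : E × Fin 3) :
    ‖gasSum 𝓙 K θ (fun I => (I a.1 a.2 : ℂ))‖
      ≤ edgeActivity G b * 4 ^ D * ‖gasSum 𝓙 K θ 1‖ := by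
  classical
  set f : (E → E3) → ℂ := fun I => (I a.1 a.2 : ℂ) * complexWeight K θ I with hf
  have hbound : ∀ I ∈ 𝓙, ‖f I‖ ≤ Real.exp (-((b - 4) * ∑ e, ‖I e‖)) := by
    intro I hI
    rw [hf, norm_mul, Complex.norm_real, Real.norm_eq_abs]
    -- The fourth unit of decay rate pays for the unbounded insertion.
    have h1 : |I a.1 a.2| ≤ Real.exp (∑ e, ‖I e‖) := by
      refine (abs_coord_le_norm _ _).trans ?_
      refine (Finset.single_le_sum (f := fun e => ‖I e‖) (fun _ _ => norm_nonneg _)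
        (Finset.mem_univ a.1)).trans ?_
      have := Real.add_one_le_exp (∑ e, ‖I e‖)
      linarith
    calc _ ≤ Real.exp (∑ e, ‖I e‖) * Real.exp (-((b - 3) * ∑ e, ‖I e‖)) := by
          gcongr
          exact h.norm_complexWeight_le hθ hI
      _ = _ := by rw [← Real.exp_add]; ring_nf
  have h1 : gasSum 𝓙 K θ (fun I => (I a.1 a.2 : ℂ))
      = ∑ S ∈ (Finset.univ : Finset E).powerset with a.1 ∈ S, supportSum 𝓙 f S := by
    rw [gasSum, ← polymerSum_supportSum, polymerSum, Finset.sum_filter]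
    refine Finset.sum_congr rfl fun S _ => ?_
    split_ifs with haS
    · rfl
    · refine Finset.sum_eq_zero fun I hI => ?_
      rw [Finset.mem_filter] at hI
      rw [← hI.2, mem_currentSupport, not_not] at haS
      simp [haS]
  rw [h1, gasSum_one]
  refine norm_sum_insertion_le hR hD (edgeActivity_nonneg _ _) hqD
    (h.norm_supportSum_le (h.norm_weight_le' hθ)) (h.isMultiplicative hR θ)
    (h.norm_supportSum_le hbound) (fun C S haC hd => ?_) _
  refine h.supportSum_union hR hd fun I₁ h₁ I₂ h₂ hC hS => ?_
  -- The root edge belongs to C, so the insertion sees only the current on C.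
  have ha : I₂ a.1 = 0 := by
    have : a.1 ∉ S := fun hs => Finset.disjoint_left.1 hd hs (mem_relNhd.2 ⟨_, haC, hR _⟩)
    rwa [← hS, mem_currentSupport, not_not] at this
  rw [hf]
  simp only [Pi.add_apply]
  rw [h.weight_mul θ h₁ h₂ (by rw [hC, hS]; exact hd), ha]
  simp [mul_assoc]

end Gas

/-! ### Second derivatives of the logarithmic partition sum and the Gaussian mixture -/

section GasHessian

variable {E : Type*} [Fintype E] [DecidableEq E]

variable {R : E → E → Prop} {𝓙 : Finset (E → E3)} {K : (E → E3) → ℝ} {G : Finset E3} {b : ℝ}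
  {D : ℕ}

theorem hasDerivAt_gasSum_line (θ η : E × Fin 3 → ℂ) (f : (E → E3) → ℂ) (s : ℂ) :
    HasDerivAt (fun s => gasSum 𝓙 K (fun a => θ a + s * η a) f)
      (gasSum 𝓙 K (fun a => θ a + s * η a) fun I => f I * (Complex.I * pairing η I)) s := by
  simp only [gasSum, complexWeight, pairing_line]
  refine HasDerivAt.fun_sum fun I _ => ?_
  have h1 : HasDerivAt (fun s : ℂ => Complex.I * (pairing θ I + s * pairing η I))
      (Complex.I * pairing η I) s := by
    simpa using (((hasDerivAt_id s).mul_const (pairing η I)).const_add (pairing θ I)).const_mul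
      Complex.I
  exact ((h1.cexp.const_mul (K I : ℂ)).const_mul (f I)).congr_deriv (by ring)

/-- The truncated two-point functions of the gas. -/
def truncatedTwoPoint (𝓙 : Finset (E → E3)) (K : (E → E3) → ℝ) (θ : E × Fin 3 → ℂ)
    (a c : E × Fin 3) : ℂ :=
  (gasSum 𝓙 K θ (fun I => (I a.1 a.2 : ℂ) * I c.1 c.2) * gasSum 𝓙 K θ 1
    - gasSum 𝓙 K θ (fun I => (I a.1 a.2 : ℂ)) * gasSum 𝓙 K θ (fun I => (I c.1 c.2 : ℂ)))
    / gasSum 𝓙 K θ 1 ^ 2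

theorem truncatedTwoPoint_comm (θ : E × Fin 3 → ℂ) (a c : E × Fin 3) :
    truncatedTwoPoint 𝓙 K θ a c = truncatedTwoPoint 𝓙 K θ c a := by
  rw [truncatedTwoPoint, truncatedTwoPoint, mul_comm (gasSum 𝓙 K θ fun I => (I a.1 a.2 : ℂ))]
  simp only [mul_comm]

theorem gasSum_mul_pairing (θ η : E × Fin 3 → ℂ) (f : (E → E3) → ℂ) :
    gasSum 𝓙 K θ (fun I => f I * pairing η I)
      = ∑ c, η c * gasSum 𝓙 K θ (fun I => f I * I c.1 c.2) := by
  simp only [gasSum, pairing, Finset.mul_sum, Finset.sum_mul]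
  rw [Finset.sum_comm]
  refine Finset.sum_congr rfl fun c _ => Finset.sum_congr rfl fun I _ => ?_
  ring

theorem gasSum_const_mul (θ : E × Fin 3 → ℂ) (f : (E → E3) → ℂ) (z : ℂ) :
    gasSum 𝓙 K θ (fun I => z * f I) = z * gasSum 𝓙 K θ f := by
  simp only [gasSum, Finset.mul_sum, mul_assoc]

theorem sum_mul_truncatedTwoPoint (θ η : E × Fin 3 → ℂ) (a : E × Fin 3) :
    ∑ c, η c * truncatedTwoPoint 𝓙 K θ a c
      = (gasSum 𝓙 K θ (fun I => (I a.1 a.2 : ℂ) * pairing η I) * gasSum 𝓙 K θ 1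
        - gasSum 𝓙 K θ (fun I => (I a.1 a.2 : ℂ)) * gasSum 𝓙 K θ (pairing η))
        / gasSum 𝓙 K θ 1 ^ 2 := by
  have h1 : gasSum 𝓙 K θ (pairing η) = ∑ c, η c * gasSum 𝓙 K θ (fun I => (I c.1 c.2 : ℂ)) := by
    have := gasSum_mul_pairing (𝓙 := 𝓙) (K := K) θ η 1
    simpa using this
  rw [gasSum_mul_pairing, h1, Finset.sum_mul, Finset.mul_sum, ← Finset.sum_sub_distrib,
    Finset.sum_div]
  refine Finset.sum_congr rfl fun c _ => ?_
  rw [truncatedTwoPoint]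
  ring

/-- Cauchy's estimate for the expectation of I_a in the field θ + sη. Since θ is real and |η| ≤ 1,
the closed unit disc in s stays in the zero-free region, where the expectation is holomorphic and
bounded by the insertion estimate. Its derivative at s = 0 is i times the sum in question. -/
theorem IsCurrentGas.norm_sum_mul_truncatedTwoPoint_le (h : IsCurrentGas R 𝓙 K G b)
    (hR : ∀ e, R e e) (hD : ∀ e, (relNhd R {e}).card ≤ D)
    (hqD : edgeActivity G b * 4 ^ D ≤ 1 / 2) (θ : E × Fin 3 → ℝ) {η : E × Fin 3 → ℂ}
    (hη : ∀ a, ‖η a‖ ≤ 1) (a : E × Fin 3) :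
    ‖∑ c, η c * truncatedTwoPoint 𝓙 K (fun a => (θ a : ℂ)) a c‖ ≤ edgeActivity G b * 4 ^ D := by
  set θ' : E × Fin 3 → ℂ := fun a => (θ a : ℂ)
  set f : (E → E3) → ℂ := fun I => (I a.1 a.2 : ℂ)
  have hstrip : ∀ s : ℂ, ‖s‖ ≤ 1 → ∀ a, |(θ' a + s * η a).im| ≤ 1 := by
    intro s hs a
    have : (θ' a + s * η a).im = (s * η a).im := by simp [θ']
    rw [this]
    refine (Complex.abs_im_le_norm _).trans ?_
    rw [norm_mul]
    exact mul_le_one₀ hs (norm_nonneg _) (hη a)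
  have hne : ∀ s : ℂ, ‖s‖ ≤ 1 → gasSum 𝓙 K (fun a => θ' a + s * η a) 1 ≠ 0 := fun s hs =>
    h.gasSum_ne_zero hR hD hqD (hstrip s hs)
  set F : ℂ → ℂ := fun s => gasSum 𝓙 K (fun a => θ' a + s * η a) f
    / gasSum 𝓙 K (fun a => θ' a + s * η a) 1
  have hF : ∀ s : ℂ, ‖s‖ ≤ 1 → HasDerivAt F _ s := fun s hs =>
    (hasDerivAt_gasSum_line θ' η f s).div (hasDerivAt_gasSum_line θ' η 1 s) (hne s hs)
  have hdiff : DiffContOnCl ℂ F (Metric.ball 0 1) := by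
    refine DifferentiableOn.diffContOnCl fun s hs => ?_
    rw [closure_ball _ one_ne_zero, mem_closedBall_zero_iff] at hs
    exact (hF s hs).differentiableAt.differentiableWithinAt
  have hle : ∀ s ∈ Metric.sphere (0 : ℂ) 1, ‖F s‖ ≤ edgeActivity G b * 4 ^ D := by
    intro s hs
    rw [mem_sphere_zero_iff_norm] at hs
    rw [norm_div, div_le_iff₀ (norm_pos_iff.2 (hne s hs.le))]
    exact h.norm_insertion_le hR hD hqD (hstrip s hs.le) a
  have hC := Complex.norm_deriv_le_of_forall_mem_sphere_norm_le one_pos hdiff hle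
  rw [(hF 0 (by simp)).deriv, div_one] at hC
  simp only [zero_mul, add_zero] at hC
  have e1 : gasSum 𝓙 K θ' (fun I => f I * (Complex.I * pairing η I))
      = Complex.I * gasSum 𝓙 K θ' (fun I => f I * pairing η I) := by
    rw [← gasSum_const_mul]; congr 1; ext I; ring
  have e2 : gasSum 𝓙 K θ' (fun I => (1 : (E → E3) → ℂ) I * (Complex.I * pairing η I))
      = Complex.I * gasSum 𝓙 K θ' (pairing η) := by
    rw [← gasSum_const_mul]; congr 1; ext I; simp
  rw [e1, e2] at hC
  rw [sum_mul_truncatedTwoPoint]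
  refine le_trans (le_of_eq ?_) hC
  rw [mul_assoc, mul_left_comm (gasSum 𝓙 K θ' f), ← mul_sub, mul_div_assoc, norm_mul,
    Complex.norm_I, one_mul]

/-- Duality between ℓ¹ and ℓ^∞: the direction η is chosen as the conjugate phases of the row. Where
an entry vanishes, division by zero gives η = 0. -/
theorem IsCurrentGas.sum_norm_truncatedTwoPoint_le (h : IsCurrentGas R 𝓙 K G b)
    (hR : ∀ e, R e e) (hD : ∀ e, (relNhd R {e}).card ≤ D)
    (hqD : edgeActivity G b * 4 ^ D ≤ 1 / 2) (θ : E × Fin 3 → ℝ) (a : E × Fin 3) :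
    ∑ c, ‖truncatedTwoPoint 𝓙 K (fun a => (θ a : ℂ)) a c‖ ≤ edgeActivity G b * 4 ^ D := by
  set T := truncatedTwoPoint 𝓙 K (fun a => (θ a : ℂ)) a
  let η : E × Fin 3 → ℂ := fun c => (starRingEnd ℂ) (T c) / ‖T c‖
  have hη : ∀ c, ‖η c‖ ≤ 1 := by
    intro c
    simp only [η, norm_div, RCLike.norm_conj, Complex.norm_real, norm_norm]
    exact div_self_le_one _
  have hη2 : ∀ c, η c * T c = (‖T c‖ : ℂ) := by
    intro c
    simp only [η]
    by_cases h0 : T c = 0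
    · simp [h0]
    · have : (‖T c‖ : ℂ) ≠ 0 := by simpa using h0
      rw [div_mul_eq_mul_div, Complex.conj_mul', div_eq_iff this, sq]
  have := h.norm_sum_mul_truncatedTwoPoint_le hR hD hqD θ hη a
  rw [show (∑ c, η c * truncatedTwoPoint 𝓙 K (fun a => (θ a : ℂ)) a c)
    = ((∑ c, ‖T c‖ : ℝ) : ℂ) by push_cast; exact Finset.sum_congr rfl fun c _ => hη2 c,
    Complex.norm_real, Real.norm_eq_abs] at this
  exact (le_abs_self _).trans this

/-- A Schur test for symmetric kernels. -/
theorem norm_sum_sum_mul_le {ι : Type*} [Fintype ι] {T : ι → ι → ℂ} (hT : ∀ a c, T a c = T c a)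
    {δ : ℝ} (hδ : ∀ a, ∑ c, ‖T a c‖ ≤ δ) (σ : ι → ℝ) :
    ‖∑ a, ∑ c, (σ a : ℂ) * σ c * T a c‖ ≤ δ * ∑ a, σ a ^ 2 := by
  have h1 : ∑ a, ∑ c, σ a ^ 2 * ‖T a c‖ ≤ δ * ∑ a, σ a ^ 2 := by
    rw [Finset.mul_sum]
    refine Finset.sum_le_sum fun a _ => ?_
    rw [← Finset.mul_sum, mul_comm]
    exact mul_le_mul_of_nonneg_right (hδ a) (sq_nonneg _)
  have h2 : ∑ a, ∑ c, σ c ^ 2 * ‖T a c‖ = ∑ a, ∑ c, σ a ^ 2 * ‖T a c‖ := by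
    rw [Finset.sum_comm]
    simp only [hT]
  calc _ ≤ ∑ a, ∑ c, (σ a ^ 2 * ‖T a c‖ / 2 + σ c ^ 2 * ‖T a c‖ / 2) := by
        refine (norm_sum_le _ _).trans (Finset.sum_le_sum fun a _ => (norm_sum_le _ _).trans
          (Finset.sum_le_sum fun c _ => ?_))
        rw [norm_mul, norm_mul, Complex.norm_real, Complex.norm_real, Real.norm_eq_abs,
          Real.norm_eq_abs, ← add_div, ← add_mul, mul_div_right_comm]
        refine mul_le_mul_of_nonneg_right ?_ (norm_nonneg _)
        have := sq_nonneg (|σ a| - |σ c|)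
        rw [← sq_abs (σ a), ← sq_abs (σ c)]
        linarith
    _ = ∑ a, ∑ c, σ a ^ 2 * ‖T a c‖ := by
        simp only [Finset.sum_add_distrib, ← Finset.sum_div]
        rw [h2]; ring
    _ ≤ _ := h1

/-- The expression is the quadratic form of the truncated two-point functions at σ, so the Schur
test applies to their row sums. -/
theorem IsCurrentGas.norm_variance_le (h : IsCurrentGas R 𝓙 K G b)
    (hR : ∀ e, R e e) (hD : ∀ e, (relNhd R {e}).card ≤ D)
    (hqD : edgeActivity G b * 4 ^ D ≤ 1 / 2) (θ σ : E × Fin 3 → ℝ) :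
    ‖(gasSum 𝓙 K (fun a => (θ a : ℂ)) (fun I => (realPairing σ I : ℂ) ^ 2)
          * gasSum 𝓙 K (fun a => (θ a : ℂ)) 1
        - gasSum 𝓙 K (fun a => (θ a : ℂ)) (fun I => (realPairing σ I : ℂ)) ^ 2)
        / gasSum 𝓙 K (fun a => (θ a : ℂ)) 1 ^ 2‖ ≤ edgeActivity G b * 4 ^ D * ∑ a, σ a ^ 2 := by
  set θ' : E × Fin 3 → ℂ := fun a => (θ a : ℂ)
  have key := norm_sum_sum_mul_le (T := truncatedTwoPoint 𝓙 K θ') (truncatedTwoPoint_comm θ')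
    (h.sum_norm_truncatedTwoPoint_le hR hD hqD θ) σ
  refine le_trans (le_of_eq ?_) key
  congr 1
  simp only [mul_assoc, ← Finset.mul_sum]
  have h1 : ∀ a, ∑ c, (σ c : ℂ) * truncatedTwoPoint 𝓙 K θ' a c = _ :=
    fun a => sum_mul_truncatedTwoPoint θ' (fun c => (σ c : ℂ)) a
  simp only [h1]
  have h2 : (fun I : E → E3 => (realPairing σ I : ℂ)) = pairing (fun c => (σ c : ℂ)) := by
    ext I; rw [pairing_ofReal]
  have h3 : gasSum 𝓙 K θ' (fun I => (realPairing σ I : ℂ) ^ 2)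
      = ∑ c, (σ c : ℂ) * gasSum 𝓙 K θ' (fun I => I c.1 c.2 * pairing (fun c => (σ c : ℂ)) I) := by
    have := gasSum_mul_pairing (𝓙 := 𝓙) (K := K) θ' (fun c => (σ c : ℂ))
      (pairing (fun c => (σ c : ℂ)))
    simp only [← h2] at this ⊢
    simp only [sq, this, mul_comm]
  have h4 : gasSum 𝓙 K θ' (fun I => (realPairing σ I : ℂ))
      = ∑ c, (σ c : ℂ) * gasSum 𝓙 K θ' (fun I => (I c.1 c.2 : ℂ)) := by
    have := gasSum_mul_pairing (𝓙 := 𝓙) (K := K) θ' (fun c => (σ c : ℂ)) 1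
    simp only [pairing_ofReal] at this
    simpa using this
  simp only [mul_div_assoc', mul_sub, ← Finset.sum_div]
  congr 1
  rw [Finset.sum_sub_distrib]
  congr 1
  · rw [h3, Finset.sum_mul]
    simp only [mul_assoc]
  · rw [sq]
    nth_rw 1 [h4]
    rw [Finset.sum_mul, h2]
    simp only [mul_assoc]

/-- The real partition sum `∑ K(I) cos⟨θ, I⟩`. -/
def cosSum (𝓙 : Finset (E → E3)) (K : (E → E3) → ℝ) (θ : E × Fin 3 → ℝ) : ℝ :=
  ∑ I ∈ 𝓙, K I * Real.cos (realPairing θ I)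

theorem IsCurrentGas.sum_odd (h : IsCurrentGas R 𝓙 K G b) {f : (E → E3) → ℂ}
    (hf : ∀ I ∈ 𝓙, f (-I) = -f I) : ∑ I ∈ 𝓙, f I = 0 := by
  have h1 : ∑ I ∈ 𝓙, f I = ∑ I ∈ 𝓙, f (-I) :=
    Finset.sum_bij' (fun I _ => -I) (fun I _ => -I) (fun I hI => h.neg_mem I hI)
      (fun I hI => h.neg_mem I hI) (by simp) (by simp) (by simp)
  rw [Finset.sum_congr rfl hf, Finset.sum_neg_distrib] at h1
  exact self_eq_neg.1 h1

theorem complexWeight_ofReal (θ : E × Fin 3 → ℝ) (I : E → E3) :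
    complexWeight K (fun a => (θ a : ℂ)) I = ((K I * Real.cos (realPairing θ I) : ℝ) : ℂ)
      + Complex.I * ((K I * Real.sin (realPairing θ I) : ℝ) : ℂ) := by
  rw [complexWeight, pairing_ofReal, mul_comm Complex.I, Complex.exp_mul_I]
  push_cast
  ring

theorem IsCurrentGas.gasSum_even (h : IsCurrentGas R 𝓙 K G b) (θ : E × Fin 3 → ℝ)
    {f : (E → E3) → ℝ} (hf : ∀ I, f (-I) = f I) :
    gasSum 𝓙 K (fun a => (θ a : ℂ)) (fun I => (f I : ℂ))
      = ((∑ I ∈ 𝓙, f I * (K I * Real.cos (realPairing θ I)) : ℝ) : ℂ) := by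
  simp only [gasSum, complexWeight_ofReal, mul_add, Finset.sum_add_distrib]
  have := h.sum_odd (f := fun I => (f I : ℂ) * (Complex.I *
    ((K I * Real.sin (realPairing θ I) : ℝ) : ℂ))) (fun I hI => by
      rw [hf, h.weight_neg I hI, realPairing_neg, Real.sin_neg]
      push_cast
      ring)
  rw [this]
  push_cast
  ring

theorem IsCurrentGas.gasSum_odd (h : IsCurrentGas R 𝓙 K G b) (θ : E × Fin 3 → ℝ)
    {f : (E → E3) → ℝ} (hf : ∀ I, f (-I) = -f I) :
    gasSum 𝓙 K (fun a => (θ a : ℂ)) (fun I => (f I : ℂ))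
      = Complex.I * ((∑ I ∈ 𝓙, f I * (K I * Real.sin (realPairing θ I)) : ℝ) : ℂ) := by
  simp only [gasSum, complexWeight_ofReal, mul_add, Finset.sum_add_distrib]
  have := h.sum_odd (f := fun I => (f I : ℂ) *
    ((K I * Real.cos (realPairing θ I) : ℝ) : ℂ)) (fun I hI => by
      rw [hf, h.weight_neg I hI, realPairing_neg, Real.cos_neg]
      push_cast
      ring)
  rw [this, zero_add]
  push_cast
  rw [Finset.mul_sum]
  exact Finset.sum_congr rfl fun I _ => by ring

theorem IsCurrentGas.gasSum_eq_cosSum (h : IsCurrentGas R 𝓙 K G b) (θ : E × Fin 3 → ℝ) :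
    gasSum 𝓙 K (fun a => (θ a : ℂ)) 1 = (cosSum 𝓙 K θ : ℂ) := by
  have := h.gasSum_even θ (f := fun _ => 1) (fun _ => rfl)
  simp only [one_mul] at this
  rw [cosSum, ← this]
  congr 1

theorem IsCurrentGas.cosSum_ne_zero (h : IsCurrentGas R 𝓙 K G b)
    (hR : ∀ e, R e e) (hD : ∀ e, (relNhd R {e}).card ≤ D)
    (hqD : edgeActivity G b * 4 ^ D ≤ 1 / 2) (θ : E × Fin 3 → ℝ) : cosSum 𝓙 K θ ≠ 0 := by
  have := h.gasSum_ne_zero hR hD hqD (θ := fun a => (θ a : ℂ)) (by simp)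
  rw [h.gasSum_eq_cosSum] at this
  exact_mod_cast this

/-- Along the segment from 0 to θ the sum is continuous, nonnegative at 0 and nowhere zero. -/
theorem IsCurrentGas.cosSum_pos (h : IsCurrentGas R 𝓙 K G b)
    (hR : ∀ e, R e e) (hD : ∀ e, (relNhd R {e}).card ≤ D)
    (hqD : edgeActivity G b * 4 ^ D ≤ 1 / 2) (θ : E × Fin 3 → ℝ) : 0 < cosSum 𝓙 K θ := by
  by_contra hneg
  push Not at hneg
  let f : ℝ → ℝ := fun s => cosSum 𝓙 K (fun a => 0 + s * θ a)
  have hcont : Continuous f := by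
    simp only [f, cosSum, realPairing_line]
    fun_prop
  have h1 : f 1 ≤ 0 := by simpa [f] using hneg
  have h0 : 0 ≤ f 0 := by
    simp only [f, zero_mul, add_zero, cosSum]
    refine Finset.sum_nonneg fun I _ => ?_
    simpa [realPairing] using h.nonneg I
  obtain ⟨s, -, hs⟩ := intermediate_value_Icc' zero_le_one hcont.continuousOn ⟨h1, h0⟩
  exact h.cosSum_ne_zero hR hD hqD _ hs

/-- The hypothesis says (log Z)'' ≥ -ε. So log Z + εt²/2 is convex, and its value at 0 is compared
with those at t and -t. -/
theorem midpoint_lower_bound {Z Z' Z'' : ℝ → ℝ} (hZ : ∀ t, 0 < Z t)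
    (h1 : ∀ t, HasDerivAt Z (Z' t) t) (h2 : ∀ t, HasDerivAt Z' (Z'' t) t) {ε : ℝ}
    (hε : ∀ t, -ε ≤ (Z'' t * Z t - Z' t ^ 2) / Z t ^ 2) (t : ℝ) :
    Real.exp (-(ε * t ^ 2)) * Z 0 ^ 2 ≤ Z t * Z (-t) := by
  let f : ℝ → ℝ := fun t => Real.log (Z t) + ε / 2 * t ^ 2
  have hf : ∀ t, HasDerivAt f (Z' t / Z t + ε * t) t := fun t => by
    refine ((h1 t).log (hZ t).ne').add (((hasDerivAt_pow 2 t).const_mul (ε / 2)).congr_deriv ?_)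
    push_cast
    ring
  have hf' : deriv f = fun t => Z' t / Z t + ε * t := funext fun t => (hf t).deriv
  have hf2 : ∀ t, HasDerivAt (deriv f) ((Z'' t * Z t - Z' t * Z' t) / Z t ^ 2 + ε) t := fun t => by
    rw [hf']
    refine ((h2 t).div (h1 t) (hZ t).ne').add ?_
    simpa using (hasDerivAt_id t).const_mul ε
  have hconv : ConvexOn ℝ Set.univ f := by
    refine convexOn_univ_of_deriv2_nonneg (fun t => (hf t).differentiableAt)
      (fun t => (hf2 t).differentiableAt) fun t => ?_
    simp only [Function.iterate_succ, Function.iterate_zero, Function.comp_apply, id_eq]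
    rw [(hf2 t).deriv]
    have := hε t
    rw [sq (Z' t)] at this
    linarith
  have hmid : f ((1 / 2 : ℝ) • t + (1 / 2 : ℝ) • -t) ≤ (1 / 2 : ℝ) • f t + (1 / 2 : ℝ) • f (-t) :=
    hconv.2 (Set.mem_univ t) (Set.mem_univ (-t)) (by norm_num) (by norm_num) (by norm_num)
  simp only [smul_eq_mul, f] at hmid
  rw [show (1 / 2 : ℝ) * t + 1 / 2 * -t = 0 by ring] at hmid
  have h3 : -(ε * t ^ 2) + (Real.log (Z 0) + Real.log (Z 0)) ≤ Real.log (Z t) + Real.log (Z (-t)) := by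
    nlinarith
  have h4 := Real.exp_le_exp.2 h3
  rw [Real.exp_add, Real.exp_add, Real.exp_add, Real.exp_log (hZ _), Real.exp_log (hZ _),
    Real.exp_log (hZ _)] at h4
  rw [sq (Z 0)]
  exact h4

/-- For Z(t) the sum at θ + tσ, the symmetry I ↦ -I identifies the insertion of ⟨σ, I⟩² with -Z''
and that of ⟨σ, I⟩ with -iZ'. The complex variance is therefore -(log Z)'', and its norm bound
yields the lower bound on the second derivative. -/
theorem IsCurrentGas.cosSum_mul_cosSum_ge (h : IsCurrentGas R 𝓙 K G b)
    (hR : ∀ e, R e e) (hD : ∀ e, (relNhd R {e}).card ≤ D)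
    (hqD : edgeActivity G b * 4 ^ D ≤ 1 / 2) (θ σ : E × Fin 3 → ℝ) (t : ℝ) :
    Real.exp (-(edgeActivity G b * 4 ^ D * (∑ a, σ a ^ 2) * t ^ 2)) * cosSum 𝓙 K θ ^ 2
      ≤ cosSum 𝓙 K (fun a => θ a + t * σ a) * cosSum 𝓙 K (fun a => θ a + -t * σ a) := by
  let Z : ℝ → ℝ := fun t => cosSum 𝓙 K (fun a => θ a + t * σ a)
  let Z' : ℝ → ℝ := fun t => -∑ I ∈ 𝓙, realPairing σ I *
    (K I * Real.sin (realPairing (fun a => θ a + t * σ a) I))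
  let Z'' : ℝ → ℝ := fun t => -∑ I ∈ 𝓙, realPairing σ I ^ 2 *
    (K I * Real.cos (realPairing (fun a => θ a + t * σ a) I))
  have hlin : ∀ (I : E → E3) (t : ℝ), HasDerivAt
      (fun t => realPairing (fun a => θ a + t * σ a) I) (realPairing σ I) t := fun I t => by
    simp only [realPairing_line]
    simpa using ((hasDerivAt_id t).mul_const (realPairing σ I)).const_add (realPairing θ I)
  have h1 : ∀ t, HasDerivAt Z (Z' t) t := fun t => by
    simp only [Z, Z', cosSum, ← Finset.sum_neg_distrib]
    refine HasDerivAt.fun_sum fun I _ => ((hlin I t).cos.const_mul (K I)).congr_deriv (by ring)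
  have h2 : ∀ t, HasDerivAt Z' (Z'' t) t := fun t => by
    simp only [Z', Z'', ← Finset.sum_neg_distrib]
    refine HasDerivAt.fun_sum fun I _ => ((((hlin I t).sin.const_mul (K I)).const_mul
      (realPairing σ I)).neg).congr_deriv (by ring)
  have key := midpoint_lower_bound (Z := Z) (fun t => h.cosSum_pos hR hD hqD _) h1 h2
    (ε := edgeActivity G b * 4 ^ D * ∑ a, σ a ^ 2) (fun t => ?_) t
  · simpa [Z] using key
  · have hv := h.norm_variance_le hR hD hqD (fun a => θ a + t * σ a) σ
    have e1 := h.gasSum_even (fun a => θ a + t * σ a) (f := fun I => realPairing σ I ^ 2)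
      (fun I => by simp [realPairing_neg])
    have e2 := h.gasSum_odd (fun a => θ a + t * σ a) (f := realPairing σ)
      (fun I => by rw [realPairing_neg])
    push_cast at e1
    rw [h.gasSum_eq_cosSum, e2] at hv
    have e3 : gasSum 𝓙 K (fun a => ((θ a + t * σ a : ℝ) : ℂ))
        (fun I => (realPairing σ I : ℂ) ^ 2) = ((-Z'' t : ℝ) : ℂ) := by
      simp only [Z'', neg_neg]
      push_cast
      exact e1
    have e4 : Complex.I * ((∑ I ∈ 𝓙, realPairing σ I *
        (K I * Real.sin (realPairing (fun a => θ a + t * σ a) I)) : ℝ) : ℂ)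
        = Complex.I * ((-Z' t : ℝ) : ℂ) := by simp only [Z', neg_neg]
    rw [e3, e4, mul_pow, Complex.I_sq, show cosSum 𝓙 K (fun a => θ a + t * σ a) = Z t from rfl,
      show ((-Z'' t : ℝ) : ℂ) * (Z t : ℂ) - -1 * ((-Z' t : ℝ) : ℂ) ^ 2
        = ((-(Z'' t * Z t - Z' t ^ 2) : ℝ) : ℂ) by push_cast; ring, ← Complex.ofReal_pow,
      ← Complex.ofReal_div, Complex.norm_real, Real.norm_eq_abs, neg_div, abs_neg] at hv
    have := neg_abs_le ((Z'' t * Z t - Z' t ^ 2) / Z t ^ 2)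
    linarith

/-- The arithmetic mean dominates the geometric mean; taking the square root halves the exponent. -/
theorem IsCurrentGas.cosSum_add_cosSum_ge (h : IsCurrentGas R 𝓙 K G b)
    (hR : ∀ e, R e e) (hD : ∀ e, (relNhd R {e}).card ≤ D)
    (hqD : edgeActivity G b * 4 ^ D ≤ 1 / 2) (θ σ : E × Fin 3 → ℝ) (t : ℝ) :
    Real.exp (-(t ^ 2 / 2 * (edgeActivity G b * 4 ^ D * (∑ a, σ a ^ 2)))) * cosSum 𝓙 K θ
      ≤ (cosSum 𝓙 K (fun a => θ a + t * σ a) + cosSum 𝓙 K (fun a => θ a + -t * σ a)) / 2 := by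
  have h1 := h.cosSum_mul_cosSum_ge hR hD hqD θ σ t
  have p1 := h.cosSum_pos hR hD hqD (fun a => θ a + t * σ a)
  have p2 := h.cosSum_pos hR hD hqD (fun a => θ a + -t * σ a)
  have p3 := h.cosSum_pos hR hD hqD θ
  set x := cosSum 𝓙 K (fun a => θ a + t * σ a)
  set y := cosSum 𝓙 K (fun a => θ a + -t * σ a)
  refine abs_le_of_sq_le_sq' (le_trans ?_ (b := x * y) ?_) (by positivity) |>.2
  · refine le_trans (le_of_eq ?_) h1
    rw [mul_pow, ← Real.exp_nat_mul]
    congr 2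
    push_cast
    ring
  · nlinarith [sq_nonneg (x - y)]

/-- The quadratic form of a matrix evaluated at the coordinates of a current. -/
def currentForm (Q : Matrix (E × Fin 3) (E × Fin 3) ℝ) (I : E → E3) : ℝ :=
  ∑ a, ∑ c, I a.1 a.2 * Q a c * I c.1 c.2

/-- Characteristic function of a centred Gaussian. The covariance is 2Q because that function
carries a factor 1/2 in the exponent. -/
theorem exists_gaussian_mixture {Q : Matrix (E × Fin 3) (E × Fin 3) ℝ} (hQ : Q.PosSemidef) :
    ∃ ν : Measure (EuclideanSpace ℝ (E × Fin 3)), IsProbabilityMeasure ν ∧ ∀ I : E → E3,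
      ∫ θ, Real.cos (realPairing θ I) ∂ν = Real.exp (-currentForm Q I) := by
  have hS : ((2 : ℝ) • Q).PosSemidef := hQ.smul (by norm_num)
  refine ⟨multivariateGaussian 0 ((2 : ℝ) • Q), inferInstance, fun I => ?_⟩
  let x : EuclideanSpace ℝ (E × Fin 3) := WithLp.toLp 2 fun a => I a.1 a.2
  have h1 := charFun_multivariateGaussian (μ := 0) hS x
  have h2 : ∀ θ : EuclideanSpace ℝ (E × Fin 3), inner ℝ θ x = realPairing θ I := by
    intro θ
    simp [PiLp.inner_apply, realPairing, x, mul_comm]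
  rw [charFun_apply] at h1
  have hexp : (inner ℝ x (0 : EuclideanSpace ℝ (E × Fin 3)) : ℂ) * Complex.I
      - ((x.ofLp ⬝ᵥ ((2 : ℝ) • Q).mulVec x.ofLp : ℝ) : ℂ) / 2 = ((-currentForm Q I : ℝ) : ℂ) := by
    have : x.ofLp ⬝ᵥ ((2 : ℝ) • Q).mulVec x.ofLp = 2 * currentForm Q I := by
      simp only [dotProduct, Matrix.mulVec, currentForm, x, Finset.mul_sum]
      refine Finset.sum_congr rfl fun a _ => Finset.sum_congr rfl fun c _ => ?_
      rw [Matrix.smul_apply, smul_eq_mul]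
      ring
    rw [this]
    simp
  have h3 : ∀ θ : EuclideanSpace ℝ (E × Fin 3),
      Real.cos (realPairing θ I) = (Complex.exp (inner ℝ θ x * Complex.I)).re := fun θ => by
    rw [h2, Complex.exp_ofReal_mul_I_re]
  simp only [h3]
  have h4 : Integrable (fun θ : EuclideanSpace ℝ (E × Fin 3) =>
      Complex.exp (inner ℝ θ x * Complex.I)) (multivariateGaussian 0 ((2 : ℝ) • Q)) := by
    refine Integrable.of_bound (C := 1) (Continuous.aestronglyMeasurable (by fun_prop)) ?_
    exact ae_of_all _ fun θ => (Complex.norm_exp_ofReal_mul_I _).le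
  have h5 := integral_re h4
  simp only [RCLike.re_to_complex] at h5
  rw [h5, h1]
  have h6 := congrArg (fun z => (Complex.exp z).re) hexp
  simp only [← Complex.ofReal_exp, Complex.ofReal_re] at h6
  exact h6

/-- Each exp(-Q(I)) is replaced by its Gaussian average of cos⟨θ, I⟩. For every single θ the
addition theorem writes cos(t⟨σ, I⟩) cos⟨θ, I⟩ as the mean of the cosines at θ ± tσ, and the
frozen-field inequality applies with a constant independent of Q. -/
theorem IsCurrentGas.sum_gaussian_cos_ge (h : IsCurrentGas R 𝓙 K G b)
    (hR : ∀ e, R e e) (hD : ∀ e, (relNhd R {e}).card ≤ D)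
    (hqD : edgeActivity G b * 4 ^ D ≤ 1 / 2) (σ : E × Fin 3 → ℝ)
    {Q : Matrix (E × Fin 3) (E × Fin 3) ℝ} (hQ : Q.PosSemidef) (t : ℝ) :
    Real.exp (-(t ^ 2 / 2 * (edgeActivity G b * 4 ^ D * (∑ a, σ a ^ 2))))
        * ∑ I ∈ 𝓙, K I * Real.exp (-currentForm Q I)
      ≤ ∑ I ∈ 𝓙, K I * Real.exp (-currentForm Q I) * Real.cos (t * realPairing σ I) := by
  obtain ⟨ν, hν, hint⟩ := exists_gaussian_mixture hQ
  have hi : ∀ I : E → E3, Integrable (fun θ : EuclideanSpace ℝ (E × Fin 3) =>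
      Real.cos (realPairing θ I)) ν := fun I => by
    refine Integrable.of_bound (C := 1) ?_ ?_
    · refine Continuous.aestronglyMeasurable ?_
      simp only [realPairing]
      fun_prop
    · exact ae_of_all _ fun θ => Real.abs_cos_le_one _
  have e1 : ∑ I ∈ 𝓙, K I * Real.exp (-currentForm Q I) = ∫ θ, cosSum 𝓙 K θ ∂ν := by
    simp only [cosSum]
    rw [integral_finsetSum _ fun I _ => (hi I).const_mul _]
    simp only [integral_const_mul, hint]
  have e2 : ∑ I ∈ 𝓙, K I * Real.exp (-currentForm Q I) * Real.cos (t * realPairing σ I)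
      = ∫ θ : EuclideanSpace ℝ (E × Fin 3), ∑ I ∈ 𝓙, K I * Real.cos (t * realPairing σ I)
        * Real.cos (realPairing θ I) ∂ν := by
    rw [integral_finsetSum _ fun I _ => (hi I).const_mul _]
    simp only [integral_const_mul, hint]
    exact Finset.sum_congr rfl fun I _ => by ring
  rw [e1, e2, ← integral_const_mul]
  refine integral_mono ?_ ?_ fun θ => ?_
  · simp only [cosSum]
    exact (integrable_finsetSum _ fun I _ => (hi I).const_mul _).const_mul _
  · exact integrable_finsetSum _ fun I _ => (hi I).const_mul _
  · refine (h.cosSum_add_cosSum_ge hR hD hqD θ σ t).trans (le_of_eq ?_)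
    simp only [cosSum, realPairing_line]
    rw [← Finset.sum_add_distrib, Finset.sum_div]
    refine Finset.sum_congr rfl fun I _ => ?_
    rw [neg_mul, ← sub_eq_add_neg, Real.cos_add, Real.cos_sub]
    ring

end GasHessian

/-! ### Discrete Gibbs measures -/

section DiscreteGibbs

variable {Ω : Type*} [Countable Ω] [MeasurableSpace Ω] [MeasurableSingletonClass Ω]

/-- The normalized measure with weights `w`. -/
def discreteGibbs (w : Ω → ℝ≥0∞) : Measure Ω :=
  (∑' I, w I)⁻¹ • Measure.sum fun I => w I • Measure.dirac I

theorem discreteGibbs_singleton (w : Ω → ℝ≥0∞) (I : Ω) :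
    discreteGibbs w {I} = (∑' I, w I)⁻¹ * w I := by
  have h : ∑' J, (w J • Measure.dirac J : Measure Ω) {I} = w I := by
    rw [tsum_eq_single I]
    · simp
    · intro J hJ
      simp [hJ]
  rw [discreteGibbs, Measure.smul_apply, Measure.sum_apply _ (measurableSet_singleton I), h,
    smul_eq_mul]

variable {W : Ω → ℝ}

theorem tsum_ofReal_eq (hW : ∀ I, 0 ≤ W I) (hs : Summable W) :
    ∑' I, ENNReal.ofReal (W I) = ENNReal.ofReal (∑' I, W I) :=
  (ENNReal.ofReal_tsum_of_nonneg hW hs).symm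

theorem isProbabilityMeasure_discreteGibbs (hW : ∀ I, 0 ≤ W I) (hs : Summable W)
    (hpos : 0 < ∑' I, W I) :
    IsProbabilityMeasure (discreteGibbs fun I => ENNReal.ofReal (W I)) := by
  constructor
  rw [discreteGibbs, Measure.smul_apply, Measure.sum_apply _ MeasurableSet.univ]
  simp only [Measure.smul_apply, measure_univ, smul_eq_mul, mul_one]
  rw [tsum_ofReal_eq hW hs]
  exact ENNReal.inv_mul_cancel (by simpa using hpos) ENNReal.ofReal_ne_top

theorem real_discreteGibbs_singleton (hW : ∀ I, 0 ≤ W I) (hs : Summable W)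
    (hpos : 0 < ∑' I, W I) (I : Ω) :
    (discreteGibbs fun I => ENNReal.ofReal (W I)).real {I} = (∑' I, W I)⁻¹ * W I := by
  rw [measureReal_def, discreteGibbs_singleton, tsum_ofReal_eq hW hs, ENNReal.toReal_mul,
    ENNReal.toReal_inv, ENNReal.toReal_ofReal hpos.le, ENNReal.toReal_ofReal (hW I)]

theorem integral_discreteGibbs {F : Type*} [NormedAddCommGroup F] [NormedSpace ℝ F]
    [CompleteSpace F] [MeasurableSpace F] [BorelSpace F] [SecondCountableTopology F]
    (hW : ∀ I, 0 ≤ W I) (hs : Summable W)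
    (hpos : 0 < ∑' I, W I) {f : Ω → F} {C : ℝ} (hf : ∀ I, ‖f I‖ ≤ C) :
    ∫ I, f I ∂(discreteGibbs fun I => ENNReal.ofReal (W I))
      = (∑' I, W I)⁻¹ • ∑' I, W I • f I := by
  have := isProbabilityMeasure_discreteGibbs hW hs hpos
  have hint : Integrable f (discreteGibbs fun I => ENNReal.ofReal (W I)) :=
    Integrable.of_bound (measurable_of_countable f).aestronglyMeasurable C (ae_of_all _ hf)
  rw [integral_countable hint]
  simp only [real_discreteGibbs_singleton hW hs hpos, mul_smul]
  have hsum : Summable fun I => W I • f I := by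
    refine Summable.of_norm_bounded (hs.mul_right C) fun I => ?_
    rw [norm_smul, Real.norm_eq_abs, abs_of_nonneg (hW I)]
    exact mul_le_mul_of_nonneg_left (hf I) (hW I)
  exact hsum.tsum_const_smul _

/-- A bound on the characteristic function near zero controls the second moment. -/
theorem tsum_mul_sq_le {O : Ω → ℝ} (hW : ∀ I, 0 ≤ W I) (hs : Summable W) {ε : ℝ}
    (h : ∀ t : ℝ, Real.exp (-(t ^ 2 / 2 * ε)) * ∑' I, W I ≤ ∑' I, W I * Real.cos (t * O I)) :
    (Summable fun I => W I * O I ^ 2) ∧ ∑' I, W I * O I ^ 2 ≤ ε * ∑' I, W I := by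
  set Z := ∑' I, W I
  have hZ : 0 ≤ Z := tsum_nonneg hW
  -- Summability of the second moment is not known beforehand, so the limit t → 0 of 2(1 -
  -- cos(tO))/t² is taken in finite partial sums; the discarded terms of 1 - cos are nonnegative.
  have hfin : ∀ F : Finset Ω, ∑ I ∈ F, W I * O I ^ 2 ≤ ε * Z := by
    intro F
    have hlim : ∀ I, Tendsto (fun t : ℝ => W I * (2 * (t⁻¹ * Real.sin (t * (O I / 2))) ^ 2) * 2)
        (𝓝[≠] 0) (𝓝 (W I * (2 * (O I / 2) ^ 2) * 2)) := by
      intro I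
      have hd : HasDerivAt (fun t : ℝ => Real.sin (t * (O I / 2))) (O I / 2) 0 := by
        have := ((hasDerivAt_id (0 : ℝ)).mul_const (O I / 2)).sin
        simpa using this
      have := hasDerivAt_iff_tendsto_slope_zero.1 hd
      simp only [zero_add, zero_mul, Real.sin_zero, sub_zero, smul_eq_mul] at this
      exact (((this.pow 2).const_mul 2).const_mul (W I)).mul_const 2
    have hsum := tendsto_finsetSum F fun I _ => hlim I
    have hle : ∑ I ∈ F, W I * (2 * (O I / 2) ^ 2) * 2 ≤ ε * Z := by
      refine le_of_tendsto hsum ?_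
      filter_upwards [self_mem_nhdsWithin] with t ht
      have ht0 : t ≠ 0 := ht
      have ht2 : 0 < t ^ 2 := by positivity
      have hcos : ∀ I, W I * (2 * (t⁻¹ * Real.sin (t * (O I / 2))) ^ 2) * 2
          = (t ^ 2)⁻¹ * 2 * (W I - W I * Real.cos (t * O I)) := by
        intro I
        have : Real.cos (t * O I) = 1 - 2 * Real.sin (t * (O I / 2)) ^ 2 := by
          rw [show t * O I = 2 * (t * (O I / 2)) by ring, Real.cos_two_mul, Real.cos_sq']
          ring
        rw [this, mul_pow, inv_pow]
        ring
      simp only [hcos]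
      rw [← Finset.mul_sum]
      have hsc : Summable fun I => W I * Real.cos (t * O I) := by
        refine Summable.of_norm_bounded hs fun I => ?_
        rw [norm_mul, Real.norm_eq_abs, abs_of_nonneg (hW I)]
        exact mul_le_of_le_one_right (hW I) (Real.abs_cos_le_one _)
      have h1 : ∑ I ∈ F, (W I - W I * Real.cos (t * O I))
          ≤ Z - ∑' I, W I * Real.cos (t * O I) := by
        rw [← hs.tsum_sub hsc]
        refine (hs.sub hsc).sum_le_tsum _ fun I _ => ?_
        have := mul_le_of_le_one_right (hW I) (Real.cos_le_one (t * O I))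
        linarith
      have h2 : (1 - t ^ 2 / 2 * ε) * Z ≤ ∑' I, W I * Real.cos (t * O I) := by
        -- The exponential is replaced by its tangent line, so that the two zeroth-order terms
        -- cancel and a factor t² remains.
        refine le_trans ?_ (h t)
        gcongr
        have := Real.add_one_le_exp (-(t ^ 2 / 2 * ε))
        linarith
      calc _ ≤ (t ^ 2)⁻¹ * 2 * (t ^ 2 / 2 * ε * Z) := by
            gcongr
            linarith
        _ = _ := by field_simp
    refine le_trans (le_of_eq ?_) hle
    exact Finset.sum_congr rfl fun I _ => by ring
  have hs2 : Summable fun I => W I * O I ^ 2 :=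
    summable_of_sum_le (fun I => mul_nonneg (hW I) (sq_nonneg _)) hfin
  exact ⟨hs2, hs2.tsum_le_of_sum_le hfin⟩

/-- The involution ν preserves the weights and flips the observable, so the sine part cancels. The
second moment then bounds the variance. -/
theorem discreteGibbs_bounds (ν : Ω ≃ Ω) {O : Ω → ℝ} (hW : ∀ I, 0 ≤ W I) (hs : Summable W)
    (hpos : 0 < ∑' I, W I) (hνW : ∀ I, W (ν I) = W I) (hνO : ∀ I, O (ν I) = -O I) {ε : ℝ}
    (h : ∀ t : ℝ, Real.exp (-(t ^ 2 / 2 * ε)) * ∑' I, W I ≤ ∑' I, W I * Real.cos (t * O I)) :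
    (∀ t : ℝ,
      (∫ I, Complex.exp (Complex.I * t * O I)
        ∂(discreteGibbs fun I => ENNReal.ofReal (W I))).im = 0 ∧
      Real.exp (-(t ^ 2 / 2 * ε)) ≤ (∫ I, Complex.exp (Complex.I * t * O I)
        ∂(discreteGibbs fun I => ENNReal.ofReal (W I))).re) ∧
    MemLp O 2 (discreteGibbs fun I => ENNReal.ofReal (W I)) ∧
    variance O (discreteGibbs fun I => ENNReal.ofReal (W I)) ≤ ε := by
  set μ := discreteGibbs fun I => ENNReal.ofReal (W I) with hμ
  have hprob : IsProbabilityMeasure μ := isProbabilityMeasure_discreteGibbs hW hs hpos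
  set Z := ∑' I, W I
  refine ⟨fun t => ?_, ?_⟩
  · have hexp : ∀ I, Complex.exp (Complex.I * t * O I) = ((Real.cos (t * O I) : ℝ) : ℂ)
        + ((Real.sin (t * O I) : ℝ) : ℂ) * Complex.I := by
      intro I
      rw [mul_assoc, mul_comm Complex.I, Complex.exp_mul_I]
      push_cast
      ring
    have hint : Integrable (fun I => Complex.exp (Complex.I * t * O I)) μ := by
      refine Integrable.of_bound (measurable_of_countable _).aestronglyMeasurable 1
        (ae_of_all _ fun I => ?_)
      rw [show Complex.I * t * O I = ((t * O I : ℝ) : ℂ) * Complex.I by push_cast; ring]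
      exact (Complex.norm_exp_ofReal_mul_I _).le
    have hre := integral_re hint
    have him := integral_im hint
    simp only [RCLike.re_to_complex, RCLike.im_to_complex] at hre him
    have hcos : ∀ I, (Complex.exp (Complex.I * t * O I)).re = Real.cos (t * O I) := fun I => by
      rw [hexp I]; simp [-Complex.ofReal_cos, -Complex.ofReal_sin]
    have hsin : ∀ I, (Complex.exp (Complex.I * t * O I)).im = Real.sin (t * O I) := fun I => by
      rw [hexp I]; simp [-Complex.ofReal_cos, -Complex.ofReal_sin]
    rw [← hre, ← him]
    simp only [hcos, hsin]
    rw [integral_discreteGibbs hW hs hpos (C := 1) fun I => Real.abs_sin_le_one _,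
      integral_discreteGibbs hW hs hpos (C := 1) fun I => Real.abs_cos_le_one _]
    simp only [smul_eq_mul]
    constructor
    · have h1 : ∑' I, W I * Real.sin (t * O I) = -∑' I, W I * Real.sin (t * O I) := by
        conv_lhs => rw [← ν.tsum_eq]
        rw [← tsum_neg]
        refine tsum_congr fun I => ?_
        rw [hνW, hνO, mul_neg, Real.sin_neg, mul_neg]
      rw [self_eq_neg.1 h1, mul_zero]
    · rw [← div_eq_inv_mul, le_div_iff₀ hpos]
      exact h t
  · obtain ⟨hs2, hle⟩ := tsum_mul_sq_le hW hs h
    have hlint : ∫⁻ I, ENNReal.ofReal (O I ^ 2) ∂μ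
        = ENNReal.ofReal (Z⁻¹ * ∑' I, W I * O I ^ 2) := by
      rw [lintegral_countable']
      have : ∀ I, ENNReal.ofReal (O I ^ 2) * μ {I} = ENNReal.ofReal (Z⁻¹ * (W I * O I ^ 2)) := by
        intro I
        rw [← ofReal_measureReal, real_discreteGibbs_singleton hW hs hpos,
          ← ENNReal.ofReal_mul (sq_nonneg _)]
        congr 1
        ring
      simp only [this]
      rw [tsum_ofReal_eq (fun I => by have := hW I; positivity) (hs2.mul_left _), tsum_mul_left]
    have hmem : MemLp O 2 μ := by
      rw [memLp_two_iff_integrable_sq (measurable_of_countable _).aestronglyMeasurable]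
      refine ⟨(measurable_of_countable _).aestronglyMeasurable, ?_⟩
      rw [hasFiniteIntegral_iff_ofReal (ae_of_all _ fun I => sq_nonneg _), hlint]
      exact ENNReal.ofReal_lt_top
    refine ⟨hmem, (variance_le_expectation_sq hmem.aestronglyMeasurable).trans ?_⟩
    have : ∫ I, (O ^ 2) I ∂μ = Z⁻¹ * ∑' I, W I * O I ^ 2 := by
      rw [integral_eq_lintegral_of_nonneg_ae (ae_of_all _ fun I => by simpa using sq_nonneg (O I))
        (measurable_of_countable _).aestronglyMeasurable]
      simp only [Pi.pow_apply]
      rw [hlint, ENNReal.toReal_ofReal]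
      refine mul_nonneg (inv_nonneg.2 hpos.le) (tsum_nonneg fun I => mul_nonneg (hW I) (sq_nonneg _))
    rw [this, ← div_eq_inv_mul, div_le_iff₀ hpos]
    exact hle

end DiscreteGibbs

/-! ### Lattice sums -/

section LatticeSums

variable (Γ : Submodule ℤ E3) [DiscreteTopology Γ]

theorem lattice_finite_ball (r : ℝ) : {g : E3 | g ∈ Γ ∧ ‖g‖ ≤ r}.Finite := by
  have : DiscreteTopology (Γ.toAddSubgroup : Set E3) := ‹DiscreteTopology Γ›
  have hcl : IsClosed (Γ.toAddSubgroup : Set E3) := AddSubgroup.isClosed_of_discrete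
  have := Metric.finite_isBounded_inter_isClosed (K := Metric.closedBall (0 : E3) r)
    ⟨this⟩ Metric.isBounded_closedBall hcl
  refine this.subset fun g hg => ⟨by simpa using hg.2, hg.1⟩

theorem exists_lattice_norm_lower_bound : ∃ m : ℝ, 0 < m ∧ ∀ g ∈ Γ, g ≠ 0 → m ≤ ‖g‖ := by
  classical
  have hf : {g : E3 | g ∈ Γ ∧ ‖g‖ ≤ 1 ∧ g ≠ 0}.Finite :=
    (lattice_finite_ball Γ 1).subset fun g hg => ⟨hg.1, hg.2.1⟩
  by_cases hne : hf.toFinset.Nonempty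
  · obtain ⟨g₀, hg₀, hmin⟩ := hf.toFinset.exists_min_image (fun g => ‖g‖) hne
    rw [Set.Finite.mem_toFinset] at hg₀
    refine ⟨‖g₀‖, norm_pos_iff.2 hg₀.2.2, fun g hg hg0 => ?_⟩
    by_cases h1 : ‖g‖ ≤ 1
    · exact hmin g (by rw [Set.Finite.mem_toFinset]; exact ⟨hg, h1, hg0⟩)
    · exact hg₀.2.1.trans (not_le.1 h1).le
  · refine ⟨1, one_pos, fun g hg hg0 => ?_⟩
    by_contra h1
    exact hne ⟨g, by rw [Set.Finite.mem_toFinset]; exact ⟨hg, (not_le.1 h1).le, hg0⟩⟩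

/-- The exponential beats the power -(d+1) of the norm, which is summable on a lattice of rank d.
That power vanishes at the origin by convention, so the term g = 0 is added separately. -/
theorem summable_exp_neg_norm : Summable fun g : Γ => Real.exp (-‖g‖) := by
  set d : ℕ := Module.finrank ℤ Γ
  have h := ZLattice.summable_norm_rpow Γ (-(d + 1 : ℝ)) (by simp [d])
  refine Summable.of_nonneg_of_le (fun _ => (Real.exp_pos _).le) ?_
    ((h.mul_left ((d + 1).factorial : ℝ)).add (summable_of_ne_finset_zero (s := {0})
      (f := fun g : Γ => if g = 0 then (1 : ℝ) else 0) (by intro g hg; simp at hg; simp [hg])))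
  intro g
  by_cases hg : g = 0
  · subst hg
    simp
    positivity
  · have hpos : 0 < ‖g‖ := norm_pos_iff.2 hg
    rw [if_neg hg, add_zero, Real.exp_neg, Real.rpow_neg hpos.le]
    have h2 := Real.pow_div_factorial_le_exp ‖g‖ hpos.le (d + 1)
    rw [show (d + 1 : ℝ) = ((d + 1 : ℕ) : ℝ) by push_cast; ring, Real.rpow_natCast]
    rw [inv_eq_one_div, ← div_eq_mul_inv, div_le_div_iff₀ (Real.exp_pos _) (by positivity), one_mul]
    rw [div_le_iff₀ (by positivity)] at h2
    linarith

/-- Splitting (b - 4)‖g‖ as (b - 5)‖g‖ + ‖g‖: the first part is at least (b - 5)m, where m is the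
minimal length of a nonzero lattice vector, and the second makes the sum over the lattice converge.
-/
theorem exists_edgeActivity_le : ∃ A m : ℝ, 0 < A ∧ 0 < m ∧ ∀ b : ℝ, 5 ≤ b → ∀ G : Finset E3,
    (∀ g ∈ G, g ∈ Γ ∧ g ≠ 0) → edgeActivity G b ≤ A * Real.exp (-(m * b)) := by
  classical
  obtain ⟨m, hm, hmin⟩ := exists_lattice_norm_lower_bound Γ
  have hs := summable_exp_neg_norm Γ
  refine ⟨(∑' g : Γ, Real.exp (-‖g‖)) * Real.exp (5 * m), m, ?_, hm, fun b hb G hG => ?_⟩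
  · refine mul_pos ?_ (Real.exp_pos _)
    exact hs.tsum_pos (fun _ => (Real.exp_pos _).le) 0 (Real.exp_pos _)
  · have h1 : ∀ g ∈ G, Real.exp (-((b - 4) * ‖g‖))
        ≤ Real.exp (5 * m) * Real.exp (-(m * b)) * Real.exp (-‖g‖) := by
      intro g hg
      rw [← Real.exp_add, ← Real.exp_add, Real.exp_le_exp]
      have := hmin g (hG g hg).1 (hG g hg).2
      nlinarith
    have h2 : ∑ g ∈ G, Real.exp (-‖g‖) ≤ ∑' g : Γ, Real.exp (-‖g‖) := by
      let emb : G ↪ Γ := ⟨fun g : G => (⟨g.1, (hG g.1 g.2).1⟩ : Γ), fun a b hab =>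
        Subtype.ext (congrArg (fun g : Γ => (g : E3)) hab)⟩
      have : ∑ g ∈ G, Real.exp (-‖g‖) = ∑ g ∈ G.attach.map emb, Real.exp (-‖g‖) := by
        rw [Finset.sum_map, ← Finset.sum_attach]
        rfl
      rw [this]
      exact hs.sum_le_tsum _ fun _ _ => (Real.exp_pos _).le
    calc edgeActivity G b ≤ ∑ g ∈ G, Real.exp (5 * m) * Real.exp (-(m * b)) * Real.exp (-‖g‖) :=
          Finset.sum_le_sum h1
      _ = Real.exp (5 * m) * Real.exp (-(m * b)) * ∑ g ∈ G, Real.exp (-‖g‖) := by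
          rw [Finset.mul_sum]
      _ ≤ Real.exp (5 * m) * Real.exp (-(m * b)) * ∑' g : Γ, Real.exp (-‖g‖) := by gcongr
      _ = _ := by ring

end LatticeSums

/-! ### Dislocation currents as a gas -/

section Dislocations

variable {Λ : MesoscopicLattice} {Γ : Submodule ℤ E3} {o : CountingDirection Λ} {φ : E3 → ℝ}
  {c : ℝ} {Hd : TensorField → ℝ≥0∞} {lam mu β : ℝ} {E : Finset Λ.Edge}

/-- Two edges with a common vertex. -/
def EdgesTouch (E : Finset Λ.Edge) (e f : E) : Prop :=
  ∃ v : E3, v ∈ ((e : Λ.Edge) : Sym2 E3) ∧ v ∈ ((f : Λ.Edge) : Sym2 E3)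

theorem src_mem (o : CountingDirection Λ) (e : Λ.Edge) : o.src e ∈ (e : Sym2 E3) := by
  rw [← o.mk_src_tgt e]; exact Sym2.mem_mk_left _ _

theorem tgt_mem (o : CountingDirection Λ) (e : Λ.Edge) : o.tgt e ∈ (e : Sym2 E3) := by
  rw [← o.mk_src_tgt e]; exact Sym2.mem_mk_right _ _

theorem edgesTouch_refl (o : CountingDirection Λ) (e : E) : EdgesTouch E e e :=
  ⟨o.src e, src_mem o e, src_mem o e⟩

theorem card_edges_at_le {M : ℕ} (hM : ∀ x, (Λ.graph.neighborSet x).encard ≤ M) (a : E3)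
    (F : Finset Λ.Edge) (hF : ∀ f ∈ F, a ∈ (f : Sym2 E3)) : F.card ≤ M := by
  classical
  have hex : ∀ f ∈ F, ∃ y, s(a, y) = (f : Sym2 E3) := fun f hf =>
    ⟨Sym2.Mem.other (hF f hf), Sym2.other_spec (hF f hf)⟩
  choose! y hy using hex
  have h1 : (F : Set Λ.Edge).encard ≤ (Λ.graph.neighborSet a).encard := by
    refine Set.encard_le_encard_of_injOn (f := y) (fun f hf => ?_) fun f hf g hg hfg => ?_
    · have := f.2
      rw [← hy f hf] at this
      exact this
    · refine Subtype.ext ?_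
      rw [← hy f hf, ← hy g hg, hfg]
  rw [Set.encard_coe_eq_coe_finsetCard] at h1
  exact_mod_cast h1.trans (hM a)

/-- An edge has two end points, each with at most M incident edges. -/
theorem exists_card_relNhd_le (Λ : MesoscopicLattice) : ∃ D : ℕ, ∀ (E : Finset Λ.Edge) (e : E),
    (relNhd (EdgesTouch E) {e}).card ≤ D := by
  classical
  obtain ⟨M, hM⟩ := Λ.boundedDegree
  refine ⟨M + M, fun E e => ?_⟩
  obtain ⟨⟨a, b⟩, hab⟩ := Sym2.mk_surjective ((e : Λ.Edge) : Sym2 E3)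
  have hcard : ∀ v : E3, (Finset.univ.filter fun f : E => v ∈ ((f : Λ.Edge) : Sym2 E3)).card ≤ M := by
    intro v
    rw [← Finset.card_map (Function.Embedding.subtype _)]
    refine card_edges_at_le hM v _ fun f hf => ?_
    obtain ⟨g, hg, rfl⟩ := Finset.mem_map.1 hf
    exact (Finset.mem_filter.1 hg).2
  refine (Finset.card_le_card (t := (Finset.univ.filter fun f : E => a ∈ ((f : Λ.Edge) : Sym2 E3))
    ∪ Finset.univ.filter fun f : E => b ∈ ((f : Λ.Edge) : Sym2 E3)) ?_).trans
    ((Finset.card_union_le _ _).trans (add_le_add (hcard a) (hcard b)))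
  intro f hf
  obtain ⟨e', he', v, hve, hvf⟩ := mem_relNhd.1 hf
  rw [Finset.mem_singleton] at he'
  subst he'
  rw [← hab] at hve
  rw [Finset.mem_union, Finset.mem_filter, Finset.mem_filter]
  rcases Sym2.mem_iff.1 hve with rfl | rfl
  · exact Or.inl ⟨Finset.mem_univ _, hvf⟩
  · exact Or.inr ⟨Finset.mem_univ _, hvf⟩

theorem incidence_eq_zero {v : E3} {e : Λ.Edge} (h : v ∉ (e : Sym2 E3)) : incidence o v e = 0 := by
  rw [incidence, if_neg, if_neg]
  · rintro rfl; exact h (src_mem o e)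
  · rintro rfl; exact h (tgt_mem o e)

theorem zero_mem_currents : (0 : E → E3) ∈ currents Γ o E := by
  refine ⟨fun e => Γ.zero_mem, fun v _ => by simp⟩

theorem neg_mem_currents {I : E → E3} (h : I ∈ currents Γ o E) : -I ∈ currents Γ o E := by
  refine ⟨fun e => Γ.neg_mem (h.1 e), fun v hv => ?_⟩
  simp only [Pi.neg_apply, smul_neg, Finset.sum_neg_distrib, h.2 v hv, neg_zero]

theorem add_mem_currents {I₁ I₂ : E → E3} (h₁ : I₁ ∈ currents Γ o E) (h₂ : I₂ ∈ currents Γ o E) :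
    I₁ + I₂ ∈ currents Γ o E := by
  refine ⟨fun e => Γ.add_mem (h₁.1 e) (h₂.1 e), fun v hv => ?_⟩
  simp only [Pi.add_apply, smul_add, Finset.sum_add_distrib, h₁.2 v hv, h₂.2 v hv, add_zero]

/-- Kirchhoff's law splits: no vertex meets both C and S, so at each vertex one of the two partial
sums is zero, and then so is the other. -/
theorem restrict_mem_currents {C S : Finset E} (hd : Disjoint S (relNhd (EdgesTouch E) C))
    {I : E → E3} (hI : I ∈ currents Γ o E) (hs : currentSupport I = C ∪ S) :
    restrictCurrent I C ∈ currents Γ o E ∧ restrictCurrent I S ∈ currents Γ o E := by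
  have hdis : ∀ e ∈ C, e ∉ S := fun e he hS =>
    Finset.disjoint_left.1 hd hS (mem_relNhd.2 ⟨e, he, _, src_mem o _, src_mem o _⟩)
  have hsum : I = restrictCurrent I C + restrictCurrent I S := by
    ext1 e
    simp only [Pi.add_apply, restrictCurrent]
    by_cases hC : e ∈ C
    · simp [hC, hdis e hC]
    · by_cases hS : e ∈ S
      · simp [hC, hS]
      · have : e ∉ currentSupport I := by rw [hs]; simp [hC, hS]
        rw [mem_currentSupport, not_not] at this
        simp [this]
  have hsplit : ∀ v ∈ Λ.verts, ∑ e : E, incidence o v e • restrictCurrent I C e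
      + ∑ e : E, incidence o v e • restrictCurrent I S e = 0 := by
    intro v hv
    rw [← Finset.sum_add_distrib, ← hI.2 v hv]
    refine Finset.sum_congr rfl fun e _ => ?_
    conv_rhs => rw [hsum]
    rw [Pi.add_apply, smul_add]
  have hz : ∀ v : E3, ∑ e : E, incidence o v e • restrictCurrent I C e = 0 ∨
      ∑ e : E, incidence o v e • restrictCurrent I S e = 0 := by
    intro v
    by_cases h : ∃ e ∈ C, v ∈ ((e : Λ.Edge) : Sym2 E3)
    · right
      obtain ⟨e, he, hv⟩ := h
      refine Finset.sum_eq_zero fun f _ => ?_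
      by_cases hf : f ∈ S
      · rw [incidence_eq_zero, zero_smul]
        intro hvf
        exact Finset.disjoint_left.1 hd hf (mem_relNhd.2 ⟨e, he, v, hv, hvf⟩)
      · simp [restrictCurrent, hf]
    · left
      push Not at h
      refine Finset.sum_eq_zero fun f _ => ?_
      by_cases hf : f ∈ C
      · rw [incidence_eq_zero (h f hf), zero_smul]
      · simp [restrictCurrent, hf]
  have hmem : ∀ T : Finset E, ∀ e, restrictCurrent I T e ∈ Γ := fun T e => by
    rw [restrictCurrent]
    split_ifs
    · exact hI.1 e
    · exact Γ.zero_mem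
  refine ⟨⟨hmem C, fun v hv => ?_⟩, ⟨hmem S, fun v hv => ?_⟩⟩
  · have := hsplit v hv
    rcases hz v with h | h
    · exact h
    · rwa [h, add_zero] at this
  · have := hsplit v hv
    rcases hz v with h | h
    · rwa [h, zero_add] at this
    · exact h

/-- The Boltzmann factor of the local dislocation energy. -/
def dislocationWeight (o : CountingDirection Λ) (φ : E3 → ℝ) (Hd : TensorField → ℝ≥0∞) (β : ℝ)
    {E : Finset Λ.Edge} (I : E → E3) : ℝ :=
  if Hd (burgers o φ I) = ⊤ then 0 else Real.exp (-(β * (Hd (burgers o φ I)).toReal))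

theorem dislocationWeight_nonneg (I : E → E3) : 0 ≤ dislocationWeight o φ Hd β I := by
  rw [dislocationWeight]
  split_ifs <;> positivity

/-- Once the elastic energy is known to be a finite number, the extended-real weight becomes a
product of two real factors, with infinite dislocation energy giving weight zero. -/
theorem gibbsWeight_eq (hβ : 0 < β) {I : E → E3} {q : ℝ} (hq : 0 ≤ q)
    (h : minElasticEnergy lam mu (burgers o φ I) = ENNReal.ofReal q) :
    gibbsWeight o φ Hd lam mu β I
      = ENNReal.ofReal (dislocationWeight o φ Hd β I * Real.exp (-(β * q))) := by
  rw [gibbsWeight, dislocationWeight, h]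
  split_ifs with htop
  · rw [htop]
    simp [EReal.coe_mul_top_of_pos hβ]
  · lift Hd (burgers o φ I) to NNReal using htop with x hx
    rw [ ← Real.exp_add]
    have : (ENNReal.ofReal q + (x : ℝ≥0∞) : ℝ≥0∞) = ENNReal.ofReal (q + x) := by
      rw [ENNReal.ofReal_add hq x.coe_nonneg, ENNReal.ofReal_coe_nnreal]
    rw [this, EReal.coe_ennreal_ofReal, max_eq_left (by positivity), ← EReal.coe_mul,
      ← EReal.coe_neg, EReal.exp_coe, ENNReal.coe_toReal]
    congr 2
    ring

variable (Γ o E) in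
/-- The currents with values of norm at most `N`. -/
theorem finite_boundedCurrents [DiscreteTopology Γ] (N : ℝ) :
    {I : currents Γ o E | ∀ e, ‖I.1 e‖ ≤ N}.Finite := by
  have h1 : {f : E → E3 | ∀ e, f e ∈ {g : E3 | g ∈ Γ ∧ ‖g‖ ≤ N}}.Finite :=
    Set.Finite.pi' fun _ => lattice_finite_ball Γ N
  refine Set.Finite.of_finite_image (f := Subtype.val) (h1.subset ?_)
    Subtype.val_injective.injOn
  rintro _ ⟨I, hI, rfl⟩ e
  exact ⟨I.2.1 e, hI e⟩

variable (Γ o E) in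
/-- The finite set of currents with values of norm at most `N`. -/
def boundedCurrents [DiscreteTopology Γ] (N : ℝ) : Finset (currents Γ o E) :=
  (finite_boundedCurrents Γ o E N).toFinset

/-- The finite set of nonzero lattice vectors of norm at most `N`. -/
def boundedVectors (Γ : Submodule ℤ E3) [DiscreteTopology Γ] (N : ℝ) : Finset E3 :=
  ((lattice_finite_ball Γ N).sdiff (t := {0})).toFinset

/-- The dislocation factor alone is the gas weight, with decay rate βc. The cutoff N makes the
family finite and is imposed edge by edge so as to respect splitting and gluing. -/
theorem isCurrentGas_boundedCurrents [DiscreteTopology Γ] (hH : IsDislocationEnergy Γ o φ c Hd)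
    (hβ : 0 < β) {N : ℝ} (hN : 0 ≤ N) :
    IsCurrentGas (EdgesTouch E)
      ((boundedCurrents Γ o E N).map (Function.Embedding.subtype _))
      (dislocationWeight o φ Hd β) (boundedVectors Γ N) (β * c) := by
  have hmem : ∀ I : E → E3, I ∈ (boundedCurrents Γ o E N).map (Function.Embedding.subtype _) ↔
      I ∈ currents Γ o E ∧ ∀ e, ‖I e‖ ≤ N := by
    intro I
    simp only [Finset.mem_map, boundedCurrents, Set.Finite.mem_toFinset, Set.mem_ofPred_eq,
      Function.Embedding.coe_subtype, Subtype.exists, exists_and_right, exists_eq_right]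
    exact ⟨fun ⟨h1, h2⟩ => ⟨h1, h2⟩, fun ⟨h1, h2⟩ => ⟨h1, h2⟩⟩
  have hloc : ∀ I₁ I₂ : E → E3, Disjoint (currentSupport I₂)
      (relNhd (EdgesTouch E) (currentSupport I₁)) → ∀ e f : E, I₁ e ≠ 0 → I₂ f ≠ 0 →
      ∀ v : E3, v ∈ ((e : Λ.Edge) : Sym2 E3) → v ∉ ((f : Λ.Edge) : Sym2 E3) := by
    intro I₁ I₂ hd e f he hf v hve hvf
    exact Finset.disjoint_left.1 hd (mem_currentSupport.2 hf)
      (mem_relNhd.2 ⟨e, mem_currentSupport.2 he, v, hve, hvf⟩)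
  constructor
  · exact (hmem 0).2 ⟨zero_mem_currents, fun e => by simpa using hN⟩
  · simp [dislocationWeight, hH.zero E]
  · exact dislocationWeight_nonneg
  · intro I hI
    rw [hmem] at hI ⊢
    exact ⟨neg_mem_currents hI.1, fun e => by simpa using hI.2 e⟩
  · intro I hI
    rw [dislocationWeight, dislocationWeight, hH.symm E I ((hmem I).1 hI).1]
  · intro C S hd I hI hs
    rw [hmem] at hI
    have := restrict_mem_currents hd hI.1 hs
    rw [hmem, hmem]
    have hb : ∀ (T : Finset E) (e : E), ‖restrictCurrent I T e‖ ≤ N := fun T e => by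
      rw [restrictCurrent]
      split_ifs
      · exact hI.2 e
      · simpa using hN
    exact ⟨⟨this.1, hb C⟩, ⟨this.2, hb S⟩⟩
  · intro I₁ h₁ I₂ h₂ hd
    rw [hmem] at h₁ h₂ ⊢
    -- The supports are disjoint, so on each edge only one summand counts and the cutoff is
    -- preserved.
    refine ⟨add_mem_currents h₁.1 h₂.1, fun e => ?_⟩
    by_cases h1 : I₁ e = 0
    · simpa [h1] using h₂.2 e
    · have h2 : I₂ e = 0 := by
        by_contra h2
        exact hloc I₁ I₂ hd e e h1 h2 _ (src_mem o _) (src_mem o _)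
      simpa [h2] using h₁.2 e
  · intro I₁ h₁ I₂ h₂ hd
    have hadd := hH.locality E I₁ ((hmem _).1 h₁).1 I₂ ((hmem _).1 h₂).1 (hloc I₁ I₂ hd)
    rw [dislocationWeight, dislocationWeight, dislocationWeight, hadd]
    by_cases t1 : Hd (burgers o φ I₁) = ⊤
    · simp [t1]
    · by_cases t2 : Hd (burgers o φ I₂) = ⊤
      · simp [t2]
      · rw [if_neg (ENNReal.add_ne_top.2 ⟨t1, t2⟩), if_neg t1, if_neg t2, ENNReal.toReal_add t1 t2,
          ← Real.exp_add]
        congr 1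
        ring
  · intro I hI e he
    rw [hmem] at hI
    rw [boundedVectors, Set.Finite.mem_toFinset]
    exact ⟨⟨hI.1.1 e, hI.2 e⟩, he⟩
  · intro I hI
    have hlow := hH.lower E I ((hmem _).1 hI).1
    rw [dislocationWeight]
    split_ifs with htop
    · positivity
    · rw [Real.exp_le_exp, neg_le_neg_iff, mul_assoc]
      refine mul_le_mul_of_nonneg_left ?_ hβ.le
      exact (ENNReal.ofReal_le_iff_le_toReal htop).1 hlow

end Dislocations

/-! ### Removing the cutoff and choosing the constants -/

section GibbsBounds

variable {Λ : MesoscopicLattice} {Γ : Submodule ℤ E3} {o : CountingDirection Λ} {φ : E3 → ℝ}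
  {c : ℝ} {Hd : TensorField → ℝ≥0∞} {lam mu β : ℝ} {E : Finset Λ.Edge}

theorem currentForm_smul (r : ℝ) (Q : Matrix (E × Fin 3) (E × Fin 3) ℝ) (I : E → E3) :
    currentForm (r • Q) I = r * currentForm Q I := by
  simp only [currentForm, Finset.mul_sum]
  refine Finset.sum_congr rfl fun a _ => Finset.sum_congr rfl fun c _ => ?_
  rw [Matrix.smul_apply, smul_eq_mul]
  ring

theorem currentForm_nonneg {Q : Matrix (E × Fin 3) (E × Fin 3) ℝ} (hQ : Q.PosSemidef)
    (I : E → E3) : 0 ≤ currentForm Q I := by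
  have := hQ.dotProduct_mulVec_nonneg fun a => I a.1 a.2
  refine this.trans_eq ?_
  simp only [dotProduct, Matrix.mulVec, currentForm, Finset.mul_sum, star_trivial, mul_assoc]

theorem currentForm_neg (Q : Matrix (E × Fin 3) (E × Fin 3) ℝ) (I : E → E3) :
    currentForm Q (-I) = currentForm Q I := by
  simp [currentForm]

/-- The bound on supports in zero field. It depends on the cutoff only through the edge activity,
which yields summability of the Gibbs weights. -/
theorem IsCurrentGas.sum_weight_le {ι : Type*} [Fintype ι] [DecidableEq ι] {R : ι → ι → Prop}
    {𝓙 : Finset (ι → E3)}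
    {K : (ι → E3) → ℝ} {G : Finset E3} {b : ℝ} (h : IsCurrentGas R 𝓙 K G b) :
    ∑ I ∈ 𝓙, K I ≤ ∑ S ∈ (Finset.univ : Finset ι).powerset, edgeActivity G b ^ S.card := by
  have h1 : gasSum 𝓙 K 0 1 = ((∑ I ∈ 𝓙, K I : ℝ) : ℂ) := by
    simp [gasSum, complexWeight, pairing]
  have h2 : ‖gasSum 𝓙 K 0 1‖ ≤ ∑ S ∈ (Finset.univ : Finset ι).powerset,
      edgeActivity G b ^ S.card := by
    rw [gasSum_one, polymerSum]
    refine (norm_sum_le _ _).trans (Finset.sum_le_sum fun S _ => ?_)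
    exact h.norm_supportSum_le (h.norm_weight_le' (by simp)) S
  rw [h1, Complex.norm_real] at h2
  exact (Real.le_norm_self _).trans h2

theorem boundedCurrents_mono [DiscreteTopology Γ] : Monotone (boundedCurrents Γ o E) := by
  intro N M hNM I hI
  rw [boundedCurrents, Set.Finite.mem_toFinset] at hI ⊢
  exact fun e => (hI e).trans hNM

theorem exists_mem_boundedCurrents [DiscreteTopology Γ] (I : currents Γ o E) :
    ∃ n : ℕ, I ∈ boundedCurrents Γ o E n := by
  obtain ⟨n, hn⟩ := exists_nat_ge (∑ e, ‖I.1 e‖)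
  refine ⟨n, ?_⟩
  rw [boundedCurrents, Set.Finite.mem_toFinset]
  exact fun e => (Finset.single_le_sum (f := fun e => ‖I.1 e‖) (fun _ _ => norm_nonneg _)
    (Finset.mem_univ e)).trans hn

theorem countable_currents [DiscreteTopology Γ] : Countable (currents Γ o E) := by
  have : (Set.univ : Set (currents Γ o E)) = ⋃ n : ℕ, (boundedCurrents Γ o E n : Set _) := by
    symm
    rw [Set.eq_univ_iff_forall]
    exact fun I => Set.mem_iUnion.2 (exists_mem_boundedCurrents I)
  rw [← Set.countable_univ_iff, this]
  exact Set.countable_iUnion fun n => Finset.countable_toSet _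

/-- The bounds for the Gibbs measure, given that the minimal elastic energy is a quadratic form
and the observable is linear. -/
theorem gibbsMeasure_bounds [DiscreteTopology Γ] (hH : IsDislocationEnergy Γ o φ c Hd)
    (hβ : 0 < β) {Q : Matrix (E × Fin 3) (E × Fin 3) ℝ} (hQ : Q.PosSemidef)
    (hmin : ∀ I ∈ currents Γ o E,
      minElasticEnergy lam mu (burgers o φ I) = ENNReal.ofReal (currentForm Q I))
    {D : ℕ} (hD : ∀ e, (relNhd (EdgesTouch E) {e}).card ≤ D) {q : ℝ}
    (hq : ∀ N : ℝ, edgeActivity (boundedVectors Γ N) (β * c) ≤ q) (hqD : q * 4 ^ D ≤ 1 / 2)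
    {O : currents Γ o E → ℝ} {σ : E × Fin 3 → ℝ} (hO : ∀ I, O I = realPairing σ I.1)
    {ε : ℝ} (hε : q * 4 ^ D * ∑ a, σ a ^ 2 ≤ ε) :
    (∀ t : ℝ,
      (∫ I, Complex.exp (Complex.I * t * O I) ∂(gibbsMeasure Γ o φ Hd lam mu β E)).im = 0 ∧
      Real.exp (-(t ^ 2 / 2 * ε)) ≤
        (∫ I, Complex.exp (Complex.I * t * O I) ∂(gibbsMeasure Γ o φ Hd lam mu β E)).re) ∧
    MemLp O 2 (gibbsMeasure Γ o φ Hd lam mu β E) ∧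
    variance O (gibbsMeasure Γ o φ Hd lam mu β E) ≤ ε := by
  have hcount : Countable (currents Γ o E) := countable_currents
  set K := dislocationWeight o φ Hd β (E := E)
  -- The local factor K and the long-range elastic factor are kept apart: K is treated by the gas,
  -- the quadratic form by the Gaussian mixture.
  let W : currents Γ o E → ℝ := fun I => K I.1 * Real.exp (-currentForm (β • Q) I.1)
  have hw : ∀ I : currents Γ o E, gibbsWeight o φ Hd lam mu β I.1 = ENNReal.ofReal (W I) := by
    intro I
    rw [gibbsWeight_eq hβ (currentForm_nonneg hQ I.1) (hmin I.1 I.2)]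
    simp only [W, currentForm_smul]
    rfl
  have hμ : gibbsMeasure Γ o φ Hd lam mu β E = discreteGibbs fun I => ENNReal.ofReal (W I) := by
    simp only [gibbsMeasure, partitionSum, discreteGibbs, hw]
  have hβQ : (β • Q).PosSemidef := hQ.smul hβ.le
  have hW : ∀ I, 0 ≤ W I := fun I =>
    mul_nonneg (dislocationWeight_nonneg _) (Real.exp_pos _).le
  have hgas : ∀ N : ℕ, IsCurrentGas (EdgesTouch E)
      ((boundedCurrents Γ o E N).map (Function.Embedding.subtype _)) K (boundedVectors Γ N) (β * c) :=
    fun N => isCurrentGas_boundedCurrents hH hβ N.cast_nonneg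
  have hlim : Tendsto (fun n : ℕ => boundedCurrents Γ o E (n : ℝ)) atTop atTop :=
    tendsto_atTop_finset_of_monotone (fun n m hnm => boundedCurrents_mono (by exact_mod_cast hnm))
      exists_mem_boundedCurrents
  have hle : ∀ I, W I ≤ K I.1 := fun I => by
    refine mul_le_of_le_one_right (dislocationWeight_nonneg _) (Real.exp_le_one_iff.2 ?_)
    exact neg_nonpos.2 (currentForm_nonneg hβQ _)
  have hs : Summable W := by
    refine summable_of_sum_le hW (c := ∑ S ∈ (Finset.univ : Finset E).powerset, q ^ S.card)
      fun F => ?_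
    obtain ⟨n, hn⟩ := (hlim.eventually (eventually_ge_atTop F)).exists
    calc ∑ I ∈ F, W I ≤ ∑ I ∈ boundedCurrents Γ o E n, W I :=
          Finset.sum_le_sum_of_subset_of_nonneg hn fun I _ _ => hW I
      _ ≤ ∑ I ∈ boundedCurrents Γ o E n, K I.1 := Finset.sum_le_sum fun I _ => hle I
      _ = ∑ I ∈ (boundedCurrents Γ o E n).map (Function.Embedding.subtype _), K I := by
          rw [Finset.sum_map]; rfl
      _ ≤ _ := (hgas n).sum_weight_le
      _ ≤ _ := Finset.sum_le_sum fun S _ => pow_le_pow_left₀ (edgeActivity_nonneg _ _) (hq n) _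
  have hpos : 0 < ∑' I, W I := by
    refine hs.tsum_pos hW ⟨0, zero_mem_currents⟩ ?_
    have : K 0 = 1 := (hgas 0).weight_zero
    simp only [W, this, one_mul]
    exact Real.exp_pos _
  rw [hμ]
  let ν : currents Γ o E ≃ currents Γ o E :=
    { toFun := fun I => ⟨-I.1, neg_mem_currents I.2⟩
      invFun := fun I => ⟨-I.1, neg_mem_currents I.2⟩
      left_inv := fun I => Subtype.ext (neg_neg _)
      right_inv := fun I => Subtype.ext (neg_neg _) }
  refine discreteGibbs_bounds ν hW hs hpos (fun I => ?_) (fun I => ?_) fun t => ?_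
  · have : K (-I.1) = K I.1 := by
      simp only [K, dislocationWeight]
      rw [hH.symm E I.1 I.2]
    simp only [W, ν, Equiv.coe_fn_mk, this, currentForm_neg]
  · rw [hO, hO]
    exact realPairing_neg _ _
  · have hsc : Summable fun I => W I * Real.cos (t * O I) := by
      refine Summable.of_norm_bounded hs fun I => ?_
      rw [norm_mul, Real.norm_eq_abs, abs_of_nonneg (hW I)]
      exact mul_le_of_le_one_right (hW I) (Real.abs_cos_le_one _)
    -- Both sides are limits of their restrictions to the currents bounded by n, where the
    -- inequality holds with the same ε.
    refine le_of_tendsto_of_tendsto' ((hs.hasSum.comp hlim).const_mul _) (hsc.hasSum.comp hlim)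
      fun n => ?_
    have hqn : edgeActivity (boundedVectors Γ n) (β * c) * 4 ^ D ≤ 1 / 2 := by
      refine le_trans ?_ hqD
      gcongr
      exact hq n
    have key := (hgas n).sum_gaussian_cos_ge (edgesTouch_refl o) hD hqn σ hβQ t
    rw [Finset.sum_map, Finset.sum_map] at key
    refine le_trans ?_ (key.trans_eq ?_)
    · refine mul_le_mul ?_ le_rfl (Finset.sum_nonneg fun I _ => hW I) (Real.exp_pos _).le
      rw [Real.exp_le_exp, neg_le_neg_iff]
      refine mul_le_mul_of_nonneg_left (le_trans ?_ hε) (by positivity)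
      have := hq n
      have h0 : 0 ≤ ∑ a, σ a ^ 2 := Finset.sum_nonneg fun _ _ => sq_nonneg _
      gcongr
    · refine Finset.sum_congr rfl fun I _ => ?_
      simp only [hO]
      rfl

/-- The final theorem, reduced to the elastic energy. -/
theorem exists_gibbs_constants (Γ : Submodule ℤ E3) [DiscreteTopology Γ] (Λ : MesoscopicLattice)
    {c : ℝ} (hc : 0 < c) {B : ℝ} (hB : 0 ≤ B) :
    ∃ c₂ : ℝ, 0 < c₂ ∧ ∃ β₀ : ℝ, ∀ β : ℝ, β₀ < β → 0 < β ∧ ∃ q : ℝ, ∃ D : ℕ,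
      (∀ (E : Finset Λ.Edge) (e : E), (relNhd (EdgesTouch E) {e}).card ≤ D) ∧
      (∀ N : ℝ, edgeActivity (boundedVectors Γ N) (β * c) ≤ q) ∧ q * 4 ^ D ≤ 1 / 2 ∧
      ∀ s : ℝ, s ≤ B → q * 4 ^ D * s ≤ Real.exp (-(c₂ * β)) := by
  obtain ⟨D, hD⟩ := exists_card_relNhd_le Λ
  obtain ⟨A, m, hA, hm, hq⟩ := exists_edgeActivity_le Γ
  have hmc : 0 < m * c / 2 := by positivity
  -- The activity decays like exp(-mcβ): half of the rate becomes c₂, the other half absorbs A 4^D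
  -- (2 + B), where the 2 secures q 4^D ≤ 1/2 and B the variance. The threshold 5/c makes the decay
  -- rate βc at least 5.
  refine ⟨m * c / 2, hmc, max (5 / c) (A * 4 ^ D * (2 + B) / (m * c / 2)), fun β hβ => ?_⟩
  have h5 : 5 / c < β := (le_max_left _ _).trans_lt hβ
  have hβ2 : A * 4 ^ D * (2 + B) / (m * c / 2) < β := (le_max_right _ _).trans_lt hβ
  have hβ0 : 0 < β := lt_trans (by positivity) h5
  rw [div_lt_iff₀ hc] at h5
  rw [div_lt_iff₀ hmc] at hβ2
  have hsmall : A * Real.exp (-(m * (β * c))) * 4 ^ D * (2 + B) ≤ Real.exp (-(m * c / 2 * β)) := by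
    have h1 := Real.add_one_le_exp (m * c / 2 * β)
    have h2 : Real.exp (-(m * (β * c))) = Real.exp (-(m * c / 2 * β)) * Real.exp (-(m * c / 2 * β)) := by
      rw [← Real.exp_add]; congr 1; ring
    rw [h2]
    have h3 : A * 4 ^ D * (2 + B) ≤ Real.exp (m * c / 2 * β) := by linarith
    calc _ = (A * 4 ^ D * (2 + B)) * (Real.exp (-(m * c / 2 * β)) * Real.exp (-(m * c / 2 * β))) := by
          ring
      _ ≤ Real.exp (m * c / 2 * β) * (Real.exp (-(m * c / 2 * β)) * Real.exp (-(m * c / 2 * β))) := by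
          gcongr
      _ = _ := by rw [← mul_assoc, ← Real.exp_add]; simp
  have hx : 0 ≤ A * Real.exp (-(m * (β * c))) * 4 ^ D := by positivity
  refine ⟨hβ0, A * Real.exp (-(m * (β * c))), D, hD, fun N => hq _ h5.le _ ?_, ?_, fun s hs => ?_⟩
  · intro g hg
    rw [boundedVectors, Set.Finite.mem_toFinset] at hg
    exact ⟨hg.1.1, hg.2⟩
  · have h1 : Real.exp (-(m * c / 2 * β)) ≤ 1 := Real.exp_le_one_iff.2 (by
      have : 0 < m * c / 2 * β := by positivity
      linarith)
    nlinarith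
  · nlinarith

end GibbsBounds

/-! ### Fourier analysis of real fields -/

section FourierPairs

open FourierTransform

/-- Fubini's theorem in the form of the symmetry of the Fourier integral; reflecting s passes to the
inverse transform. -/
theorem integrable_fourierInv_smul_eq {g : E3 → ℂ} (hg : Integrable g) (s : SchwartzMap E3 ℂ) :
    ∫ x, s x • 𝓕⁻ g x = ∫ ξ, (𝓕⁻ (s : E3 → ℂ)) ξ • g ξ := by
  have hs : Integrable (fun x => s (-x)) := s.integrable.comp_neg
  have h := VectorFourier.integral_fourierIntegral_smul_eq_flip (𝕜 := ℝ) (V := E3) (W := E3)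
    (e := Real.fourierChar) (μ := volume) (ν := volume) (L := innerₗ E3)
    (f := fun x => s (-x)) (g := g) Real.continuous_fourierChar (by
      exact continuous_inner) hs hg
  rw [flip_innerₗ] at h
  have e1 : ∀ ξ, (𝓕⁻ (s : E3 → ℂ)) ξ
      = VectorFourier.fourierIntegral Real.fourierChar volume (innerₗ E3) (fun x => s (-x)) ξ := by
    intro ξ
    rw [Real.fourierInv_eq_fourier_comp_neg]
    rfl
  simp only [e1]
  rw [h, ← integral_neg_eq_self (fun x => s x • 𝓕⁻ g x) volume]
  refine integral_congr_ae (ae_of_all _ fun x => ?_)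
  simp only [Real.fourierInv_eq_fourier_neg, neg_neg]
  rfl

/-- Plancherel's theorem for functions in `L¹ ∩ L²`. -/
theorem fourierInv_ae_eq {g : E3 → ℂ} (hg : Integrable g) (hg2 : MemLp g 2) :
    (𝓕⁻ (hg2.toLp g) : Lp ℂ 2 (volume : Measure E3)) =ᵐ[volume] 𝓕⁻ g := by
  set F : Lp ℂ 2 (volume : Measure E3) := 𝓕⁻ (hg2.toLp g)
  have hF : LocallyIntegrable F volume := (Lp.memLp F).locallyIntegrable (by norm_num)
  have hcont : Continuous (𝓕⁻ g) := by
    rw [Real.fourierInv_eq_fourier_comp_neg]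
    exact VectorFourier.fourierIntegral_continuous Real.continuous_fourierChar
      (by exact continuous_inner) hg.comp_neg
  -- Both functions define the same tempered distribution: the L² transform is compatible with the
  -- distributional one, and the integral transform is moved to the test function.
  refine ae_eq_of_integral_contDiff_smul_eq hF hcont.locallyIntegrable fun s hs hc => ?_
  let S : SchwartzMap E3 ℂ := HasCompactSupport.toSchwartzMap (f := fun x => ((s x : ℝ) : ℂ))
    (hc.comp_left (g := fun r : ℝ => (r : ℂ)) (by simp)) (Complex.ofRealCLM.contDiff.comp hs)
  have h1 := congrArg (fun T => T S) (Lp.fourierInv_toTemperedDistribution_eq (hg2.toLp g))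
  have h2 : (Lp.toTemperedDistribution F) S = ∫ x, S x • F x :=
    Lp.toTemperedDistribution_apply F S
  have h3 : (𝓕⁻ (Lp.toTemperedDistribution (hg2.toLp g))) S
      = ∫ ξ, (𝓕⁻ S) ξ • (hg2.toLp g) ξ := Lp.toTemperedDistribution_apply (hg2.toLp g) (𝓕⁻ S)
  have hS : ∀ (x : E3) (z : ℂ), S x • z = s x • z := fun x z => by
    change ((s x : ℝ) : ℂ) • z = s x • z
    simp
  calc ∫ x, s x • F x = ∫ x, S x • F x := by simp only [hS]
    _ = ∫ ξ, (𝓕⁻ S) ξ • (hg2.toLp g) ξ := by rw [← h3, h1, h2]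
    _ = ∫ ξ, (𝓕⁻ S) ξ • g ξ := by
        refine integral_congr_ae ?_
        filter_upwards [hg2.coeFn_toLp] with ξ hξ
        rw [hξ]
    _ = ∫ ξ, (𝓕⁻ (S : E3 → ℂ)) ξ • g ξ := by rw [SchwartzMap.fourierInv_coe]
    _ = ∫ x, S x • 𝓕⁻ g x := (integrable_fourierInv_smul_eq hg S).symm
    _ = _ := by simp only [hS]

theorem eLpNorm_fourierInv {g : E3 → ℂ} (hg : Integrable g) (hg2 : MemLp g 2) :
    eLpNorm (𝓕⁻ g) 2 volume = eLpNorm g 2 volume := by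
  rw [← eLpNorm_congr_ae (fourierInv_ae_eq hg hg2), ← eLpNorm_congr_ae hg2.coeFn_toLp,
    ← Lp.enorm_def (𝓕⁻ (hg2.toLp g) : Lp ℂ 2 (volume : Measure E3)), ← Lp.enorm_def (hg2.toLp g)]
  have : ‖(𝓕⁻ (hg2.toLp g) : Lp ℂ 2 (volume : Measure E3))‖ = ‖hg2.toLp g‖ :=
    (Lp.fourierTransformₗᵢ E3 ℂ).symm.norm_map _
  rw [← ofReal_norm, ← ofReal_norm, this]

/-- The real function `h` is the inverse Fourier transform of `g ∈ L¹ ∩ L²`. -/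
structure IsFourierPair (h : E3 → ℝ) (g : E3 → ℂ) : Prop where
  integrable : Integrable g
  memLp : MemLp g 2
  eq : ∀ x, (h x : ℂ) = 𝓕⁻ g x

theorem fourierInv_add_apply {g₁ g₂ : E3 → ℂ} (h₁ : Integrable g₁) (h₂ : Integrable g₂) (x : E3) :
    𝓕⁻ (fun ξ => g₁ ξ + g₂ ξ) x = 𝓕⁻ g₁ x + 𝓕⁻ g₂ x := by
  rw [Real.fourierInv_eq, Real.fourierInv_eq, Real.fourierInv_eq]
  simp only [smul_add]
  refine integral_add ?_ ?_
  · have := (Real.fourierIntegral_convergent_iff (-x)).2 h₁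
    simpa using this
  · have := (Real.fourierIntegral_convergent_iff (-x)).2 h₂
    simpa using this

theorem fourierInv_const_mul_apply (z : ℂ) (g : E3 → ℂ) (x : E3) :
    𝓕⁻ (fun ξ => z * g ξ) x = z * 𝓕⁻ g x := by
  rw [Real.fourierInv_eq, Real.fourierInv_eq, ← integral_const_mul]
  refine integral_congr_ae (ae_of_all _ fun ξ => ?_)
  simp only [Circle.smul_def, smul_eq_mul]
  ring

namespace IsFourierPair

variable {h h₁ h₂ : E3 → ℝ} {g g₁ g₂ : E3 → ℂ}

theorem add (p₁ : IsFourierPair h₁ g₁) (p₂ : IsFourierPair h₂ g₂) :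
    IsFourierPair (fun x => h₁ x + h₂ x) (fun ξ => g₁ ξ + g₂ ξ) :=
  ⟨p₁.integrable.add p₂.integrable, p₁.memLp.add p₂.memLp, fun x => by
    rw [fourierInv_add_apply p₁.integrable p₂.integrable, ← p₁.eq, ← p₂.eq]
    push_cast
    rfl⟩

theorem const_mul (p : IsFourierPair h g) (r : ℝ) :
    IsFourierPair (fun x => r * h x) (fun ξ => (r : ℂ) * g ξ) :=
  ⟨p.integrable.const_mul _, p.memLp.const_mul _, fun x => by
    rw [fourierInv_const_mul_apply, ← p.eq]
    push_cast
    rfl⟩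

theorem sub (p₁ : IsFourierPair h₁ g₁) (p₂ : IsFourierPair h₂ g₂) :
    IsFourierPair (fun x => h₁ x - h₂ x) (fun ξ => g₁ ξ - g₂ ξ) := by
  have := p₁.add (p₂.const_mul (-1))
  simpa [sub_eq_add_neg] using this

theorem finset_sum {ι : Type*} (s : Finset ι) {h : ι → E3 → ℝ} {g : ι → E3 → ℂ}
    (p : ∀ i, IsFourierPair (h i) (g i)) :
    IsFourierPair (fun x => ∑ i ∈ s, h i x) (fun ξ => ∑ i ∈ s, g i ξ) := by
  classical
  induction s using Finset.induction_on with
  | empty =>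
    refine ⟨by simp, by simp, fun x => ?_⟩
    rw [Real.fourierInv_eq]
    simp
  | insert a s ha ih =>
    simp only [Finset.sum_insert ha]
    exact (p a).add ih

theorem enorm_eq (p : IsFourierPair h g) (x : E3) : ‖h x‖ₑ = ‖𝓕⁻ g x‖ₑ := by
  rw [← p.eq, ← ofReal_norm, ← ofReal_norm, Complex.norm_real]

theorem eLpNorm_eq (p : IsFourierPair h g) : eLpNorm h 2 volume = eLpNorm g 2 volume := by
  rw [← eLpNorm_fourierInv p.integrable p.memLp]
  exact eLpNorm_congr_enorm_ae (ae_of_all _ p.enorm_eq)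

theorem continuous (p : IsFourierPair h g) : Continuous h := by
  have hcont : Continuous (𝓕⁻ g) := by
    rw [Real.fourierInv_eq_fourier_comp_neg]
    exact VectorFourier.fourierIntegral_continuous Real.continuous_fourierChar
      (by exact continuous_inner) p.integrable.comp_neg
  have : h = fun x => (𝓕⁻ g x).re := funext fun x => by rw [← p.eq, Complex.ofReal_re]
  rw [this]
  exact Complex.continuous_re.comp hcont

theorem memLp_left (p : IsFourierPair h g) : MemLp h 2 :=
  ⟨p.continuous.aestronglyMeasurable, by rw [p.eLpNorm_eq]; exact p.memLp.2⟩

theorem eLpNorm_two_sq {F : Type*} [NormedAddCommGroup F] {f : E3 → F} (hf : MemLp f 2) :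
    eLpNorm f 2 volume = ENNReal.ofReal (Real.sqrt (∫ x, ‖f x‖ ^ 2)) := by
  rw [hf.eLpNorm_eq_integral_rpow_norm (by norm_num) (by norm_num), Real.sqrt_eq_rpow]
  norm_num

theorem integral_sq (p : IsFourierPair h g) : ∫ x, h x ^ 2 = ∫ ξ, ‖g ξ‖ ^ 2 := by
  have := p.eLpNorm_eq
  rw [eLpNorm_two_sq p.memLp_left, eLpNorm_two_sq p.memLp,
    ENNReal.ofReal_eq_ofReal_iff (Real.sqrt_nonneg _) (Real.sqrt_nonneg _),
    Real.sqrt_inj (integral_nonneg fun _ => sq_nonneg _) (integral_nonneg fun _ => sq_nonneg _)]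
    at this
  simpa using this

theorem abs_le (p : IsFourierPair h g) (x : E3) : |h x| ≤ ∫ ξ, ‖g ξ‖ := by
  rw [← Real.norm_eq_abs, ← Complex.norm_real, p.eq, Real.fourierInv_eq_fourier_comp_neg]
  refine (VectorFourier.norm_fourierIntegral_le_integral_norm _ _ _ _ _).trans_eq ?_
  exact integral_neg_eq_self (fun ξ => ‖g ξ‖) volume

theorem contDiff (p : IsFourierPair h g) (hm : ∀ n : ℕ, Integrable fun ξ => ‖ξ‖ ^ n * ‖g ξ‖) :
    ContDiff ℝ ∞ h := by
  have h1 : ContDiff ℝ ∞ (𝓕⁻ g) := by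
    rw [Real.fourierInv_eq_fourier_comp_neg]
    refine Real.contDiff_fourier (N := ⊤) fun n _ => ?_
    simpa using (hm n).comp_neg
  have : h = fun x => (𝓕⁻ g x).re := funext fun x => by rw [← p.eq, Complex.ofReal_re]
  rw [this]
  exact Complex.reCLM.contDiff.comp h1

/-- Functions with Hermitian symmetry have a real inverse Fourier transform. -/
theorem of_hermitian (hg : Integrable g) (hg2 : MemLp g 2)
    (hsymm : ∀ ξ, g (-ξ) = (starRingEnd ℂ) (g ξ)) :
    IsFourierPair (fun x => (𝓕⁻ g x).re) g := by
  refine ⟨hg, hg2, fun x => Complex.conj_eq_iff_re.1 ?_⟩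
  rw [Real.fourierInv_eq, ← integral_conj, ← integral_neg_eq_self]
  refine integral_congr_ae (ae_of_all _ fun ξ => ?_)
  simp only [Circle.smul_def, smul_eq_mul, map_mul, hsymm, Complex.conj_conj, inner_neg_left]
  rw [← Circle.coe_inv_eq_conj, ← AddChar.map_neg_eq_inv, neg_neg]

end IsFourierPair

theorem partialDeriv_re_fourierInv {g : E3 → ℂ} (hg : Integrable g)
    (hg1 : Integrable fun ξ => ‖ξ‖ * ‖g ξ‖) (i : Fin 3) (x : E3) :
    partialDeriv i (fun x => (𝓕⁻ g x).re) x
      = (𝓕⁻ (fun ξ => 2 * Real.pi * Complex.I * (ξ i : ℂ) * g ξ) x).re := by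
  have hd := Real.hasFDerivAt_fourier (f := fun ξ => g (-ξ)) hg.comp_neg
    (by simpa using hg1.comp_neg) x
  rw [← Real.fourierInv_eq_fourier_comp_neg] at hd
  have hre := Complex.reCLM.hasFDerivAt.comp x hd
  have hfd : fderiv ℝ (fun x => (𝓕⁻ g x).re) x = _ := HasFDerivAt.fderiv hre
  rw [partialDeriv, hfd]
  simp only [ContinuousLinearMap.comp_apply, Complex.reCLM_apply]
  congr 1
  rw [Real.fourier_continuousLinearMap_apply, Real.fourierInv_eq_fourier_comp_neg]
  · refine congrFun (congrArg _ (funext fun ξ => ?_)) x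
    rw [VectorFourier.fourierSMulRight_apply, innerSL_apply_apply, EuclideanSpace.inner_single_right]
    simp
    ring
  · refine ((hg1.comp_neg).const_mul (2 * Real.pi * ‖innerSL ℝ (E := E3)‖)).mono'
      (AEStronglyMeasurable.fourierSMulRight hg.comp_neg.aestronglyMeasurable)
      (ae_of_all _ fun ξ => ?_)
    refine (VectorFourier.norm_fourierSMulRight_le _ _ _).trans_eq ?_
    simp only [norm_neg]
    ring

/-- The Fourier transform of a real function. -/
def realFourier (f : E3 → ℝ) : E3 → ℂ := 𝓕 fun x => (f x : ℂ)

theorem exists_schwartz {f : E3 → ℝ} (hf : ContDiff ℝ ∞ f) (hc : HasCompactSupport f) :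
    ∃ S : SchwartzMap E3 ℂ, (∀ x, S x = f x) ∧ ((𝓕 S : SchwartzMap E3 ℂ) : E3 → ℂ) = realFourier f := by
  let S : SchwartzMap E3 ℂ := HasCompactSupport.toSchwartzMap (f := fun x => ((f x : ℝ) : ℂ))
    (hc.comp_left (g := fun r : ℝ => (r : ℂ)) (by simp)) (Complex.ofRealCLM.contDiff.comp hf)
  exact ⟨S, fun x => rfl, by rw [SchwartzMap.fourier_coe]; rfl⟩

theorem isFourierPair_realFourier {f : E3 → ℝ} (hf : ContDiff ℝ ∞ f) (hc : HasCompactSupport f) :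
    IsFourierPair f (realFourier f) := by
  obtain ⟨S, hS, hF⟩ := exists_schwartz hf hc
  have hi : Integrable (realFourier f) := by rw [← hF]; exact (𝓕 S).integrable
  refine ⟨hi, by rw [← hF]; exact (𝓕 S).memLp 2, fun x => ?_⟩
  have hfi : Integrable fun x => (f x : ℂ) := by
    have : (fun x => (f x : ℂ)) = S := funext fun x => (hS x).symm
    rw [this]
    exact S.integrable
  exact (hfi.fourierInv_fourier_eq hi
    (Complex.continuous_ofReal.comp hf.continuous).continuousAt).symm

theorem realFourier_neg (f : E3 → ℝ) (ξ : E3) :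
    realFourier f (-ξ) = (starRingEnd ℂ) (realFourier f ξ) := by
  rw [realFourier, Real.fourier_eq, Real.fourier_eq, ← integral_conj]
  refine integral_congr_ae (ae_of_all _ fun x => ?_)
  simp only [Circle.smul_def, smul_eq_mul, map_mul, Complex.conj_ofReal, inner_neg_right, neg_neg]
  rw [← Circle.coe_inv_eq_conj, ← AddChar.map_neg_eq_inv, neg_neg]

theorem contDiff_partialDeriv {f : E3 → ℝ} (hf : ContDiff ℝ ∞ f) (i : Fin 3) :
    ContDiff ℝ ∞ (partialDeriv i f) :=
  (hf.fderiv_right (m := ∞) (by simp)).clm_apply contDiff_const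

theorem hasCompactSupport_partialDeriv {f : E3 → ℝ} (hc : HasCompactSupport f) (i : Fin 3) :
    HasCompactSupport (partialDeriv i f) := hc.fderiv_apply ℝ _

theorem realFourier_partialDeriv {f : E3 → ℝ} (hf : ContDiff ℝ ∞ f) (hc : HasCompactSupport f)
    (i : Fin 3) (ξ : E3) :
    realFourier (partialDeriv i f) ξ = 2 * Real.pi * Complex.I * (ξ i : ℂ) * realFourier f ξ := by
  have p := isFourierPair_realFourier hf hc
  have hd : ContDiff ℝ ∞ fun x => (f x : ℂ) := Complex.ofRealCLM.contDiff.comp hf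
  have hdc : HasCompactSupport fun x => (f x : ℂ) :=
    hc.comp_left (g := fun r : ℝ => (r : ℂ)) (by simp)
  have hi : Integrable (fun x => (f x : ℂ)) := hd.continuous.integrable_of_hasCompactSupport hdc
  have hi' : Integrable (fderiv ℝ fun x => (f x : ℂ)) :=
    (hd.continuous_fderiv (by simp)).integrable_of_hasCompactSupport (hdc.fderiv ℝ)
  have h1 := congrFun (Real.fourier_fderiv hi (hd.differentiable (by simp)) hi') ξ
  have h2 := congrArg (fun T => T (EuclideanSpace.single i (1 : ℝ))) h1
  rw [Real.fourier_continuousLinearMap_apply hi', VectorFourier.fourierSMulRight_apply] at h2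
  have h3 : (fun x => (fderiv ℝ (fun x => (f x : ℂ)) x) (EuclideanSpace.single i (1 : ℝ)))
      = fun x => ((partialDeriv i f x : ℝ) : ℂ) := by
    ext x
    have := (Complex.ofRealCLM.hasFDerivAt.comp x
      (hf.differentiable (by simp) x).hasFDerivAt).fderiv
    have h4 : (fun x => (f x : ℂ)) = Complex.ofRealCLM ∘ f := rfl
    rw [h4, this]
    rfl
  rw [h3] at h2
  rw [realFourier, h2, neg_apply, neg_apply,
    innerSL_apply_apply, EuclideanSpace.inner_single_right]
  simp [realFourier]
  ring

theorem realFourier_add {f g : E3 → ℝ} (hf : Integrable f) (hg : Integrable g) (ξ : E3) :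
    realFourier (fun x => f x + g x) ξ = realFourier f ξ + realFourier g ξ := by
  rw [realFourier, realFourier, realFourier, Real.fourier_eq, Real.fourier_eq, Real.fourier_eq]
  push_cast
  simp only [smul_add]
  refine integral_add ?_ ?_
  · exact (Real.fourierIntegral_convergent_iff ξ).2 hf.ofReal
  · exact (Real.fourierIntegral_convergent_iff ξ).2 hg.ofReal

theorem realFourier_const_mul (r : ℝ) (f : E3 → ℝ) (ξ : E3) :
    realFourier (fun x => r * f x) ξ = r * realFourier f ξ := by
  rw [realFourier, realFourier, Real.fourier_eq, Real.fourier_eq, ← integral_const_mul]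
  refine integral_congr_ae (ae_of_all _ fun ξ => ?_)
  simp only [Circle.smul_def, smul_eq_mul]
  push_cast
  ring

end FourierPairs

/-! ### The pointwise minimization problem in Fourier space -/

section Symbols

/-- The complex version of `F(U + Uᵗ)`. -/
def complexForm (lam mu : ℝ) (U : Matrix (Fin 3) (Fin 3) ℂ) : ℝ :=
  lam / 2 * ‖2 * U.trace‖ ^ 2 + mu * ∑ i, ∑ j, ‖U i j + U j i‖ ^ 2

/-- The field in Coulomb gauge with Burgers vector density `b`. -/
def coulombSymbol (ξ : E3) (b : Fin 3 → Fin 3 → Fin 3 → ℂ) : Matrix (Fin 3) (Fin 3) ℂ :=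
  Matrix.of fun j k => (∑ i, (ξ i : ℂ) * b i j k) / (2 * Real.pi * Complex.I * (‖ξ‖ ^ 2 : ℝ))

/-- The energy minimizing field with Burgers vector density `b`, where `κ = λ / (λ + 2μ)`. -/
def minimizerSymbol (κ : ℝ) (ξ : E3) (b : Fin 3 → Fin 3 → Fin 3 → ℂ) :
    Matrix (Fin 3) (Fin 3) ℂ :=
  Matrix.of fun j k => coulombSymbol ξ b j k - (ξ j : ℂ) / (‖ξ‖ ^ 2 : ℝ) *
    (∑ l, (ξ l : ℂ) * coulombSymbol ξ b k l + κ * ξ k * (coulombSymbol ξ b).trace)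

theorem normSq_sum_three (ξ : E3) : ‖ξ‖ ^ 2 = ξ 0 ^ 2 + ξ 1 ^ 2 + ξ 2 ^ 2 := by
  rw [EuclideanSpace.norm_sq_eq, Fin.sum_univ_three]
  simp

theorem coulombSymbol_transverse {ξ : E3} {b : Fin 3 → Fin 3 → Fin 3 → ℂ}
    (hb : ∀ i j k, b i j k = -b j i k) (k : Fin 3) :
    ∑ j, (ξ j : ℂ) * coulombSymbol ξ b j k = 0 := by
  have h : ∀ i, b i i k = 0 := fun i => self_eq_neg.1 (hb i i k)
  simp only [coulombSymbol, Matrix.of_apply, Fin.sum_univ_three]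
  rw [h 0, h 1, h 2, hb 1 0 k, hb 2 0 k, hb 2 1 k]
  ring

/-- The Euler–Lagrange equations of the elastic energy. -/
theorem minimizerSymbol_equilibrium {lam mu : ℝ} (h : 0 < lam + 2 * mu) {ξ : E3} (hξ : ξ ≠ 0)
    {b : Fin 3 → Fin 3 → Fin 3 → ℂ} (hb : ∀ i j k, b i j k = -b j i k) (k : Fin 3) :
    lam * (minimizerSymbol (lam / (lam + 2 * mu)) ξ b).trace * ξ k
      + mu * ∑ j, (minimizerSymbol (lam / (lam + 2 * mu)) ξ b j k
        + minimizerSymbol (lam / (lam + 2 * mu)) ξ b k j) * ξ j = 0 := by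
  set κ := lam / (lam + 2 * mu) with hκ
  have hκ2 : lam = κ * (lam + 2 * mu) := by rw [hκ]; field_simp
  have hN : ‖ξ‖ ^ 2 ≠ 0 := by simpa using hξ
  have hNc : ((‖ξ‖ ^ 2 : ℝ) : ℂ) ≠ 0 := by exact_mod_cast hN
  set n : ℂ := ((‖ξ‖ ^ 2 : ℝ) : ℂ) with hn
  have hn3 : n = (ξ 0 : ℂ) ^ 2 + (ξ 1 : ℂ) ^ 2 + (ξ 2 : ℂ) ^ 2 := by
    rw [hn, normSq_sum_three]; push_cast; rfl
  set w := coulombSymbol ξ b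
  have ht := coulombSymbol_transverse (ξ := ξ) hb
  set τ := w.trace
  set g : Fin 3 → ℂ := fun k => (∑ l, (ξ l : ℂ) * w k l + κ * ξ k * τ) / n with hg
  have hU : ∀ j k, minimizerSymbol κ ξ b j k = w j k - ξ j * g k := by
    intro j k
    simp only [minimizerSymbol, Matrix.of_apply, hg]
    ring
  have hgn : ∀ k, g k * n = ∑ l, (ξ l : ℂ) * w k l + κ * ξ k * τ := fun k =>
    div_mul_cancel₀ _ hNc
  -- Contracting the definition of g with ξ kills its first term by transversality. The trace
  -- becomes (1 - κ)τ, and equilibrium reduces to λ = κ(λ + 2μ).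
  have hξg : ∑ k, (ξ k : ℂ) * g k = κ * τ := by
    have h1 : (∑ k, (ξ k : ℂ) * g k) * n = κ * τ * n := by
      have h2 : ∑ l, (ξ l : ℂ) * ∑ k, (ξ k : ℂ) * w k l = 0 := by simp [ht, w]
      simp only [Fin.sum_univ_three] at h2 hgn ⊢
      rw [hn3] at hgn ⊢
      linear_combination (ξ 0 : ℂ) * hgn 0 + ξ 1 * hgn 1 + ξ 2 * hgn 2 + h2
    exact mul_right_cancel₀ hNc h1
  have htr : (minimizerSymbol κ ξ b).trace = τ - κ * τ := by
    rw [← hξg]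
    simp only [Matrix.trace, Matrix.diag, hU, Finset.sum_sub_distrib, τ]
  have h1 : ∑ j, minimizerSymbol κ ξ b j k * ξ j = -(g k * n) := by
    have := ht k
    simp only [hU, Fin.sum_univ_three] at this ⊢
    rw [hn3]
    linear_combination this
  have h2 : ∑ j, minimizerSymbol κ ξ b k j * ξ j = ∑ l, (ξ l : ℂ) * w k l - ξ k * (κ * τ) := by
    rw [← hξg]
    simp only [hU, Fin.sum_univ_three]
    ring
  simp only [add_mul, Finset.sum_add_distrib]
  rw [h1, h2, htr, hgn]
  have hκc : (lam : ℂ) = κ * (lam + 2 * mu) := by exact_mod_cast hκ2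
  linear_combination (τ * ξ k) * hκc

theorem complex_norm_sq (z : ℂ) : ‖z‖ ^ 2 = z.re ^ 2 + z.im ^ 2 := by
  rw [← Complex.normSq_eq_norm_sq, Complex.normSq_apply]; ring

/-- The cross term is four times the real part of the pairing of g with the left side of the
equilibrium equations, hence zero. -/
theorem complexForm_add {lam mu : ℝ} {ξ : E3} {U : Matrix (Fin 3) (Fin 3) ℂ} {g : Fin 3 → ℂ}
    (hU : ∀ k, lam * U.trace * ξ k + mu * ∑ j, (U j k + U k j) * ξ j = 0) :
    complexForm lam mu (U + Matrix.of fun j k => ξ j * g k)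
      = complexForm lam mu U + complexForm lam mu (Matrix.of fun j k => ξ j * g k) := by
  have hre : ∀ k, lam * U.trace.re * ξ k + mu * ∑ j, ((U j k).re + (U k j).re) * ξ j = 0 := by
    intro k
    have := congrArg Complex.re (hU k)
    simpa using this
  have him : ∀ k, lam * U.trace.im * ξ k + mu * ∑ j, ((U j k).im + (U k j).im) * ξ j = 0 := by
    intro k
    have := congrArg Complex.im (hU k)
    simpa using this
  simp only [Matrix.trace, Matrix.diag, Fin.sum_univ_three, Complex.add_re, Complex.add_im]
    at hre him
  simp only [complexForm, complex_norm_sq, Matrix.trace, Matrix.diag, Fin.sum_univ_three,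
    Matrix.add_apply, Matrix.of_apply, Complex.add_re, Complex.add_im, Complex.mul_re, Complex.mul_im, Complex.re_ofNat, Complex.im_ofNat,
    Complex.ofReal_re, Complex.ofReal_im]
  linear_combination 4 * ((g 0).re * hre 0 + (g 1).re * hre 1 + (g 2).re * hre 2
    + (g 0).im * him 0 + (g 1).im * him 1 + (g 2).im * him 2)

/-- On longitudinal symbols the symmetrized form controls the full matrix, as in Korn's inequality:
both coefficients are positive for admissible moduli. This coercivity turns energy convergence into
L² convergence. -/
theorem complexForm_gradient (lam mu : ℝ) (ξ : E3) (g : Fin 3 → ℂ) :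
    complexForm lam mu (Matrix.of fun j k => (ξ j : ℂ) * g k)
      = 2 * mu * ∑ j, ∑ k, ‖(ξ j : ℂ) * g k‖ ^ 2 + 2 * (lam + mu) * ‖∑ k, (ξ k : ℂ) * g k‖ ^ 2 := by
  simp only [complexForm, complex_norm_sq, Matrix.trace, Matrix.diag, Fin.sum_univ_three,
    Matrix.of_apply, Complex.add_re, Complex.add_im, Complex.mul_re, Complex.mul_im,
    Complex.re_ofNat, Complex.im_ofNat, Complex.ofReal_re, Complex.ofReal_im]
  ring

theorem complexForm_le (lam mu : ℝ) (U : Matrix (Fin 3) (Fin 3) ℂ) :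
    complexForm lam mu U ≤ (6 * |lam| + 4 * |mu|) * ∑ i, ∑ j, ‖U i j‖ ^ 2 := by
  have h1 : ‖2 * U.trace‖ ^ 2 ≤ 12 * ∑ i, ∑ j, ‖U i j‖ ^ 2 := by
    simp only [complex_norm_sq, Matrix.trace, Matrix.diag, Fin.sum_univ_three, Complex.add_re,
      Complex.add_im, Complex.mul_re, Complex.mul_im, Complex.re_ofNat, Complex.im_ofNat]
    nlinarith [sq_nonneg ((U 0 0).re - (U 1 1).re), sq_nonneg ((U 0 0).re - (U 2 2).re),
      sq_nonneg ((U 1 1).re - (U 2 2).re), sq_nonneg ((U 0 0).im - (U 1 1).im),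
      sq_nonneg ((U 0 0).im - (U 2 2).im), sq_nonneg ((U 1 1).im - (U 2 2).im),
      sq_nonneg (U 0 1).re, sq_nonneg (U 0 2).re, sq_nonneg (U 1 0).re, sq_nonneg (U 1 2).re,
      sq_nonneg (U 2 0).re, sq_nonneg (U 2 1).re, sq_nonneg (U 0 1).im, sq_nonneg (U 0 2).im,
      sq_nonneg (U 1 0).im, sq_nonneg (U 1 2).im, sq_nonneg (U 2 0).im, sq_nonneg (U 2 1).im]
  have h2 : ∑ i, ∑ j, ‖U i j + U j i‖ ^ 2 ≤ 4 * ∑ i, ∑ j, ‖U i j‖ ^ 2 := by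
    have h3 : ∑ i, ∑ j, ‖U i j + U j i‖ ^ 2 ≤ ∑ i, ∑ j, (2 * ‖U i j‖ ^ 2 + 2 * ‖U j i‖ ^ 2) := by
      refine Finset.sum_le_sum fun i _ => Finset.sum_le_sum fun j _ => ?_
      have h4 := norm_add_le (U i j) (U j i)
      have h5 := norm_nonneg (U i j + U j i)
      nlinarith [sq_nonneg (‖U i j‖ - ‖U j i‖)]
    refine h3.trans (le_of_eq ?_)
    simp only [Finset.sum_add_distrib, ← Finset.mul_sum]
    rw [Finset.sum_comm (f := fun i j => ‖U j i‖ ^ 2)]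
    ring
  have h0 : 0 ≤ ∑ i, ∑ j, ‖U i j‖ ^ 2 :=
    Finset.sum_nonneg fun i _ => Finset.sum_nonneg fun j _ => sq_nonneg _
  have h3 : 0 ≤ ∑ i, ∑ j, ‖U i j + U j i‖ ^ 2 :=
    Finset.sum_nonneg fun i _ => Finset.sum_nonneg fun j _ => sq_nonneg _
  rw [complexForm, add_mul]
  refine add_le_add ?_ ?_
  · calc lam / 2 * ‖2 * U.trace‖ ^ 2 ≤ |lam| / 2 * (12 * ∑ i, ∑ j, ‖U i j‖ ^ 2) := by
          gcongr
          exact le_abs_self _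
      _ = _ := by ring
  · calc mu * ∑ i, ∑ j, ‖U i j + U j i‖ ^ 2 ≤ |mu| * (4 * ∑ i, ∑ j, ‖U i j‖ ^ 2) := by
          gcongr
          exact le_abs_self _
      _ = _ := by ring

theorem quadForm_nonneg {lam mu : ℝ} (hmu : 0 < mu) (h : 0 < mu + 3 * lam / 2)
    (U : Matrix (Fin 3) (Fin 3) ℝ) : 0 ≤ quadForm lam mu U := by
  simp only [quadForm, Matrix.trace, Matrix.diag, Fin.sum_univ_three]
  have h1 : (U 0 0 + U 1 1 + U 2 2) ^ 2 ≤ 3 * (U 0 0 ^ 2 + U 1 1 ^ 2 + U 2 2 ^ 2) := by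
    nlinarith [sq_nonneg (U 0 0 - U 1 1), sq_nonneg (U 0 0 - U 2 2), sq_nonneg (U 1 1 - U 2 2)]
  have h2 : 0 ≤ (mu + 3 * lam / 2) * (U 0 0 + U 1 1 + U 2 2) ^ 2 := by positivity
  have h3 : 0 ≤ mu * (U 0 1 ^ 2 + U 0 2 ^ 2 + U 1 0 ^ 2 + U 1 2 ^ 2 + U 2 0 ^ 2 + U 2 1 ^ 2) := by
    positivity
  have h4 := mul_le_mul_of_nonneg_left h1 hmu.le
  linarith

theorem complexForm_eq_quadForm_add (lam mu : ℝ) (U : Matrix (Fin 3) (Fin 3) ℂ) :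
    complexForm lam mu U
      = quadForm lam mu (Matrix.of fun i j => (U i j + U j i).re)
        + quadForm lam mu (Matrix.of fun i j => (U i j + U j i).im) := by
  simp only [complexForm, quadForm, complex_norm_sq, Matrix.trace, Matrix.diag, Fin.sum_univ_three,
    Matrix.of_apply, Complex.add_re, Complex.add_im, Complex.mul_re, Complex.mul_im,
    Complex.re_ofNat, Complex.im_ofNat]
  ring

theorem complexForm_nonneg {lam mu : ℝ} (hmu : 0 < mu) (h : 0 < mu + 3 * lam / 2)
    (U : Matrix (Fin 3) (Fin 3) ℂ) : 0 ≤ complexForm lam mu U := by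
  rw [complexForm_eq_quadForm_add]
  exact add_nonneg (quadForm_nonneg hmu h _) (quadForm_nonneg hmu h _)

/-- A field with Burgers vector density `b` differs from the minimizer by a gradient. -/
theorem exists_eq_minimizerSymbol_add (κ : ℝ) {ξ : E3} (hξ : ξ ≠ 0)
    {b : Fin 3 → Fin 3 → Fin 3 → ℂ} {u : Matrix (Fin 3) (Fin 3) ℂ}
    (hu : ∀ i j k, 2 * Real.pi * Complex.I * ξ i * u j k - 2 * Real.pi * Complex.I * ξ j * u i k
      = b i j k) :
    ∃ g : Fin 3 → ℂ, u = minimizerSymbol κ ξ b + Matrix.of fun j k => (ξ j : ℂ) * g k := by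
  have hN : ‖ξ‖ ^ 2 ≠ 0 := by simpa using hξ
  have hNc : ((‖ξ‖ ^ 2 : ℝ) : ℂ) ≠ 0 := by exact_mod_cast hN
  refine ⟨fun k => ((∑ i, (ξ i : ℂ) * u i k) + (∑ l, (ξ l : ℂ) * coulombSymbol ξ b k l
    + κ * ξ k * (coulombSymbol ξ b).trace)) / (‖ξ‖ ^ 2 : ℝ), ?_⟩
  -- Contracting the relation between u and b with ξ shows that the Coulomb symbol is u minus its
  -- longitudinal projection.
  have hw : ∀ j k, coulombSymbol ξ b j k
      = u j k - ξ j * ((∑ i, (ξ i : ℂ) * u i k) / (‖ξ‖ ^ 2 : ℝ)) := by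
    intro j k
    have hpi : (2 * Real.pi * Complex.I : ℂ) ≠ 0 := by
      simp [Real.pi_ne_zero]
    have h1 : ∑ i, (ξ i : ℂ) * b i j k = (2 * Real.pi * Complex.I) *
        ((‖ξ‖ ^ 2 : ℝ) * u j k - ξ j * ∑ i, (ξ i : ℂ) * u i k) := by
      rw [normSq_sum_three]
      simp only [← hu, Fin.sum_univ_three]
      push_cast
      ring
    rw [coulombSymbol, Matrix.of_apply, h1, mul_div_mul_left _ _ hpi]
    field_simp
  ext j k
  simp only [Matrix.add_apply, minimizerSymbol, Matrix.of_apply]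
  rw [hw j k]
  ring

/-- The total size of the components of `b`. -/
def tensorSize (b : Fin 3 → Fin 3 → Fin 3 → ℂ) : ℝ := ∑ i, ∑ j, ∑ k, ‖b i j k‖

theorem tensorSize_nonneg (b : Fin 3 → Fin 3 → Fin 3 → ℂ) : 0 ≤ tensorSize b :=
  Finset.sum_nonneg fun _ _ => Finset.sum_nonneg fun _ _ => Finset.sum_nonneg fun _ _ =>
    norm_nonneg _

theorem norm_coulombSymbol_le (ξ : E3) (b : Fin 3 → Fin 3 → Fin 3 → ℂ) (j k : Fin 3) :
    ‖coulombSymbol ξ b j k‖ ≤ tensorSize b / ‖ξ‖ := by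
  by_cases hξ : ξ = 0
  · subst hξ
    simp [coulombSymbol]
  have hpos : 0 < ‖ξ‖ := norm_pos_iff.2 hξ
  have h1 : ‖∑ i, (ξ i : ℂ) * b i j k‖ ≤ ‖ξ‖ * tensorSize b := by
    refine (norm_sum_le _ _).trans ?_
    rw [tensorSize, Finset.mul_sum]
    refine Finset.sum_le_sum fun i _ => ?_
    rw [norm_mul, Complex.norm_real, Real.norm_eq_abs]
    refine mul_le_mul (abs_coord_le_norm _ _) ?_ (norm_nonneg _) hpos.le
    refine (Finset.single_le_sum (f := fun k => ‖b i j k‖) (fun _ _ => norm_nonneg _)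
      (Finset.mem_univ k)).trans ?_
    exact Finset.single_le_sum (f := fun j => ∑ k, ‖b i j k‖)
      (fun _ _ => Finset.sum_nonneg fun _ _ => norm_nonneg _) (Finset.mem_univ j)
  have hden : ‖(2 * Real.pi * Complex.I * (‖ξ‖ ^ 2 : ℝ) : ℂ)‖ = 2 * Real.pi * ‖ξ‖ ^ 2 := by
    simp [abs_of_pos Real.pi_pos]
  rw [coulombSymbol, Matrix.of_apply, norm_div, hden, div_le_div_iff₀ (by positivity) hpos]
  have h2 : 1 ≤ 2 * Real.pi := by linarith [Real.pi_gt_three]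
  have h3 := tensorSize_nonneg b
  calc ‖∑ i, (ξ i : ℂ) * b i j k‖ * ‖ξ‖ ≤ ‖ξ‖ * tensorSize b * ‖ξ‖ := by gcongr
    _ = 1 * (tensorSize b * ‖ξ‖ ^ 2) := by ring
    _ ≤ 2 * Real.pi * (tensorSize b * ‖ξ‖ ^ 2) := by gcongr
    _ = _ := by ring

/-- With s the bound on the Coulomb entries, that entry contributes s and each of the two gauge
terms 3s. The constant is uniform in the moduli because only |κ| ≤ 1 is used. -/
theorem norm_minimizerSymbol_le {κ : ℝ} (hκ : |κ| ≤ 1) (ξ : E3) (b : Fin 3 → Fin 3 → Fin 3 → ℂ)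
    (j k : Fin 3) : ‖minimizerSymbol κ ξ b j k‖ ≤ 7 * (tensorSize b / ‖ξ‖) := by
  by_cases hξ : ξ = 0
  · subst hξ
    simp [minimizerSymbol, coulombSymbol]
  have hpos : 0 < ‖ξ‖ := norm_pos_iff.2 hξ
  have hw := norm_coulombSymbol_le ξ b
  set s := tensorSize b / ‖ξ‖
  have hs : 0 ≤ s := div_nonneg (tensorSize_nonneg b) hpos.le
  have h1 : ‖∑ l, (ξ l : ℂ) * coulombSymbol ξ b k l‖ ≤ 3 * (‖ξ‖ * s) := by
    refine (norm_sum_le _ _).trans ?_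
    refine (Finset.sum_le_sum (g := fun _ => ‖ξ‖ * s) fun l _ => ?_).trans (by simp)
    rw [norm_mul, Complex.norm_real, Real.norm_eq_abs]
    exact mul_le_mul (abs_coord_le_norm _ _) (hw _ _) (norm_nonneg _) hpos.le
  have h2 : ‖(coulombSymbol ξ b).trace‖ ≤ 3 * s := by
    refine (norm_sum_le _ _).trans ?_
    refine (Finset.sum_le_sum (g := fun _ => s) fun l _ => ?_).trans (by simp)
    exact hw _ _
  have h3 : ‖(κ : ℂ) * ξ k * (coulombSymbol ξ b).trace‖ ≤ ‖ξ‖ * (3 * s) := by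
    rw [norm_mul, norm_mul, Complex.norm_real, Complex.norm_real, Real.norm_eq_abs,
      Real.norm_eq_abs]
    refine mul_le_mul ?_ h2 (norm_nonneg _) hpos.le
    calc |κ| * |ξ k| ≤ 1 * ‖ξ‖ := mul_le_mul hκ (abs_coord_le_norm _ _) (abs_nonneg _) zero_le_one
      _ = _ := one_mul _
  have h4 : ‖(ξ j : ℂ) / (‖ξ‖ ^ 2 : ℝ)‖ ≤ 1 / ‖ξ‖ := by
    rw [norm_div, Complex.norm_real, Complex.norm_real, Real.norm_eq_abs, Real.norm_eq_abs,
      abs_of_nonneg (sq_nonneg ‖ξ‖), div_le_div_iff₀ (by positivity) hpos]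
    have := abs_coord_le_norm ξ j
    nlinarith
  rw [minimizerSymbol, Matrix.of_apply]
  refine (norm_sub_le _ _).trans ?_
  rw [norm_mul]
  calc _ ≤ s + 1 / ‖ξ‖ * (3 * (‖ξ‖ * s) + ‖ξ‖ * (3 * s)) := by
        refine add_le_add (hw _ _) (mul_le_mul h4 ?_ (norm_nonneg _) (by positivity))
        exact (norm_add_le _ _).trans (add_le_add h1 h3)
    _ = 7 * s := by field_simp; ring

/-- Hermitian symmetry, which makes the minimizing field real. -/
theorem minimizerSymbol_neg_conj (κ : ℝ) (ξ : E3) (b : Fin 3 → Fin 3 → Fin 3 → ℂ) (j k : Fin 3) :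
    minimizerSymbol κ (-ξ) (fun i j k => (starRingEnd ℂ) (b i j k)) j k
      = (starRingEnd ℂ) (minimizerSymbol κ ξ b j k) := by
  have hw : ∀ j k, coulombSymbol (-ξ) (fun i j k => (starRingEnd ℂ) (b i j k)) j k
      = (starRingEnd ℂ) (coulombSymbol ξ b j k) := by
    intro j k
    simp only [coulombSymbol, Matrix.of_apply, map_div₀, map_sum, map_mul, Complex.conj_ofReal,
      Complex.conj_I, norm_neg, PiLp.neg_apply, Complex.ofReal_neg, map_ofNat]
    rw [← neg_div_neg_eq]
    congr 1
    · rw [← Finset.sum_neg_distrib]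
      exact Finset.sum_congr rfl fun i _ => by ring
    · ring
  simp only [minimizerSymbol, Matrix.of_apply, Matrix.trace, Matrix.diag, hw, map_sub, map_mul,
    map_div₀, map_add, map_sum, Complex.conj_ofReal, norm_neg, PiLp.neg_apply, Complex.ofReal_neg]
  simp only [neg_mul, mul_neg, Finset.sum_neg_distrib]
  ring

theorem minimizerSymbol_sum {ι : Type*} (s : Finset ι) (κ : ℝ) (ξ : E3) (r : ι → ℂ)
    (b : ι → Fin 3 → Fin 3 → Fin 3 → ℂ) (j k : Fin 3) :
    minimizerSymbol κ ξ (fun i j k => ∑ a ∈ s, r a * b a i j k) j k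
      = ∑ a ∈ s, r a * minimizerSymbol κ ξ (b a) j k := by
  have hw : ∀ j k, coulombSymbol ξ (fun i j k => ∑ a ∈ s, r a * b a i j k) j k
      = ∑ a ∈ s, r a * coulombSymbol ξ (b a) j k := by
    intro j k
    simp only [coulombSymbol, Matrix.of_apply, mul_div_assoc', ← Finset.sum_div]
    congr 1
    simp only [Finset.mul_sum]
    rw [Finset.sum_comm]
    exact Finset.sum_congr rfl fun a _ => Finset.sum_congr rfl fun i _ => by ring
  simp only [minimizerSymbol, Matrix.of_apply, Matrix.trace, Matrix.diag, hw, mul_sub, mul_add,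
    Finset.sum_sub_distrib, Finset.sum_add_distrib, Finset.mul_sum]
  congr 1
  congr 1
  · rw [Finset.sum_comm]
    exact Finset.sum_congr rfl fun a _ => Finset.sum_congr rfl fun i _ => by ring
  · rw [Finset.sum_comm]
    exact Finset.sum_congr rfl fun a _ => Finset.sum_congr rfl fun i _ => by ring

end Symbols

/-! ### The minimizing field -/

section Minimizer

open FourierTransform

/-- Smooth compactly supported fields. -/
structure IsBurgersField (b : TensorField) : Prop where
  smooth : ∀ i j k, ContDiff ℝ ∞ fun x => b x i j k
  compactSupport : ∀ i j k, HasCompactSupport fun x => b x i j k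

/-- The componentwise Fourier transform of `b`. -/
def tensorFourier (b : TensorField) (ξ : E3) : Fin 3 → Fin 3 → Fin 3 → ℂ := fun i j k =>
  realFourier (fun x => b x i j k) ξ

/-- The Fourier transform of the minimizer. -/
def minimizerFourier (κ : ℝ) (b : TensorField) (i j : Fin 3) (ξ : E3) : ℂ :=
  minimizerSymbol κ ξ (tensorFourier b ξ) i j

/-- The minimizer. -/
def minimizerField (κ : ℝ) (b : TensorField) : MatrixField := fun x =>
  Matrix.of fun i j => (𝓕⁻ (minimizerFourier κ b i j) x).re

theorem continuous_realFourier {f : E3 → ℝ} (hf : ContDiff ℝ ∞ f) (hc : HasCompactSupport f) :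
    Continuous (realFourier f) := by
  obtain ⟨S, -, hS⟩ := exists_schwartz hf hc
  rw [← hS]
  exact (𝓕 S).continuous

theorem integrable_pow_mul_realFourier {f : E3 → ℝ} (hf : ContDiff ℝ ∞ f)
    (hc : HasCompactSupport f) (n : ℕ) : Integrable fun ξ => ‖ξ‖ ^ n * ‖realFourier f ξ‖ := by
  obtain ⟨S, -, hS⟩ := exists_schwartz hf hc
  rw [← hS]
  exact (𝓕 S).integrable_pow_mul volume n

theorem exists_realFourier_le {f : E3 → ℝ} (hf : ContDiff ℝ ∞ f)
    (hc : HasCompactSupport f) : ∃ C, ∀ ξ, (1 + ‖ξ‖) * ‖realFourier f ξ‖ ≤ C := by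
  obtain ⟨S, -, hS⟩ := exists_schwartz hf hc
  obtain ⟨C₀, -, h₀⟩ := (𝓕 S).decay 0 0
  obtain ⟨C₁, -, h₁⟩ := (𝓕 S).decay 1 0
  refine ⟨C₀ + C₁, fun ξ => ?_⟩
  have h2 := h₀ ξ
  have h3 := h₁ ξ
  rw [norm_iteratedFDeriv_zero, hS] at h2 h3
  rw [add_mul]
  simp only [pow_zero, pow_one] at h2 h3
  linarith

/-- The weight `1 / (|ξ|² (1 + |ξ|²))` is integrable in three dimensions. -/
theorem integrable_singular_weight :
    Integrable fun ξ : E3 => (‖ξ‖ ^ 2 * (1 + ‖ξ‖ ^ 2))⁻¹ := by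
  have h := (integrable_fun_norm_addHaar (volume : Measure E3)
    (f := fun r : ℝ => (r ^ 2 * (1 + r ^ 2))⁻¹)).2
  refine h ?_
  have h1 : IntegrableOn (fun r : ℝ => (1 + r ^ 2)⁻¹) (Set.Ioi 0) :=
    integrable_inv_one_add_sq.integrableOn
  -- The Jacobian r² of polar coordinates cancels the singularity at the origin.
  refine h1.congr_fun (fun r hr => ?_) measurableSet_Ioi
  have hr0 : r ≠ 0 := (Set.mem_Ioi.1 hr).ne'
  have hd : Module.finrank ℝ E3 = 3 := by simp
  simp only [hd, smul_eq_mul, mul_inv]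
  rw [← mul_assoc, mul_inv_cancel₀ (by positivity), one_mul]

/-- The quotient is the product of 1/(|ξ|a) and as with a² = 1 + |ξ|², and the inequality 2xy ≤ x² +
y² applies. It separates a universal integrable singularity from the H¹ density of b. -/
theorem div_norm_le (ξ : E3) (s : ℝ) :
    s / ‖ξ‖ ≤ 1 / 2 * ((‖ξ‖ ^ 2 * (1 + ‖ξ‖ ^ 2))⁻¹ + (1 + ‖ξ‖ ^ 2) * s ^ 2) := by
  by_cases hξ : ‖ξ‖ = 0
  · rw [hξ]
    simp
    positivity
  · have hpos : 0 < ‖ξ‖ := lt_of_le_of_ne (norm_nonneg _) (Ne.symm hξ)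
    set a := Real.sqrt (1 + ‖ξ‖ ^ 2)
    have ha : a ^ 2 = 1 + ‖ξ‖ ^ 2 := Real.sq_sqrt (by positivity)
    have hapos : 0 < a := Real.sqrt_pos.2 (by positivity)
    rw [← ha]
    have h1 : (‖ξ‖ ^ 2 * a ^ 2)⁻¹ + a ^ 2 * s ^ 2 - 2 * (s / ‖ξ‖) = ((‖ξ‖ * a)⁻¹ - a * s) ^ 2 := by
      field_simp
      ring
    have := sq_nonneg ((‖ξ‖ * a)⁻¹ - a * s)
    linarith

theorem norm_minimizerFourier_le {b : TensorField} {κ : ℝ} (hκ : |κ| ≤ 1) (i j : Fin 3) (ξ : E3) :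
    ‖minimizerFourier κ b i j ξ‖ ≤ 7 * (tensorSize (tensorFourier b ξ) / ‖ξ‖) :=
  norm_minimizerSymbol_le hκ _ _ _ _

theorem minimizerFourier_neg (b : TensorField) (κ : ℝ) (i j : Fin 3) (ξ : E3) :
    minimizerFourier κ b i j (-ξ) = (starRingEnd ℂ) (minimizerFourier κ b i j ξ) := by
  rw [minimizerFourier, minimizerFourier, ← minimizerSymbol_neg_conj]
  congr 1
  ext i j k
  exact realFourier_neg _ _

namespace IsBurgersField

variable {b : TensorField} (hb : IsBurgersField b)
include hb

theorem continuous_tensorSize : Continuous fun ξ => tensorSize (tensorFourier b ξ) := by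
  unfold tensorSize tensorFourier
  refine continuous_finsetSum _ fun i _ => continuous_finsetSum _ fun j _ =>
    continuous_finsetSum _ fun k _ => ?_
  exact (continuous_realFourier (hb.smooth i j k) (hb.compactSupport i j k)).norm

theorem integrable_pow_mul_tensorSize (n : ℕ) :
    Integrable fun ξ => ‖ξ‖ ^ n * tensorSize (tensorFourier b ξ) := by
  simp only [tensorSize, tensorFourier, Finset.mul_sum]
  refine integrable_finsetSum _ fun i _ => integrable_finsetSum _ fun j _ =>
    integrable_finsetSum _ fun k _ => ?_
  exact integrable_pow_mul_realFourier (hb.smooth i j k) (hb.compactSupport i j k) n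

theorem exists_tensorSize_le :
    ∃ C, ∀ ξ, (1 + ‖ξ‖) * tensorSize (tensorFourier b ξ) ≤ C := by
  choose C hC using fun i j k => exists_realFourier_le (hb.smooth i j k) (hb.compactSupport i j k)
  refine ⟨∑ i, ∑ j, ∑ k, C i j k, fun ξ => ?_⟩
  simp only [tensorSize, tensorFourier, Finset.mul_sum]
  exact Finset.sum_le_sum fun i _ => Finset.sum_le_sum fun j _ => Finset.sum_le_sum fun k _ =>
    hC i j k ξ

theorem integrable_weight_mul_tensorSize_sq :
    Integrable fun ξ => (1 + ‖ξ‖ ^ 2) * tensorSize (tensorFourier b ξ) ^ 2 := by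
  obtain ⟨C, hC⟩ := hb.exists_tensorSize_le
  have h1 := ((hb.integrable_pow_mul_tensorSize 0).add
    (hb.integrable_pow_mul_tensorSize 1)).const_mul C
  refine h1.mono' ?_ (ae_of_all _ fun ξ => ?_)
  · have := hb.continuous_tensorSize
    exact Continuous.aestronglyMeasurable (by fun_prop)
  · have hs := tensorSize_nonneg (tensorFourier b ξ)
    rw [Real.norm_eq_abs, abs_of_nonneg (by positivity)]
    have h2 := hC ξ
    have h3 := norm_nonneg ξ
    simp only [Pi.add_apply, pow_zero, pow_one, one_mul]
    calc (1 + ‖ξ‖ ^ 2) * tensorSize (tensorFourier b ξ) ^ 2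
        ≤ ((1 + ‖ξ‖) * tensorSize (tensorFourier b ξ))
          * ((1 + ‖ξ‖) * tensorSize (tensorFourier b ξ)) := by
          have : (1 + ‖ξ‖ ^ 2) ≤ (1 + ‖ξ‖) ^ 2 := by nlinarith
          have := mul_le_mul_of_nonneg_right this (sq_nonneg (tensorSize (tensorFourier b ξ)))
          linarith
      _ ≤ C * ((1 + ‖ξ‖) * tensorSize (tensorFourier b ξ)) := by gcongr
      _ = _ := by ring

theorem measurable_minimizerFourier (κ : ℝ) (i j : Fin 3) :
    Measurable (minimizerFourier κ b i j) := by
  have hm : ∀ i j k, Measurable fun ξ => tensorFourier b ξ i j k := fun i j k =>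
    (continuous_realFourier (hb.smooth i j k) (hb.compactSupport i j k)).measurable
  have hw : ∀ j k, Measurable fun ξ => coulombSymbol ξ (tensorFourier b ξ) j k := by
    intro j k
    simp only [coulombSymbol, Matrix.of_apply]
    fun_prop
  unfold minimizerFourier
  simp only [minimizerSymbol, Matrix.of_apply, Matrix.trace, Matrix.diag]
  fun_prop

theorem integrable_minimizerFourier {κ : ℝ} (hκ : |κ| ≤ 1) (i j : Fin 3) :
    Integrable (minimizerFourier κ b i j) := by
  refine ((integrable_singular_weight.add hb.integrable_weight_mul_tensorSize_sq).const_mul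
    (7 * (1 / 2))).mono' (hb.measurable_minimizerFourier κ i j).aestronglyMeasurable
    (ae_of_all _ fun ξ => ?_)
  refine (norm_minimizerFourier_le hκ i j ξ).trans ?_
  have := div_norm_le ξ (tensorSize (tensorFourier b ξ))
  simp only [Pi.add_apply]
  linarith

/-- The L¹ norm of the transform bounds the field pointwise. The inhomogeneous form, a constant plus
a quadratic term in b, is what the later duality argument needs. -/
theorem integral_norm_minimizerFourier_le {κ : ℝ} (hκ : |κ| ≤ 1) (i j : Fin 3) :
    ∫ ξ, ‖minimizerFourier κ b i j ξ‖ ≤ 7 / 2 * ((∫ ξ : E3, (‖ξ‖ ^ 2 * (1 + ‖ξ‖ ^ 2))⁻¹)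
      + ∫ ξ, (1 + ‖ξ‖ ^ 2) * tensorSize (tensorFourier b ξ) ^ 2) := by
  rw [← integral_add integrable_singular_weight hb.integrable_weight_mul_tensorSize_sq,
    ← integral_const_mul]
  refine integral_mono (hb.integrable_minimizerFourier hκ i j).norm
    ((integrable_singular_weight.add hb.integrable_weight_mul_tensorSize_sq).const_mul _)
    fun ξ => ?_
  refine (norm_minimizerFourier_le hκ i j ξ).trans ?_
  have := div_norm_le ξ (tensorSize (tensorFourier b ξ))
  linarith

/-- One power of |ξ| cancels the singularity; the other powers are absorbed by the rapid decay of
the transform of b. All moments being finite, the field is smooth. -/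
theorem integrable_pow_mul_minimizerFourier {κ : ℝ} (hκ : |κ| ≤ 1) (i j : Fin 3) (n : ℕ) :
    Integrable fun ξ => ‖ξ‖ ^ n * ‖minimizerFourier κ b i j ξ‖ := by
  cases n with
  | zero => simpa using (hb.integrable_minimizerFourier hκ i j).norm
  | succ n =>
    refine ((hb.integrable_pow_mul_tensorSize n).const_mul 7).mono' ?_ (ae_of_all _ fun ξ => ?_)
    · have := hb.measurable_minimizerFourier κ i j
      exact Measurable.aestronglyMeasurable (by fun_prop)
    · rw [norm_mul, norm_norm, norm_pow, norm_norm]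
      have h1 := norm_minimizerFourier_le (b := b) hκ i j ξ
      by_cases hξ : ‖ξ‖ = 0
      · rw [hξ]
        have := tensorSize_nonneg (tensorFourier b ξ)
        simp
        positivity
      · calc _ ≤ ‖ξ‖ ^ (n + 1) * (7 * (tensorSize (tensorFourier b ξ) / ‖ξ‖)) := by gcongr
          _ = _ := by field_simp; ring

theorem memLp_minimizerFourier {κ : ℝ} (hκ : |κ| ≤ 1) (i j : Fin 3) :
    MemLp (minimizerFourier κ b i j) 2 := by
  obtain ⟨C, hC⟩ := hb.exists_tensorSize_le
  rw [memLp_two_iff_integrable_sq_norm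
    (hb.measurable_minimizerFourier κ i j).aestronglyMeasurable]
  refine (integrable_singular_weight.const_mul (49 * C ^ 2)).mono' ?_ (ae_of_all _ fun ξ => ?_)
  · have := hb.measurable_minimizerFourier κ i j
    exact Measurable.aestronglyMeasurable (by fun_prop)
  · have h1 := norm_minimizerFourier_le (b := b) hκ i j ξ
    have hs := tensorSize_nonneg (tensorFourier b ξ)
    rw [norm_pow, norm_norm]
    by_cases hξ : ‖ξ‖ = 0
    · rw [hξ] at h1 ⊢
      simp at h1
      simp [h1]
    · have hpos : 0 < ‖ξ‖ := lt_of_le_of_ne (norm_nonneg _) (Ne.symm hξ)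
      have h2 : (1 + ‖ξ‖ ^ 2) * tensorSize (tensorFourier b ξ) ^ 2 ≤ C ^ 2 := by
        have h3 : ((1 + ‖ξ‖) * tensorSize (tensorFourier b ξ)) ^ 2 ≤ C ^ 2 :=
          pow_le_pow_left₀ (by positivity) (hC ξ) 2
        have h4 : (1 + ‖ξ‖ ^ 2) ≤ (1 + ‖ξ‖) ^ 2 := by nlinarith
        have := mul_le_mul_of_nonneg_right h4 (sq_nonneg (tensorSize (tensorFourier b ξ)))
        rw [mul_pow] at h3
        linarith
      calc ‖minimizerFourier κ b i j ξ‖ ^ 2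
          ≤ (7 * (tensorSize (tensorFourier b ξ) / ‖ξ‖)) ^ 2 :=
            pow_le_pow_left₀ (norm_nonneg _) h1 2
        _ = 49 * ((1 + ‖ξ‖ ^ 2) * tensorSize (tensorFourier b ξ) ^ 2)
            * (‖ξ‖ ^ 2 * (1 + ‖ξ‖ ^ 2))⁻¹ := by field_simp; ring
        _ ≤ 49 * C ^ 2 * (‖ξ‖ ^ 2 * (1 + ‖ξ‖ ^ 2))⁻¹ := by gcongr

theorem isFourierPair_minimizer {κ : ℝ} (hκ : |κ| ≤ 1) (i j : Fin 3) :
    IsFourierPair (fun x => minimizerField κ b x i j) (minimizerFourier κ b i j) :=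
  IsFourierPair.of_hermitian (hb.integrable_minimizerFourier hκ i j)
    (hb.memLp_minimizerFourier hκ i j) (minimizerFourier_neg b κ i j)

theorem isSmoothField_minimizer {κ : ℝ} (hκ : |κ| ≤ 1) : IsSmoothField (minimizerField κ b) :=
  fun i j => (hb.isFourierPair_minimizer hκ i j).contDiff
    (hb.integrable_pow_mul_minimizerFourier hκ i j)

end IsBurgersField

/-- The elastic energy in Fourier space. -/
theorem integrable_complexForm {lam mu : ℝ} {U : Fin 3 → Fin 3 → E3 → ℂ}
    (hU : ∀ i j, MemLp (U i j) 2) :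
    Integrable fun ξ => complexForm lam mu (Matrix.of fun i j => U i j ξ) := by
  have hsq : ∀ {g : E3 → ℂ}, MemLp g 2 → Integrable fun ξ => ‖g ξ‖ ^ 2 := fun hg =>
    (memLp_two_iff_integrable_sq_norm hg.aestronglyMeasurable).1 hg
  simp only [complexForm, Matrix.trace, Matrix.diag, Matrix.of_apply]
  refine Integrable.add ((hsq ?_).const_mul _) ((integrable_finsetSum _ fun i _ =>
    integrable_finsetSum _ fun j _ => hsq ?_).const_mul _)
  · exact (memLp_finsetSum _ fun i _ => hU i i).const_mul 2
  · exact (hU i j).add (hU j i)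

/-- Plancherel's theorem for the trace and for each symmetrized entry. -/
theorem elasticEnergy_eq {lam mu : ℝ} (hmu : 0 < mu) (h : 0 < mu + 3 * lam / 2) {u : MatrixField}
    {U : Fin 3 → Fin 3 → E3 → ℂ} (p : ∀ i j, IsFourierPair (fun x => u x i j) (U i j)) :
    elasticEnergy lam mu u
      = ENNReal.ofReal (∫ ξ, complexForm lam mu (Matrix.of fun i j => U i j ξ)) := by
  have ptr : IsFourierPair (fun x => 2 * ∑ i, u x i i) (fun ξ => 2 * ∑ i, U i i ξ) := by
    have := (IsFourierPair.finset_sum Finset.univ fun i => p i i).const_mul 2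
    simpa using this
  have pij : ∀ i j, IsFourierPair (fun x => u x i j + u x j i) (fun ξ => U i j ξ + U j i ξ) :=
    fun i j => (p i j).add (p j i)
  have hform : ∀ x, quadForm lam mu (u x + (u x).transpose)
      = lam / 2 * (2 * ∑ i, u x i i) ^ 2 + mu * ∑ i, ∑ j, (u x i j + u x j i) ^ 2 := by
    intro x
    simp only [quadForm, Matrix.trace_add, Matrix.trace_transpose, Matrix.add_apply,
      Matrix.transpose_apply]
    simp only [Matrix.trace, Matrix.diag]
    ring
  have hsqR : ∀ {g : E3 → ℝ}, MemLp g 2 → Integrable fun ξ => g ξ ^ 2 := fun hg =>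
    (memLp_two_iff_integrable_sq hg.aestronglyMeasurable).1 hg
  have hsqC : ∀ {g : E3 → ℂ}, MemLp g 2 → Integrable fun ξ => ‖g ξ‖ ^ 2 := fun hg =>
    (memLp_two_iff_integrable_sq_norm hg.aestronglyMeasurable).1 hg
  have hint : Integrable fun x => quadForm lam mu (u x + (u x).transpose) := by
    simp only [hform]
    exact ((hsqR ptr.memLp_left).const_mul _).add ((integrable_finsetSum _ fun i _ =>
      integrable_finsetSum _ fun j _ => hsqR (pij i j).memLp_left).const_mul _)
  rw [elasticEnergy, ← ofReal_integral_eq_lintegral_ofReal hint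
    (ae_of_all _ fun x => quadForm_nonneg hmu h _)]
  congr 1
  simp only [hform, complexForm, Matrix.trace, Matrix.diag, Matrix.of_apply]
  rw [integral_add ((hsqR ptr.memLp_left).const_mul _) ((integrable_finsetSum _ fun i _ =>
      integrable_finsetSum _ fun j _ => hsqR (pij i j).memLp_left).const_mul _),
    integral_add ((hsqC ptr.memLp).const_mul _) ((integrable_finsetSum _ fun i _ =>
      integrable_finsetSum _ fun j _ => hsqC (pij i j).memLp).const_mul _),
    integral_const_mul, integral_const_mul, integral_const_mul, integral_const_mul,
    ptr.integral_sq, integral_finsetSum _ fun i _ => integrable_finsetSum _ fun j _ =>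
      hsqR (pij i j).memLp_left, integral_finsetSum _ fun i _ => integrable_finsetSum _ fun j _ =>
      hsqC (pij i j).memLp]
  congr 2
  refine Finset.sum_congr rfl fun i _ => ?_
  rw [integral_finsetSum _ fun j _ => hsqR (pij i j).memLp_left,
    integral_finsetSum _ fun j _ => hsqC (pij i j).memLp]
  exact Finset.sum_congr rfl fun j _ => (pij i j).integral_sq

theorem IsAdmissible.component {b : TensorField} {u : MatrixField} (hu : IsAdmissible b u)
    (i j : Fin 3) : HasCompactSupport fun x => u x i j :=
  hu.2.1.comp_left (g := fun M : Matrix (Fin 3) (Fin 3) ℝ => M i j) rfl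

theorem IsAdmissible.isFourierPair {b : TensorField} {u : MatrixField} (hu : IsAdmissible b u)
    (i j : Fin 3) : IsFourierPair (fun x => u x i j) (realFourier fun x => u x i j) :=
  isFourierPair_realFourier (hu.1 i j) (hu.component i j)

theorem IsAdmissible.fourier {b : TensorField} {u : MatrixField} (hu : IsAdmissible b u)
    (ξ : E3) (i j k : Fin 3) :
    2 * Real.pi * Complex.I * ξ i * realFourier (fun x => u x j k) ξ
      - 2 * Real.pi * Complex.I * ξ j * realFourier (fun x => u x i k) ξ
      = tensorFourier b ξ i j k := by
  have hi : ∀ i j k, Integrable (partialDeriv i fun x => u x j k) := fun i j k =>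
    (contDiff_partialDeriv (hu.1 j k) i).continuous.integrable_of_hasCompactSupport
      (hasCompactSupport_partialDeriv (hu.component j k) i)
  rw [tensorFourier, ← hu.2.2]
  have h1 : (fun x => d1 u x i j k) = fun x => partialDeriv i (fun x => u x j k) x
      + (-1) * partialDeriv j (fun x => u x i k) x := by
    ext x
    rw [d1]
    ring
  rw [h1, realFourier_add (hi _ _ _) ((hi _ _ _).const_mul _), realFourier_const_mul,
    realFourier_partialDeriv (hu.1 _ _) (hu.component _ _),
    realFourier_partialDeriv (hu.1 _ _) (hu.component _ _)]
  push_cast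
  ring

theorem ae_ne_zero : ∀ᵐ ξ : E3, ξ ≠ 0 := by
  have : ({(0 : E3)}ᶜ : Set E3) ∈ ae (volume : Measure E3) := compl_mem_ae_iff.2 (by simp)
  exact this

/-- The Pythagorean identity for the elastic energy of admissible fields. -/
theorem IsAdmissible.elasticEnergy_eq_add {lam mu : ℝ} (hmu : 0 < mu) (h : 0 < mu + 3 * lam / 2)
    {b : TensorField} (hb : IsBurgersField b) (hκ : |lam / (lam + 2 * mu)| ≤ 1)
    {u : MatrixField} (hu : IsAdmissible b u) :
    elasticEnergy lam mu u = ENNReal.ofReal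
      ((∫ ξ, complexForm lam mu (Matrix.of fun i j => minimizerFourier (lam / (lam + 2 * mu)) b i j ξ))
      + ∫ ξ, complexForm lam mu (Matrix.of fun i j => realFourier (fun x => u x i j) ξ
          - minimizerFourier (lam / (lam + 2 * mu)) b i j ξ)) ∧
    ∀ i j, ∫ ξ, ‖realFourier (fun x => u x i j) ξ
          - minimizerFourier (lam / (lam + 2 * mu)) b i j ξ‖ ^ 2 ≤ (2 * mu)⁻¹ *
      ∫ ξ, complexForm lam mu (Matrix.of fun i j => realFourier (fun x => u x i j) ξ
          - minimizerFourier (lam / (lam + 2 * mu)) b i j ξ) := by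
  set κ := lam / (lam + 2 * mu) with hκdef
  have hpos : 0 < lam + 2 * mu := by linarith
  have hv : ∀ i j, MemLp (fun ξ => realFourier (fun x => u x i j) ξ - minimizerFourier κ b i j ξ) 2 :=
    fun i j => (hu.isFourierPair i j).memLp.sub (hb.memLp_minimizerFourier hκ i j)
  have hanti : ∀ ξ i j k, tensorFourier b ξ i j k = -tensorFourier b ξ j i k := by
    intro ξ i j k
    rw [← hu.fourier, ← hu.fourier]
    ring
  -- Pointwise in ξ, an admissible field is the minimizer plus a longitudinal symbol: the
  -- equilibrium equations remove the cross term, and coercivity bounds the difference.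
  have hpt : ∀ ξ : E3, ξ ≠ 0 →
      complexForm lam mu (Matrix.of fun i j => realFourier (fun x => u x i j) ξ)
        = complexForm lam mu (Matrix.of fun i j => minimizerFourier κ b i j ξ)
        + complexForm lam mu (Matrix.of fun i j => realFourier (fun x => u x i j) ξ
          - minimizerFourier κ b i j ξ) ∧
      ∀ i j, 2 * mu * ‖realFourier (fun x => u x i j) ξ - minimizerFourier κ b i j ξ‖ ^ 2
        ≤ complexForm lam mu (Matrix.of fun i j => realFourier (fun x => u x i j) ξ
          - minimizerFourier κ b i j ξ) := by
    intro ξ hξ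
    obtain ⟨g, hg⟩ := exists_eq_minimizerSymbol_add κ hξ
      (u := Matrix.of fun i j => realFourier (fun x => u x i j) ξ) (hu.fourier ξ)
    have hmat : (Matrix.of fun i j => minimizerFourier κ b i j ξ)
        = minimizerSymbol κ ξ (tensorFourier b ξ) := rfl
    have hdiff : (Matrix.of fun i j => realFourier (fun x => u x i j) ξ - minimizerFourier κ b i j ξ)
        = Matrix.of fun j k => (ξ j : ℂ) * g k := by
      ext i j
      have := congrFun (congrFun hg i) j
      simp only [Matrix.add_apply, Matrix.of_apply] at this ⊢
      rw [this]
      simp [minimizerFourier]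
    constructor
    · rw [hdiff, hmat, hg]
      exact complexForm_add fun k => minimizerSymbol_equilibrium hpos hξ (hanti ξ) k
    · intro i j
      have h1 : ‖realFourier (fun x => u x i j) ξ - minimizerFourier κ b i j ξ‖
          = ‖(ξ i : ℂ) * g j‖ := by
        have := congrFun (congrFun hdiff i) j
        simp only [Matrix.of_apply] at this
        rw [this]
      rw [h1, hdiff, complexForm_gradient]
      have h2 : ‖(ξ i : ℂ) * g j‖ ^ 2 ≤ ∑ j, ∑ k, ‖(ξ j : ℂ) * g k‖ ^ 2 := by
        refine (Finset.single_le_sum (f := fun k => ‖(ξ i : ℂ) * g k‖ ^ 2)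
          (fun _ _ => sq_nonneg _) (Finset.mem_univ j)).trans ?_
        exact Finset.single_le_sum (f := fun j => ∑ k, ‖(ξ j : ℂ) * g k‖ ^ 2)
          (fun _ _ => Finset.sum_nonneg fun _ _ => sq_nonneg _) (Finset.mem_univ i)
      have h3 : 0 ≤ 2 * (lam + mu) * ‖∑ k, (ξ k : ℂ) * g k‖ ^ 2 := by
        have : 0 < lam + mu := by linarith
        positivity
      have h4 := mul_le_mul_of_nonneg_left h2 (by positivity : 0 ≤ 2 * mu)
      linarith
  constructor
  · rw [elasticEnergy_eq hmu h hu.isFourierPair, ← integral_add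
      (integrable_complexForm (hb.memLp_minimizerFourier hκ)) (integrable_complexForm hv)]
    congr 1
    refine integral_congr_ae ?_
    filter_upwards [ae_ne_zero] with ξ hξ
    exact (hpt ξ hξ).1
  · intro i j
    rw [← div_eq_inv_mul, le_div_iff₀ (by positivity), mul_comm, ← integral_const_mul]
    refine integral_mono_ae (((memLp_two_iff_integrable_sq_norm
      (hv i j).aestronglyMeasurable).1 (hv i j)).const_mul _) (integrable_complexForm hv) ?_
    filter_upwards [ae_ne_zero] with ξ hξ
    exact (hpt ξ hξ).2 i j

end Minimizer

/-! ### Approximation of gradients by gradients of test functions -/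

section Approximation

open FourierTransform

theorem tendsto_eLpNorm_of_dominated {F : Type*} [NormedAddCommGroup F] {h : ℕ → E3 → F}
    {g : E3 → ℝ} (hm : ∀ n, AEStronglyMeasurable (h n)) (hg : MemLp g 2)
    (hle : ∀ n x, ‖h n x‖ ≤ g x) (hlim : ∀ᵐ x, Tendsto (fun n => h n x) atTop (𝓝 0)) :
    Tendsto (fun n => eLpNorm (h n) 2 volume) atTop (𝓝 0) := by
  have hmem : ∀ n, MemLp (h n) 2 := fun n =>
    hg.mono (hm n) (ae_of_all _ fun x => (hle n x).trans (le_abs_self _))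
  simp only [fun n => IsFourierPair.eLpNorm_two_sq (hmem n)]
  have h1 : Tendsto (fun n => ∫ x, ‖h n x‖ ^ 2) atTop (𝓝 (∫ _ : E3, (0 : ℝ))) := by
    refine tendsto_integral_of_dominated_convergence (fun x => g x ^ 2)
      (fun n => ((hm n).norm.pow 2)) ((memLp_two_iff_integrable_sq hg.aestronglyMeasurable).1 hg)
      (fun n => ae_of_all _ fun x => ?_) ?_
    · rw [norm_pow, norm_norm]
      exact pow_le_pow_left₀ (norm_nonneg _) (hle n x) 2
    · filter_upwards [hlim] with x hx
      simpa using (hx.norm.pow 2)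
  rw [integral_zero] at h1
  have h2 := ENNReal.tendsto_ofReal ((Real.continuous_sqrt.tendsto 0).comp h1)
  simpa using h2

theorem partialDeriv_mul {f g : E3 → ℝ} {x : E3} (hf : DifferentiableAt ℝ f x)
    (hg : DifferentiableAt ℝ g x) (i : Fin 3) :
    partialDeriv i (fun y => f y * g y) x = f x * partialDeriv i g x + partialDeriv i f x * g x := by
  rw [partialDeriv, fderiv_fun_mul hf hg]
  simp [partialDeriv, mul_comm]

theorem partialDeriv_add {f g : E3 → ℝ} {x : E3} (hf : DifferentiableAt ℝ f x)
    (hg : DifferentiableAt ℝ g x) (i : Fin 3) :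
    partialDeriv i (fun y => f y + g y) x = partialDeriv i f x + partialDeriv i g x := by
  rw [partialDeriv, fderiv_fun_add hf hg]
  simp [partialDeriv]

theorem partialDeriv_comp_smul {f : E3 → ℝ} (hf : Differentiable ℝ f) (r : ℝ) (i : Fin 3) (x : E3) :
    partialDeriv i (fun y => f (r • y)) x = r * partialDeriv i f (r • x) := by
  have h1 : HasFDerivAt (fun y : E3 => r • y) (r • ContinuousLinearMap.id ℝ E3) x :=
    (hasFDerivAt_id x).const_smul r
  have h2 : HasFDerivAt (fun y => f (r • y)) _ x := (hf (r • x)).hasFDerivAt.comp x h1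
  rw [partialDeriv, h2.fderiv]
  simp [partialDeriv]

theorem partialDeriv_comm {f : E3 → ℝ} (hf : ContDiff ℝ ∞ f) (i j : Fin 3) (x : E3) :
    partialDeriv i (partialDeriv j f) x = partialDeriv j (partialDeriv i f) x := by
  have hd : DifferentiableAt ℝ (fderiv ℝ f) x :=
    ((hf.fderiv_right (m := ∞) (by simp)).differentiable (by simp)) x
  have h1 : ∀ i j, partialDeriv i (partialDeriv j f) x
      = fderiv ℝ (fderiv ℝ f) x (EuclideanSpace.single i 1) (EuclideanSpace.single j 1) := by
    intro i j
    have : partialDeriv j f = fun y => fderiv ℝ f y (EuclideanSpace.single j 1) := rfl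
    rw [this, partialDeriv, fderiv_clm_apply hd (by fun_prop)]
    simp
  rw [h1, h1]
  exact ((contDiff_infty.1 hf 2).contDiffAt.isSymmSndFDerivAt (by simp)) _ _

/-- Smooth functions with square integrable gradient are approximated by test functions. -/
theorem exists_cutoff_approx {f : E3 → ℝ} (hf : ContDiff ℝ ∞ f) (hf2 : MemLp f 2)
    (hdf : ∀ j, MemLp (partialDeriv j f) 2) :
    ∃ F : ℕ → E3 → ℝ, (∀ n, ContDiff ℝ ∞ (F n)) ∧ (∀ n, HasCompactSupport (F n)) ∧
      ∀ j, Tendsto (fun n => eLpNorm (fun x => partialDeriv j (F n) x - partialDeriv j f x) 2 volume)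
        atTop (𝓝 0) := by
  -- The potential is cut off at scale n + 1. The error in the product rule carries the factor 1/(n
  -- + 1) and is dominated by a multiple of |f|, which is square integrable.
  let χ : ContDiffBump (0 : E3) := ⟨1, 2, by norm_num, by norm_num⟩
  have hχ : ContDiff ℝ ∞ χ := χ.contDiff
  let r : ℕ → ℝ := fun n => ((n : ℝ) + 1)⁻¹
  have hr0 : ∀ n, r n ≠ 0 := fun n => by positivity
  have hr1 : ∀ n, |r n| ≤ 1 := fun n => by
    rw [abs_of_pos (by positivity)]
    exact inv_le_one_of_one_le₀ (by linarith [(Nat.cast_nonneg n : (0 : ℝ) ≤ n)])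
  have hrlim : Tendsto r atTop (𝓝 0) := by
    simpa [r, one_div] using tendsto_one_div_add_atTop_nhds_zero_nat (𝕜 := ℝ)
  have hχs : ∀ n, ContDiff ℝ ∞ fun x : E3 => χ (r n • x) := fun n =>
    hχ.comp (contDiff_const_smul (r n))
  refine ⟨fun n x => χ (r n • x) * f x, fun n => (hχs n).mul hf, fun n => ?_, fun j => ?_⟩
  · refine HasCompactSupport.mul_right ?_
    exact χ.hasCompactSupport.comp_smul (hr0 n)
  · have hdc : Continuous (partialDeriv j χ) := (contDiff_partialDeriv hχ j).continuous
    obtain ⟨C, hC⟩ := hdc.bounded_above_of_compact_support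
      (hasCompactSupport_partialDeriv χ.hasCompactSupport j)
    have hC0 : 0 ≤ C := (norm_nonneg _).trans (hC 0)
    have hd : ∀ n x, partialDeriv j (fun x => χ (r n • x) * f x) x - partialDeriv j f x
        = (χ (r n • x) - 1) * partialDeriv j f x + r n * partialDeriv j χ (r n • x) * f x := by
      intro n x
      rw [partialDeriv_mul ((hχs n).differentiable (by simp) x) (hf.differentiable (by simp) x),
        partialDeriv_comp_smul (hχ.differentiable (by simp))]
      ring
    simp only [hd]
    refine tendsto_eLpNorm_of_dominated (g := fun x => |partialDeriv j f x| + C * |f x|)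
      (fun n => ?_) ((hdf j).abs.add (hf2.abs.const_mul C)) (fun n x => ?_) (ae_of_all _ fun x => ?_)
    · have := (contDiff_partialDeriv hf j).continuous
      have := hf.continuous
      have := χ.continuous
      exact Continuous.aestronglyMeasurable (by fun_prop)
    · refine (norm_add_le _ _).trans (add_le_add ?_ ?_)
      · rw [norm_mul, Real.norm_eq_abs, Real.norm_eq_abs]
        refine mul_le_of_le_one_left (abs_nonneg _) ?_
        rw [abs_le]
        constructor <;> linarith [χ.nonneg' (r n • x), χ.le_one (x := r n • x)]
      · rw [norm_mul, norm_mul, Real.norm_eq_abs, Real.norm_eq_abs]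
        have := mul_le_mul (hr1 n) (hC (r n • x)) (norm_nonneg _) zero_le_one
        rw [one_mul] at this
        exact mul_le_mul_of_nonneg_right this (abs_nonneg _)
    · have hx : Tendsto (fun n => r n • x) atTop (𝓝 0) := by
        simpa using hrlim.smul_const x
      have h1 : Tendsto (fun n => χ (r n • x)) atTop (𝓝 1) := by
        have := (χ.continuous.tendsto 0).comp hx
        rwa [χ.one_of_mem_closedBall (by simp [χ])] at this
      have h2 : Tendsto (fun n => partialDeriv j χ (r n • x)) atTop (𝓝 (partialDeriv j χ 0)) :=
        (hdc.tendsto 0).comp hx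
      have := ((h1.sub_const 1).mul_const (partialDeriv j f x)).add
        ((hrlim.mul h2).mul_const (f x))
      simpa using this

/-- A longitudinal square integrable field is approximated by gradients of test functions. -/
theorem exists_gradient_approx {h : Fin 3 → E3 → ℝ} {V : Fin 3 → E3 → ℂ}
    (p : ∀ j, IsFourierPair (h j) (V j)) (hV : ∀ j, Measurable (V j))
    (hs : ∀ j ξ, V j (-ξ) = (starRingEnd ℂ) (V j ξ))
    (hmom : ∀ j (n : ℕ), Integrable fun ξ => ‖ξ‖ ^ n * ‖V j ξ‖)
    (hlong : ∀ ξ : E3, ξ ≠ 0 → ∃ g : ℂ, ∀ j, V j ξ = ξ j * g) {ε : ℝ≥0∞} (hε : ε ≠ 0) :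
    ∃ F : E3 → ℝ, ContDiff ℝ ∞ F ∧ HasCompactSupport F ∧
      ∀ j, eLpNorm (fun x => partialDeriv j F x - h j x) 2 volume ≤ ε := by
  -- Recovering the potential divides by |ξ|, which may destroy square integrability near the
  -- origin. Low frequencies are therefore discarded first, at an L² cost of ε/2; the spatial cutoff
  -- costs the other ε/2.
  let S : ℕ → Set E3 := fun n => {ξ | ((n : ℝ) + 1)⁻¹ < ‖ξ‖}
  have hS : ∀ n, MeasurableSet (S n) := fun n => measurableSet_lt measurable_const measurable_norm
  have hlow : ∀ j, Tendsto (fun n => eLpNorm (fun ξ => (S n).indicator (V j) ξ - V j ξ) 2 volume)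
      atTop (𝓝 0) := by
    intro j
    refine tendsto_eLpNorm_of_dominated (g := fun ξ => ‖V j ξ‖) (fun n => ?_) (p j).memLp.norm
      (fun n ξ => ?_) ?_
    · exact (((hV j).indicator (hS n)).sub (hV j)).aestronglyMeasurable
    · by_cases hξ : ξ ∈ S n <;> simp [hξ]
    · filter_upwards [ae_ne_zero] with ξ hξ
      refine tendsto_const_nhds.congr' ?_
      have h1 : Tendsto (fun n : ℕ => ((n : ℝ) + 1)⁻¹) atTop (𝓝 0) := by
        simpa [one_div] using tendsto_one_div_add_atTop_nhds_zero_nat (𝕜 := ℝ)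
      filter_upwards [h1.eventually_lt_const (norm_pos_iff.2 hξ)] with n hn
      have : ξ ∈ S n := hn
      simp [this]
  have hε2 : ε / 2 ≠ 0 := by simpa using hε
  obtain ⟨n, hn⟩ := (eventually_all.2 fun j =>
    (hlow j).eventually_le_const (pos_iff_ne_zero.2 hε2)).exists
  -- Transform of the potential: multiplication by 2πiξ_j returns the truncated V_j because V is
  -- longitudinal.
  let G : E3 → ℂ := (S n).indicator fun ξ =>
    (∑ j, (ξ j : ℂ) * V j ξ) / (2 * Real.pi * Complex.I * (‖ξ‖ ^ 2 : ℝ))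
  have hGm : Measurable G := by
    refine Measurable.indicator ?_ (hS n)
    fun_prop
  have hGle : ∀ ξ, ‖G ξ‖ ≤ ((n : ℝ) + 1) * ∑ j, ‖V j ξ‖ := by
    intro ξ
    have h0 : 0 ≤ ((n : ℝ) + 1) * ∑ j, ‖V j ξ‖ := by positivity
    by_cases hξ : ξ ∈ S n
    · have hlt : ((n : ℝ) + 1)⁻¹ < ‖ξ‖ := hξ
      have hpos : 0 < ‖ξ‖ := lt_trans (by positivity) hlt
      simp only [G, Set.indicator_of_mem hξ]
      have hden : ‖(2 * Real.pi * Complex.I * (‖ξ‖ ^ 2 : ℝ) : ℂ)‖ = 2 * Real.pi * ‖ξ‖ ^ 2 := by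
        simp [abs_of_pos Real.pi_pos]
      rw [norm_div, hden, div_le_iff₀ (by positivity)]
      have h1 : ‖∑ j, (ξ j : ℂ) * V j ξ‖ ≤ ‖ξ‖ * ∑ j, ‖V j ξ‖ := by
        rw [Finset.mul_sum]
        refine (norm_sum_le _ _).trans (Finset.sum_le_sum fun j _ => ?_)
        rw [norm_mul, Complex.norm_real, Real.norm_eq_abs]
        exact mul_le_mul_of_nonneg_right (abs_coord_le_norm ξ j) (norm_nonneg _)
      refine h1.trans ?_
      have h2 : 1 ≤ ((n : ℝ) + 1) * ‖ξ‖ := by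
        have := mul_le_mul_of_nonneg_left hlt.le (by positivity : (0 : ℝ) ≤ (n : ℝ) + 1)
        rwa [mul_inv_cancel₀ (by positivity)] at this
      have h3 : (1 : ℝ) ≤ 2 * Real.pi := by linarith [Real.pi_gt_three]
      have h4 : ‖ξ‖ ≤ ((n : ℝ) + 1) * ‖ξ‖ * (2 * Real.pi) * ‖ξ‖ := by
        have : 1 ≤ ((n : ℝ) + 1) * ‖ξ‖ * (2 * Real.pi) := one_le_mul_of_one_le_of_one_le h2 h3
        exact le_mul_of_one_le_left hpos.le this
      calc ‖ξ‖ * ∑ j, ‖V j ξ‖ ≤ (((n : ℝ) + 1) * ‖ξ‖ * (2 * Real.pi) * ‖ξ‖) * ∑ j, ‖V j ξ‖ := by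
            gcongr
        _ = _ := by ring
    · simpa [G, hξ] using h0
  have hGi : ∀ m : ℕ, Integrable fun ξ => ‖ξ‖ ^ m * ‖G ξ‖ := by
    intro m
    refine ((integrable_finsetSum Finset.univ fun j _ => hmom j m).const_mul
      ((n : ℝ) + 1)).mono' ?_ (ae_of_all _ fun ξ => ?_)
    · exact Measurable.aestronglyMeasurable (by fun_prop)
    · rw [norm_mul, norm_norm, norm_pow, norm_norm, ← Finset.mul_sum]
      calc _ ≤ ‖ξ‖ ^ m * (((n : ℝ) + 1) * ∑ j, ‖V j ξ‖) := by gcongr; exact hGle ξ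
        _ = _ := by ring
  have hG1 : Integrable G := (integrable_norm_iff hGm.aestronglyMeasurable).1 (by simpa using hGi 0)
  have hG2 : MemLp G 2 := by
    refine MemLp.mono (g := fun ξ => ((n : ℝ) + 1) * ∑ j, ‖V j ξ‖)
      ((memLp_finsetSum _ fun j _ => (p j).memLp.norm).const_mul _)
      hGm.aestronglyMeasurable (ae_of_all _ fun ξ => (hGle ξ).trans (le_abs_self _))
  have hGs : ∀ ξ, G (-ξ) = (starRingEnd ℂ) (G ξ) := by
    intro ξ
    by_cases hξ : ξ ∈ S n
    · have hξ' : -ξ ∈ S n := by simpa [S] using hξ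
      simp only [G, Set.indicator_of_mem hξ, Set.indicator_of_mem hξ', hs, map_div₀, map_sum,
        map_mul, Complex.conj_ofReal, Complex.conj_I, norm_neg, PiLp.neg_apply, map_ofNat]
      push_cast
      rw [← neg_div_neg_eq]
      congr 1
      · rw [← Finset.sum_neg_distrib]
        exact Finset.sum_congr rfl fun j _ => by ring
      · ring
    · have hξ' : -ξ ∉ S n := by simpa [S] using hξ
      simp [G, hξ, hξ']
  have pG := IsFourierPair.of_hermitian hG1 hG2 hGs
  set f : E3 → ℝ := fun x => (𝓕⁻ G x).re
  have hf : ContDiff ℝ ∞ f := pG.contDiff hGi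
  have hGV : ∀ j, (fun ξ : E3 => 2 * Real.pi * Complex.I * (ξ j : ℂ) * G ξ)
      = (S n).indicator (V j) := by
    intro j
    ext ξ
    by_cases hξ : ξ ∈ S n
    · have hlt : ((n : ℝ) + 1)⁻¹ < ‖ξ‖ := hξ
      have hpos : 0 < ‖ξ‖ := lt_trans (by positivity) hlt
      obtain ⟨g, hg⟩ := hlong ξ (norm_pos_iff.1 hpos)
      simp only [G, Set.indicator_of_mem hξ, hg]
      have h1 : ∑ k, (ξ k : ℂ) * (ξ k * g) = ((‖ξ‖ ^ 2 : ℝ) : ℂ) * g := by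
        rw [normSq_sum_three, Fin.sum_univ_three]
        push_cast
        ring
      have h2 : ((‖ξ‖ ^ 2 : ℝ) : ℂ) ≠ 0 := by exact_mod_cast (by positivity : ‖ξ‖ ^ 2 ≠ 0)
      have h3 : (Real.pi : ℂ) ≠ 0 := by exact_mod_cast Real.pi_ne_zero
      rw [h1]
      field_simp
    · simp [G, hξ]
  have hdf : ∀ j, IsFourierPair (partialDeriv j f) ((S n).indicator (V j)) := by
    intro j
    have h1 : partialDeriv j f = fun x => (𝓕⁻ ((S n).indicator (V j)) x).re := by
      funext x
      rw [partialDeriv_re_fourierInv hG1 (by simpa using hGi 1), hGV]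
    rw [h1]
    refine IsFourierPair.of_hermitian ((p j).integrable.indicator (hS n))
      ((p j).memLp.indicator (hS n)) fun ξ => ?_
    rw [← hGV]
    simp only [hGs, map_mul, Complex.conj_ofReal, Complex.conj_I, map_ofNat, PiLp.neg_apply]
    push_cast
    ring
  obtain ⟨F, hF, hFc, hFlim⟩ := exists_cutoff_approx hf pG.memLp_left fun j => (hdf j).memLp_left
  obtain ⟨m, hm⟩ := (eventually_all.2 fun j =>
    (hFlim j).eventually_le_const (pos_iff_ne_zero.2 hε2)).exists
  refine ⟨F m, hF m, hFc m, fun j => ?_⟩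
  have h1 : (fun x => partialDeriv j (F m) x - h j x)
      = (fun x => partialDeriv j (F m) x - partialDeriv j f x)
        + fun x => partialDeriv j f x - h j x := by
    ext x
    simp
  have hpd := (hdf j).sub (p j)
  rw [h1]
  refine (eLpNorm_add_le ?_ hpd.memLp_left.aestronglyMeasurable (by norm_num)).trans ?_
  · exact ((contDiff_partialDeriv (hF m) j).continuous.sub
      (contDiff_partialDeriv hf j).continuous).aestronglyMeasurable
  · rw [hpd.eLpNorm_eq]
    exact (add_le_add (hm j) (hn j)).trans_eq (ENNReal.add_halves ε)

end Approximation

/-! ### Existence and uniqueness of the energy minimizer -/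

section EnergyMinimizer

theorem abs_lame_ratio_le {lam mu : ℝ} (hmu : 0 < mu) (h : 0 < mu + 3 * lam / 2) :
    |lam / (lam + 2 * mu)| ≤ 1 := by
  have hpos : 0 < lam + 2 * mu := by linarith
  rw [abs_div, abs_of_pos hpos, div_le_one hpos, abs_le]
  constructor <;> linarith

theorem hasCompactSupport_of_components {w : MatrixField}
    (h : ∀ i j, HasCompactSupport fun x => w x i j) : HasCompactSupport w := by
  refine HasCompactSupport.of_support_subset_isCompact
    (K := ⋃ i, ⋃ j, tsupport fun x => w x i j)
    (isCompact_iUnion fun i => isCompact_iUnion fun j => h i j) fun x hx => ?_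
  by_contra hne
  simp only [Set.mem_iUnion, not_exists] at hne
  refine hx ?_
  ext i j
  exact image_eq_zero_of_notMem_tsupport (f := fun x => w x i j) (hne i j)

/-- Adding gradients of test functions does not change the Burgers vector density. -/
theorem IsAdmissible.add_gradient {b : TensorField} {u : MatrixField} (hu : IsAdmissible b u)
    {F : Fin 3 → E3 → ℝ} (hF : ∀ k, ContDiff ℝ ∞ (F k)) (hFc : ∀ k, HasCompactSupport (F k)) :
    IsAdmissible b fun x => Matrix.of fun j k => u x j k + partialDeriv j (F k) x := by
  have hs : ∀ j k, ContDiff ℝ ∞ (partialDeriv j (F k)) := fun j k => contDiff_partialDeriv (hF k) j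
  refine ⟨fun j k => (hu.1 j k).add (hs j k), hasCompactSupport_of_components fun j k =>
    (hu.component j k).add (hasCompactSupport_partialDeriv (hFc k) j), ?_⟩
  rw [← hu.2.2]
  funext x i j k
  simp only [d1, Matrix.of_apply]
  have h1 : ∀ i j, partialDeriv i (fun y => u y j k + partialDeriv j (F k) y) x
      = partialDeriv i (fun y => u y j k) x + partialDeriv i (partialDeriv j (F k)) x := fun i j =>
    partialDeriv_add ((hu.1 j k).differentiable (by simp) x)
      ((hs j k).differentiable (by simp) x) i
  rw [h1, h1, partialDeriv_comm (hF k) i j]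
  ring

namespace IsBurgersField

variable {b : TensorField} (hb : IsBurgersField b) {u₀ : MatrixField} (hu₀ : IsAdmissible b u₀)
include hb hu₀

/-- The minimizer itself need not be compactly supported. Its difference from the given admissible
field is longitudinal in every column, so it is approximated by gradients of test functions, whose
addition preserves admissibility. -/
theorem exists_admissible_approx {κ : ℝ} (hκ : |κ| ≤ 1) {ε : ℝ≥0∞} (hε : ε ≠ 0) :
    ∃ u, IsAdmissible b u ∧
      ∀ j k, eLpNorm (fun x => u x j k - minimizerField κ b x j k) 2 volume ≤ ε := by
  have hp : ∀ j k, IsFourierPair (fun x => minimizerField κ b x j k - u₀ x j k)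
      (fun ξ => minimizerFourier κ b j k ξ - realFourier (fun x => u₀ x j k) ξ) := fun j k =>
    (hb.isFourierPair_minimizer hκ j k).sub (hu₀.isFourierPair j k)
  have hcont : ∀ j k, Continuous (realFourier fun x => u₀ x j k) := fun j k =>
    continuous_realFourier (hu₀.1 j k) (hu₀.component j k)
  have hk : ∀ k, ∃ F : E3 → ℝ, ContDiff ℝ ∞ F ∧ HasCompactSupport F ∧ ∀ j,
      eLpNorm (fun x => partialDeriv j F x - (minimizerField κ b x j k - u₀ x j k)) 2 volume
        ≤ ε := by
    intro k
    refine exists_gradient_approx (fun j => hp j k)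
      (fun j => (hb.measurable_minimizerFourier κ j k).sub (hcont j k).measurable)
      (fun j ξ => ?_) (fun j n => ?_) (fun ξ hξ => ?_) hε
    · rw [map_sub, minimizerFourier_neg, realFourier_neg]
    · refine ((hb.integrable_pow_mul_minimizerFourier hκ j k n).add
        (integrable_pow_mul_realFourier (hu₀.1 j k) (hu₀.component j k) n)).mono' ?_
        (ae_of_all _ fun ξ => ?_)
      · have := hb.measurable_minimizerFourier κ j k
        have := (hcont j k).measurable
        exact Measurable.aestronglyMeasurable (by fun_prop)
      · rw [norm_mul, norm_norm, norm_pow, norm_norm]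
        simp only [Pi.add_apply]
        rw [← mul_add]
        gcongr
        exact norm_sub_le _ _
    · obtain ⟨g, hg⟩ := exists_eq_minimizerSymbol_add κ hξ
        (u := Matrix.of fun i j => realFourier (fun x => u₀ x i j) ξ) (hu₀.fourier ξ)
      refine ⟨-g k, fun j => ?_⟩
      have := congrFun (congrFun hg j) k
      simp only [Matrix.add_apply, Matrix.of_apply] at this ⊢
      rw [this]
      simp [minimizerFourier]
  choose F hF hFc hFle using hk
  refine ⟨_, hu₀.add_gradient hF hFc, fun j k => ?_⟩
  refine Eq.trans_le ?_ (hFle k j)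
  congr 1
  ext x
  simp only [Matrix.of_apply]
  ring

/-- By the Pythagorean identity the excess energy is a quadratic form of the difference to the
minimizer, hence of order (n + 1)⁻² for approximants at L² distance at most 1/(n + 1). -/
theorem exists_minimizing_seq {lam mu : ℝ} (hmu : 0 < mu) (h : 0 < mu + 3 * lam / 2) :
    ∃ u : ℕ → MatrixField, (∀ n, IsAdmissible b (u n)) ∧
      Tendsto (fun n => elasticEnergy lam mu (u n)) atTop (𝓝 (ENNReal.ofReal
        (∫ ξ, complexForm lam mu
          (Matrix.of fun i j => minimizerFourier (lam / (lam + 2 * mu)) b i j ξ)))) := by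
  have hκ := abs_lame_ratio_le hmu h
  have hn : ∀ n : ℕ, ENNReal.ofReal ((n : ℝ) + 1)⁻¹ ≠ 0 := fun n => by
    rw [Ne, ENNReal.ofReal_eq_zero, not_le]
    positivity
  choose u hu hle using fun n : ℕ => hb.exists_admissible_approx hu₀ hκ (hn n)
  refine ⟨u, hu, ?_⟩
  simp only [fun n => ((hu n).elasticEnergy_eq_add hmu h hb hκ).1]
  set κ := lam / (lam + 2 * mu)
  have hp : ∀ n i j, IsFourierPair (fun x => u n x i j - minimizerField κ b x i j)
      (fun ξ => realFourier (fun x => u n x i j) ξ - minimizerFourier κ b i j ξ) := fun n i j =>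
    ((hu n).isFourierPair i j).sub (hb.isFourierPair_minimizer hκ i j)
  have hsq : ∀ n i j, ∫ ξ, ‖realFourier (fun x => u n x i j) ξ - minimizerFourier κ b i j ξ‖ ^ 2
      ≤ ((n : ℝ) + 1)⁻¹ ^ 2 := by
    intro n i j
    have h1 := hle n i j
    rw [(hp n i j).eLpNorm_eq, IsFourierPair.eLpNorm_two_sq (hp n i j).memLp,
      ENNReal.ofReal_le_ofReal_iff (by positivity)] at h1
    exact (Real.sqrt_le_left (by positivity)).1 h1
  have hcf : ∀ n, ∫ ξ, complexForm lam mu (Matrix.of fun i j =>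
      realFourier (fun x => u n x i j) ξ - minimizerFourier κ b i j ξ)
      ≤ (6 * |lam| + 4 * |mu|) * (9 * ((n : ℝ) + 1)⁻¹ ^ 2) := by
    intro n
    have hi : ∀ i j, Integrable fun ξ =>
        ‖realFourier (fun x => u n x i j) ξ - minimizerFourier κ b i j ξ‖ ^ 2 := fun i j =>
      (memLp_two_iff_integrable_sq_norm (hp n i j).memLp.aestronglyMeasurable).1 (hp n i j).memLp
    have hii : Integrable fun ξ => ∑ i, ∑ j,
        ‖realFourier (fun x => u n x i j) ξ - minimizerFourier κ b i j ξ‖ ^ 2 :=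
      integrable_finsetSum _ fun i _ => integrable_finsetSum _ fun j _ => hi i j
    refine (integral_mono (integrable_complexForm fun i j => (hp n i j).memLp)
      (hii.const_mul (6 * |lam| + 4 * |mu|)) fun ξ => complexForm_le lam mu _).trans ?_
    rw [integral_const_mul]
    refine mul_le_mul_of_nonneg_left ?_ (by positivity)
    rw [integral_finsetSum _ fun i _ => integrable_finsetSum _ fun j _ => hi i j]
    calc ∑ i, ∫ ξ, ∑ j, ‖realFourier (fun x => u n x i j) ξ - minimizerFourier κ b i j ξ‖ ^ 2
        = ∑ i, ∑ j, ∫ ξ, ‖realFourier (fun x => u n x i j) ξ - minimizerFourier κ b i j ξ‖ ^ 2 :=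
          Finset.sum_congr rfl fun i _ => integral_finsetSum _ fun j _ => hi i j
      _ ≤ ∑ _i : Fin 3, ∑ _j : Fin 3, ((n : ℝ) + 1)⁻¹ ^ 2 :=
          Finset.sum_le_sum fun i _ => Finset.sum_le_sum fun j _ => hsq n i j
      _ = _ := by simp; ring
  refine ENNReal.tendsto_ofReal ?_
  have h1 : Tendsto (fun n : ℕ => ((n : ℝ) + 1)⁻¹) atTop (𝓝 0) := by
    simpa [one_div] using tendsto_one_div_add_atTop_nhds_zero_nat (𝕜 := ℝ)
  have h2 : Tendsto (fun n : ℕ => (6 * |lam| + 4 * |mu|) * (9 * ((n : ℝ) + 1)⁻¹ ^ 2))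
      atTop (𝓝 0) := by
    simpa using ((h1.pow 2).const_mul 9).const_mul (6 * |lam| + 4 * |mu|)
  have h3 := squeeze_zero (fun n => integral_nonneg fun ξ => complexForm_nonneg hmu h _) hcf h2
  simpa using h3.const_add (∫ ξ, complexForm lam mu
          (Matrix.of fun i j => minimizerFourier κ b i j ξ))

theorem minElasticEnergy_eq {lam mu : ℝ} (hmu : 0 < mu) (h : 0 < mu + 3 * lam / 2) :
    minElasticEnergy lam mu b = ENNReal.ofReal (∫ ξ, complexForm lam mu
      (Matrix.of fun i j => minimizerFourier (lam / (lam + 2 * mu)) b i j ξ)) := by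
  have hκ := abs_lame_ratio_le hmu h
  refine le_antisymm ?_ (le_iInf₂ fun u hu => ?_)
  · obtain ⟨u, hu, hlim⟩ := hb.exists_minimizing_seq hu₀ hmu h
    exact ge_of_tendsto' hlim fun n => iInf₂_le (u n) (hu n)
  · rw [(hu.elasticEnergy_eq_add hmu h hb hκ).1]
    exact ENNReal.ofReal_le_ofReal (le_add_of_nonneg_right
      (integral_nonneg fun ξ => complexForm_nonneg hmu h _))

/-- For a minimizing sequence the excess energy tends to 0, and by coercivity it dominates the
squared L² distance to the field. Boundedness comes from the integrable transform. -/
theorem isEnergyMinimizer {lam mu : ℝ} (hmu : 0 < mu) (h : 0 < mu + 3 * lam / 2) :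
    IsEnergyMinimizer lam mu b (minimizerField (lam / (lam + 2 * mu)) b) := by
  have hκ := abs_lame_ratio_le hmu h
  have hmin := hb.minElasticEnergy_eq hu₀ hmu h
  set κ := lam / (lam + 2 * mu) with hκdef
  have hp := fun i j => hb.isFourierPair_minimizer hκ i j
  refine ⟨hb.isSmoothField_minimizer hκ, ⟨∑ i, ∑ j, ∫ ξ, ‖minimizerFourier κ b i j ξ‖,
    fun x i j => ?_⟩, fun i j => (hp i j).memLp_left, fun u hu hlim i j => ?_⟩
  · refine ((hp i j).abs_le x).trans ?_
    have h0 : ∀ i j, 0 ≤ ∫ ξ, ‖minimizerFourier κ b i j ξ‖ := fun i j =>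
      integral_nonneg fun _ => norm_nonneg _
    refine (Finset.single_le_sum (f := fun j => ∫ ξ, ‖minimizerFourier κ b i j ξ‖)
      (fun j _ => h0 i j) (Finset.mem_univ j)).trans ?_
    exact Finset.single_le_sum (f := fun i => ∑ j, ∫ ξ, ‖minimizerFourier κ b i j ξ‖)
      (fun i _ => Finset.sum_nonneg fun j _ => h0 i j) (Finset.mem_univ i)
  · have hpu := fun n => (hu n).isFourierPair i j
    have hpd := fun n => (hpu n).sub (hp i j)
    simp only [fun n => (hpd n).eLpNorm_eq, fun n => IsFourierPair.eLpNorm_two_sq (hpd n).memLp]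
    set A := ∫ ξ, complexForm lam mu (Matrix.of fun i j => minimizerFourier κ b i j ξ)
    have hA : 0 ≤ A := integral_nonneg fun ξ => complexForm_nonneg hmu h _
    rw [hmin] at hlim
    simp only [fun n => ((hu n).elasticEnergy_eq_add hmu h hb hκ).1] at hlim
    have hle := fun n => ((hu n).elasticEnergy_eq_add hmu h hb hκ).2 i j
    set R : ℕ → ℝ := fun n => ∫ ξ, complexForm lam mu (Matrix.of fun i j =>
      realFourier (fun x => u n x i j) ξ - minimizerFourier κ b i j ξ)
    have hR : ∀ n, 0 ≤ R n := fun n => integral_nonneg fun ξ => complexForm_nonneg hmu h _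
    have h1 := (ENNReal.tendsto_toReal ENNReal.ofReal_ne_top).comp hlim
    rw [ENNReal.toReal_ofReal hA] at h1
    have h2 : Tendsto (fun n => A + R n) atTop (𝓝 A) := by
      refine h1.congr fun n => ?_
      exact ENNReal.toReal_ofReal (add_nonneg hA (hR n))
    have h3 : Tendsto R atTop (𝓝 0) := by simpa using h2.sub_const A
    have h4 : Tendsto (fun n => ∫ ξ, ‖realFourier (fun x => u n x i j) ξ
        - minimizerFourier κ b i j ξ‖ ^ 2) atTop (𝓝 0) := by
      refine squeeze_zero (fun n => integral_nonneg fun _ => sq_nonneg _) hle ?_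
      simpa using h3.const_mul (2 * mu)⁻¹
    have h5 := ENNReal.tendsto_ofReal ((Real.continuous_sqrt.tendsto 0).comp h4)
    simpa using h5

/-- Two minimizers are L² limits of one and the same minimizing sequence, whose existence keeps the
defining property from being vacuous; continuity upgrades equality almost everywhere to equality. -/
theorem eq_minimizerField {lam mu : ℝ} (hmu : 0 < mu) (h : 0 < mu + 3 * lam / 2)
    {w : MatrixField} (hw : IsEnergyMinimizer lam mu b w) :
    w = minimizerField (lam / (lam + 2 * mu)) b := by
  have hm := hb.isEnergyMinimizer hu₀ hmu h
  set w' := minimizerField (lam / (lam + 2 * mu)) b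
  obtain ⟨u, hu, hlim⟩ := hb.exists_minimizing_seq hu₀ hmu h
  rw [← hb.minElasticEnergy_eq hu₀ hmu h] at hlim
  funext x
  ext i j
  have hcw : Continuous fun x => w x i j := (hw.smooth i j).continuous
  have hcw' : Continuous fun x => w' x i j := (hm.smooth i j).continuous
  have h0 : eLpNorm (fun x => w x i j - w' x i j) 2 volume = 0 := by
    have h1 := (hw.tendsto u hu hlim i j).add (hm.tendsto u hu hlim i j)
    rw [add_zero] at h1
    refine le_antisymm (ge_of_tendsto' h1 fun n => ?_) bot_le
    have hcu : Continuous fun x => u n x i j := ((hu n).1 i j).continuous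
    have h2 : (fun x => w x i j - w' x i j)
        = (fun x => u n x i j - w' x i j) - fun x => u n x i j - w x i j := by
      ext x
      simp
    rw [h2, add_comm]
    exact eLpNorm_sub_le (hcu.sub hcw').aestronglyMeasurable (hcu.sub hcw).aestronglyMeasurable
      (by norm_num)
  have hcd : Continuous fun x => w x i j - w' x i j := hcw.sub hcw'
  have h3 : (fun x => w x i j - w' x i j) = fun _ => 0 :=
    (Continuous.ae_eq_iff_eq volume hcd continuous_const).1
      ((eLpNorm_eq_zero_iff hcd.aestronglyMeasurable (by norm_num)).1 h0)
  exact sub_eq_zero.1 (congrFun h3 x)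

theorem existsUnique_isEnergyMinimizer {lam mu : ℝ} (hmu : 0 < mu) (h : 0 < mu + 3 * lam / 2) :
    ∃! w, IsEnergyMinimizer lam mu b w :=
  ⟨_, hb.isEnergyMinimizer hu₀ hmu h, fun _ hw => hb.eq_minimizerField hu₀ hmu h hw⟩

theorem wStar_eq {lam mu : ℝ} (hmu : 0 < mu) (h : 0 < mu + 3 * lam / 2) :
    wStar lam mu b = minimizerField (lam / (lam + 2 * mu)) b := by
  have hex : ∃ w, IsEnergyMinimizer lam mu b w := ⟨_, hb.isEnergyMinimizer hu₀ hmu h⟩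
  rw [wStar, dif_pos hex]
  exact hb.eq_minimizerField hu₀ hmu h hex.choose_spec

end IsBurgersField

end EnergyMinimizer

/-! ### Smearing measures with the form function -/

section Smear

/-- The convolution of a function with a measure. -/
def smear (φ : E3 → ℝ) (ν : Measure E3) (x : E3) : ℝ := ∫ y, φ (x - y) ∂ν

variable {φ : E3 → ℝ} {ν : Measure E3}

theorem contDiff_smear [IsFiniteMeasure ν] (hφ : ContDiff ℝ ∞ φ) (hc : HasCompactSupport φ) :
    ContDiff ℝ ∞ (smear φ ν) := by
  have h : smear φ ν = convolution (fun _ => (1 : ℝ)) φ (ContinuousLinearMap.lsmul ℝ ℝ) ν := by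
    funext x
    simp [smear, convolution]
  rw [h]
  exact hc.contDiff_convolution_right _ (locallyIntegrable_const _) hφ

theorem hasCompactSupport_smear (hc : HasCompactSupport φ) {K : Set E3} (hK : IsCompact K)
    (hν : ν Kᶜ = 0) : HasCompactSupport (smear φ ν) := by
  refine HasCompactSupport.of_support_subset_isCompact (hc.isCompact.add hK) fun x hx => ?_
  by_contra hne
  refine hx ?_
  rw [smear]
  refine integral_eq_zero_of_ae ?_
  have : ∀ᵐ y ∂ν, y ∈ K := hν
  filter_upwards [this] with y hy
  refine image_eq_zero_of_notMem_tsupport fun h => hne ?_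
  exact ⟨x - y, h, y, hy, by simp⟩

theorem integrable_sub_comp [IsFiniteMeasure ν] {f : E3 → ℝ} (hf : Continuous f)
    (hc : HasCompactSupport f) (x : E3) : Integrable (fun y => f (x - y)) ν := by
  obtain ⟨C, hC⟩ := hf.bounded_above_of_compact_support hc
  exact Integrable.of_bound (hf.comp (continuous_const.sub continuous_id)).aestronglyMeasurable C
    (ae_of_all _ fun y => hC _)

theorem partialDeriv_smear [IsFiniteMeasure ν] (hφ : ContDiff ℝ ∞ φ) (hc : HasCompactSupport φ)
    (i : Fin 3) (x : E3) : partialDeriv i (smear φ ν) x = smear (partialDeriv i φ) ν x := by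
  have hd : Continuous (fderiv ℝ φ) := (hφ.fderiv_right (m := ∞) (by simp)).continuous
  obtain ⟨C, hC⟩ := hd.bounded_above_of_compact_support (hc.fderiv ℝ)
  have hm : AEStronglyMeasurable (fun y => fderiv ℝ φ (x - y)) ν :=
    (hd.comp (continuous_const.sub continuous_id)).aestronglyMeasurable
  have h := hasFDerivAt_integral_of_dominated_of_fderiv_le (μ := ν) (𝕜 := ℝ) (s := Set.univ)
    (F := fun x y => φ (x - y)) (F' := fun x y => fderiv ℝ φ (x - y)) (x₀ := x)
    (bound := fun _ => C) Filter.univ_mem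
    (Eventually.of_forall fun x => (hφ.continuous.comp
      (continuous_const.sub continuous_id)).aestronglyMeasurable)
    (integrable_sub_comp hφ.continuous hc x) hm
    (ae_of_all _ fun y z _ => hC _) (integrable_const C)
    (ae_of_all _ fun y z _ => by
      have h1 : HasFDerivAt (fun z : E3 => z - y) (ContinuousLinearMap.id ℝ E3) z :=
        (hasFDerivAt_id z).sub_const y
      have h2 := ((hφ.differentiable (by simp)) (z - y)).hasFDerivAt.comp z h1
      rwa [ContinuousLinearMap.comp_id] at h2)
  have h2 : fderiv ℝ (smear φ ν) x = ∫ y, fderiv ℝ φ (x - y) ∂ν := h.fderiv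
  rw [partialDeriv, h2, ContinuousLinearMap.integral_apply]
  · rfl
  · exact Integrable.of_bound hm C (ae_of_all _ fun y => hC _)

theorem hasCompactSupport_sum {ι : Type*} (s : Finset ι) {f : ι → E3 → ℝ}
    (h : ∀ a ∈ s, HasCompactSupport (f a)) : HasCompactSupport fun x => ∑ a ∈ s, f a x := by
  classical
  induction s using Finset.induction_on with
  | empty => exact HasCompactSupport.zero
  | insert a s ha ih =>
    simp only [Finset.sum_insert ha]
    exact (h a (Finset.mem_insert_self a s)).add
      (ih fun b hb => h b (Finset.mem_insert_of_mem hb))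

end Smear

/-! ### Burgers vector densities of currents -/

section Burgers

variable {Λ : MesoscopicLattice} {E : Finset Λ.Edge} (o : CountingDirection Λ)

instance (e : Λ.Edge) : IsFiniteMeasure (edgeMeasure o e) := by
  unfold edgeMeasure
  exact Measure.smul_finite _ ENNReal.ofReal_ne_top

/-- The point `src e + t (tgt e - src e)` of the segment of an edge. -/
def edgePoint (e : Λ.Edge) (t : ℝ) : E3 := o.src e + t • (o.tgt e - o.src e)

theorem continuous_edgePoint (e : Λ.Edge) : Continuous (edgePoint o e) := by
  unfold edgePoint
  fun_prop

theorem edgeMeasure_compl (e : Λ.Edge) :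
    edgeMeasure o e (edgePoint o e '' Set.Icc 0 1)ᶜ = 0 := by
  have hK : IsCompact (edgePoint o e '' Set.Icc 0 1) :=
    isCompact_Icc.image (continuous_edgePoint o e)
  have h : Measure.map (edgePoint o e) (volume.restrict (Set.Icc 0 1))
      (edgePoint o e '' Set.Icc 0 1)ᶜ = 0 := by
    rw [Measure.map_apply (continuous_edgePoint o e).measurable hK.measurableSet.compl,
      Measure.restrict_apply (hK.measurableSet.compl.preimage
        (continuous_edgePoint o e).measurable)]
    convert measure_empty (μ := (volume : Measure ℝ))
    ext t
    simp only [Set.mem_inter_iff, Set.mem_preimage, Set.mem_compl_iff, Set.mem_empty_iff_false,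
      iff_false, not_and]
    exact fun h1 h2 => h1 ⟨t, h2, rfl⟩
  rw [edgeMeasure, Measure.smul_apply]
  have : (fun t : ℝ => o.src e + t • (o.tgt e - o.src e)) = edgePoint o e := rfl
  rw [this, h, smul_zero]

theorem smear_edgeMeasure {φ : E3 → ℝ} (hφ : Continuous φ) (e : Λ.Edge) (x : E3) :
    smear φ (edgeMeasure o e) x
      = ‖o.tgt e - o.src e‖ * ∫ t in (0 : ℝ)..1, φ (x - edgePoint o e t) := by
  rw [smear, edgeMeasure, integral_smul_measure, ENNReal.toReal_ofReal (norm_nonneg _),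
    smul_eq_mul, intervalIntegral.integral_of_le zero_le_one, ← integral_Icc_eq_integral_Ioc]
  congr 1
  refine integral_map (continuous_edgePoint o e).aemeasurable ?_
  exact (hφ.comp (continuous_const.sub continuous_id)).aestronglyMeasurable

/-- The length in the edge measure cancels the normalization of the unit vector, leaving expressions
polynomial in the end points. -/
theorem unitVec_mul_smear {φ : E3 → ℝ} (hφ : Continuous φ) (e : Λ.Edge) (x : E3) (l : Fin 3) :
    unitVec o e l * smear φ (edgeMeasure o e) x
      = (o.tgt e - o.src e) l * ∫ t in (0 : ℝ)..1, φ (x - edgePoint o e t) := by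
  rw [smear_edgeMeasure o hφ]
  by_cases h : ‖o.tgt e - o.src e‖ = 0
  · rw [h, norm_eq_zero.1 h]
    simp
  · rw [unitVec, PiLp.smul_apply, smul_eq_mul]
    field_simp

theorem smoothedCurrent_apply (φ : E3 → ℝ) (I : E → E3) (x : E3) (j k : Fin 3) :
    smoothedCurrent o φ I x j k
      = ∑ e : E, unitVec o e j * I e k * smear φ (edgeMeasure o e) x := rfl

theorem isBurgersField_burgers {φ : E3 → ℝ} (hφ : ContDiff ℝ ∞ φ) (hc : HasCompactSupport φ)
    (I : E → E3) : IsBurgersField (burgers o φ I) := by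
  refine ⟨fun i j k => ?_, fun i j k => ?_⟩
  · simp only [burgers, smoothedCurrent_apply]
    exact ContDiff.sum fun l _ => contDiff_const.mul (ContDiff.sum fun e _ =>
      contDiff_const.mul (contDiff_smear hφ hc))
  · simp only [burgers, smoothedCurrent_apply]
    refine hasCompactSupport_sum _ fun l _ => HasCompactSupport.mul_left
      (hasCompactSupport_sum _ fun e _ => HasCompactSupport.mul_left ?_)
    exact hasCompactSupport_smear hc (isCompact_Icc.image (continuous_edgePoint o e))
      (edgeMeasure_compl o e)

end Burgers

/-! ### Compactly supported fields with prescribed Burgers vector density -/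

section Cone

variable {Λ : MesoscopicLattice} {E : Finset Λ.Edge} (o : CountingDirection Λ)

theorem fderiv_eq_sum_partialDeriv (φ : E3 → ℝ) (y v : E3) :
    fderiv ℝ φ y v = ∑ m, v m * partialDeriv m φ y := by
  have h : v = ∑ m, v m • EuclideanSpace.single m (1 : ℝ) := by
    ext n
    simp [Finset.sum_apply, Pi.single_apply]
  conv_lhs => rw [h]
  simp [partialDeriv]

/-- The parametrization of the cone over an edge with apex at the origin. -/
def conePoint (e : Λ.Edge) (p : ℝ × ℝ) : E3 := p.1 • edgePoint o e p.2

theorem contDiff_conePoint (e : Λ.Edge) : ContDiff ℝ ∞ (conePoint o e) := by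
  unfold conePoint edgePoint
  fun_prop

/-- The measure on the cone over an edge that carries the vector potential of the edge. -/
def coneMeasure (e : Λ.Edge) : Measure E3 :=
  Measure.map (conePoint o e) ((volume.restrict (Set.Icc 0 1)).withDensity
    fun p : ℝ × ℝ => (p.1.toNNReal : ℝ≥0∞))

theorem smear_coneMeasure {f : E3 → ℝ} (hf : Continuous f) (e : Λ.Edge) (x : E3) :
    smear f (coneMeasure o e) x
      = ∫ p in Set.Icc (0 : ℝ × ℝ) 1, p.1 * f (x - conePoint o e p) := by
  have hm : Continuous fun y => f (x - y) := hf.comp (continuous_const.sub continuous_id)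
  rw [smear, coneMeasure, integral_map (contDiff_conePoint o e).continuous.aemeasurable
    hm.aestronglyMeasurable, integral_withDensity_eq_integral_smul (by fun_prop)]
  refine setIntegral_congr_fun measurableSet_Icc fun p hp => ?_
  have : 0 ≤ p.1 := hp.1.1
  simp [NNReal.smul_def, this]

instance (e : Λ.Edge) : IsFiniteMeasure (coneMeasure o e) := by
  have h : IsFiniteMeasure ((volume.restrict (Set.Icc 0 1)).withDensity
      fun p : ℝ × ℝ => (p.1.toNNReal : ℝ≥0∞)) := by
    refine isFiniteMeasure_withDensity ?_
    refine ((setLIntegral_mono' (g := fun _ => 1) measurableSet_Icc fun p hp => ?_).trans_lt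
      ?_).ne
    · have : p.1 ≤ 1 := hp.2.1
      exact_mod_cast Real.toNNReal_le_one.2 this
    · rw [setLIntegral_one]
      exact isCompact_Icc.measure_lt_top
  unfold coneMeasure
  infer_instance

theorem coneMeasure_compl (e : Λ.Edge) :
    coneMeasure o e (conePoint o e '' Set.Icc 0 1)ᶜ = 0 := by
  have hcont := (contDiff_conePoint o e).continuous
  have hK : IsCompact (conePoint o e '' Set.Icc 0 1) := isCompact_Icc.image hcont
  rw [coneMeasure, Measure.map_apply hcont.measurable hK.measurableSet.compl]
  refine withDensity_absolutelyContinuous _ _ ?_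
  rw [Measure.restrict_apply (hK.measurableSet.compl.preimage hcont.measurable)]
  convert measure_empty (μ := (volume : Measure (ℝ × ℝ)))
  ext t
  simp only [Set.mem_inter_iff, Set.mem_preimage, Set.mem_compl_iff, Set.mem_empty_iff_false,
    iff_false, not_and]
  exact fun h1 h2 => h1 ⟨t, h2, rfl⟩

/-- The vector product in coordinates. -/
def crossVec (u v : E3) : Fin 3 → ℝ :=
  ![u 1 * v 2 - u 2 * v 1, u 2 * v 0 - u 0 * v 2, u 0 * v 1 - u 1 * v 0]

/-- The normal of the cone over a straight edge is constant along the edge, so one scalar measure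
per edge suffices for the vector potential. -/
theorem crossVec_edgePoint (e : Λ.Edge) (t : ℝ) (j : Fin 3) :
    crossVec (edgePoint o e t) (o.tgt e - o.src e) j
      = crossVec (o.src e) (o.tgt e - o.src e) j := by
  fin_cases j <;> simp [crossVec, edgePoint] <;> ring

/-- The expansion g × (u × v) = u(v·g) - v(u·g) in antisymmetric notation. -/
theorem mul_crossVec_sub (g : Fin 3 → ℝ) (u v : E3) (i j : Fin 3) :
    g i * crossVec u v j - g j * crossVec u v i
      = ∑ l, leviCivita i j l * (u l * ∑ m, v m * g m - v l * ∑ m, u m * g m) := by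
  unfold leviCivita
  fin_cases i <;> fin_cases j <;>
    simp [crossVec, Matrix.det_fin_three, Fin.sum_univ_three] <;> ring

/-- Stokes' theorem on the cone over an edge. -/
theorem integral_cone {φ : E3 → ℝ} (hφ : ContDiff ℝ ∞ φ) (e : Λ.Edge) (x : E3) (l : Fin 3) :
    ∫ p in Set.Icc (0 : ℝ × ℝ) 1, p.1 * (edgePoint o e p.2 l *
        (∑ m, (o.tgt e - o.src e) m * partialDeriv m φ (x - conePoint o e p))
      - (o.tgt e - o.src e) l *
        ∑ m, edgePoint o e p.2 m * partialDeriv m φ (x - conePoint o e p))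
    = (o.tgt e - o.src e) l * (∫ t in (0 : ℝ)..1, φ (x - edgePoint o e t))
      - (o.tgt e l * (∫ s in (0 : ℝ)..1, φ (x - s • o.tgt e))
        - o.src e l * ∫ s in (0 : ℝ)..1, φ (x - s • o.src e)) := by
  set d := o.tgt e - o.src e with hd
  have hcp := contDiff_conePoint o e
  have hγ : ContDiff ℝ ∞ fun p : ℝ × ℝ => edgePoint o e p.2 l := by
    unfold edgePoint
    simp only [PiLp.add_apply, PiLp.smul_apply, smul_eq_mul]
    fun_prop
  have hh : ContDiff ℝ ∞ fun p : ℝ × ℝ => φ (x - conePoint o e p) :=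
    hφ.comp (contDiff_const.sub hcp)
  -- In the divergence ∂_s F + ∂_t G the undifferentiated terms cancel and the integrand remains. On
  -- the boundary, F gives the edge at s = 1 and nothing at s = 0, while G gives the rays to the two
  -- end points.
  let F : ℝ × ℝ → ℝ := fun p => p.1 * d l * φ (x - conePoint o e p)
  let G : ℝ × ℝ → ℝ := fun p => -(edgePoint o e p.2 l * φ (x - conePoint o e p))
  have hF : ContDiff ℝ ∞ F := (contDiff_fst.mul contDiff_const).mul hh
  have hG : ContDiff ℝ ∞ G := (hγ.mul hh).neg
  have hFd : ∀ p, HasFDerivAt F (fderiv ℝ F p) p := fun p =>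
    (hF.differentiable (by simp) p).hasFDerivAt
  have hGd : ∀ p, HasFDerivAt G (fderiv ℝ G p) p := fun p =>
    (hG.differentiable (by simp) p).hasFDerivAt
  have hφd : ∀ y, HasFDerivAt φ (fderiv ℝ φ y) y := fun y =>
    (hφ.differentiable (by simp) y).hasFDerivAt
  have hF1 : ∀ p : ℝ × ℝ, fderiv ℝ F p (1, 0) = d l * φ (x - conePoint o e p)
      - p.1 * d l * fderiv ℝ φ (x - conePoint o e p) (edgePoint o e p.2) := by
    intro p
    have h1 : HasDerivAt (fun s : ℝ => (s, p.2)) ((1 : ℝ), (0 : ℝ)) p.1 :=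
      (hasDerivAt_id p.1).prodMk (hasDerivAt_const p.1 p.2)
    have h2 : HasDerivAt (fun s : ℝ => F (s, p.2)) (fderiv ℝ F p (1, 0)) p.1 :=
      HasFDerivAt.comp_hasDerivAt (f := fun s : ℝ => (s, p.2)) p.1 (hFd p) h1
    have h3 : HasDerivAt (fun s : ℝ => x - s • edgePoint o e p.2) (-edgePoint o e p.2) p.1 := by
      simpa using ((hasDerivAt_id p.1).smul_const (edgePoint o e p.2)).const_sub x
    have h4 : HasDerivAt (fun s : ℝ => φ (x - s • edgePoint o e p.2)) _ p.1 :=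
      (hφd (x - p.1 • edgePoint o e p.2)).comp_hasDerivAt p.1 h3
    have h5 := ((hasDerivAt_id p.1).mul_const (d l)).mul h4
    rw [h2.unique h5]
    simp only [conePoint, map_neg, id]
    ring
  have hG1 : ∀ p : ℝ × ℝ, fderiv ℝ G p (0, 1) = -(d l * φ (x - conePoint o e p))
      + edgePoint o e p.2 l * (p.1 * fderiv ℝ φ (x - conePoint o e p) d) := by
    intro p
    have h1 : HasDerivAt (fun t : ℝ => (p.1, t)) ((0 : ℝ), (1 : ℝ)) p.2 :=
      (hasDerivAt_const p.2 p.1).prodMk (hasDerivAt_id p.2)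
    have h2 : HasDerivAt (fun t : ℝ => G (p.1, t)) (fderiv ℝ G p (0, 1)) p.2 :=
      HasFDerivAt.comp_hasDerivAt (f := fun t : ℝ => (p.1, t)) p.2 (hGd p) h1
    have h0 : HasDerivAt (edgePoint o e) d p.2 := by
      have := ((hasDerivAt_id p.2).smul_const d).const_add (o.src e)
      rwa [one_smul] at this
    have h3 : HasDerivAt (fun t : ℝ => x - p.1 • edgePoint o e t) (-(p.1 • d)) p.2 :=
      (h0.const_smul p.1).const_sub x
    have h4 : HasDerivAt (fun t : ℝ => φ (x - p.1 • edgePoint o e t)) _ p.2 :=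
      (hφd (x - p.1 • edgePoint o e p.2)).comp_hasDerivAt p.2 h3
    have h6 : HasDerivAt (fun t : ℝ => edgePoint o e t l) (d l) p.2 := by
      have := ((hasDerivAt_id p.2).mul_const (d l)).const_add (o.src e l)
      rwa [one_mul] at this
    have h5 := (h6.mul h4).neg
    rw [h2.unique h5]
    simp only [conePoint, map_neg, map_smul, smul_eq_mul]
    ring
  have hcF : Continuous fun p => fderiv ℝ F p (1, 0) :=
    (hF.fderiv_right (m := ∞) (by simp)).continuous.clm_apply continuous_const
  have hcG : Continuous fun p => fderiv ℝ G p (0, 1) :=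
    (hG.fderiv_right (m := ∞) (by simp)).continuous.clm_apply continuous_const
  have hdiv := integral_divergence_prod_Icc_of_hasFDerivAt_of_le F G (fderiv ℝ F) (fderiv ℝ G)
    (0 : ℝ × ℝ) 1 (by constructor <;> simp) hF.continuous.continuousOn hG.continuous.continuousOn
    (fun p _ => hFd p) (fun p _ => hGd p) ((hcF.add hcG).continuousOn.integrableOn_compact
      isCompact_Icc)
  have hl : ∀ p : ℝ × ℝ, fderiv ℝ F p (1, 0) + fderiv ℝ G p (0, 1) = p.1 * (edgePoint o e p.2 l *
        (∑ m, d m * partialDeriv m φ (x - conePoint o e p))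
      - d l * ∑ m, edgePoint o e p.2 m * partialDeriv m φ (x - conePoint o e p)) := by
    intro p
    rw [hF1, hG1, ← fderiv_eq_sum_partialDeriv, ← fderiv_eq_sum_partialDeriv]
    ring
  simp only [hl] at hdiv
  rw [hdiv]
  have e1 : edgePoint o e 1 = o.tgt e := by simp [edgePoint]
  have e0 : edgePoint o e 0 = o.src e := by simp [edgePoint]
  simp only [F, G, conePoint, e1, e0, Prod.fst_zero, Prod.snd_zero, Prod.fst_one, Prod.snd_one,
    intervalIntegral.integral_neg, intervalIntegral.integral_const_mul, one_mul, zero_mul,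
    one_smul, intervalIntegral.integral_zero]
  ring

/-- Discrete summation by parts: the increments of h along edges are regrouped at vertices, where
Kirchhoff's law annihilates them. -/
theorem sum_kirchhoff {Γ : Submodule ℤ E3} {I : E → E3} (hI : I ∈ currents Γ o E) (h : E3 → ℝ)
    (k : Fin 3) : ∑ e : E, I e k * (h (o.tgt e) - h (o.src e)) = 0 := by
  classical
  let S : Finset E3 := (Finset.univ.image fun e : E => o.tgt e) ∪ Finset.univ.image fun e : E => o.src e
  have hne : ∀ e : Λ.Edge, Λ.graph.Adj (o.src e) (o.tgt e) := fun e => by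
    rw [← SimpleGraph.mem_edgeSet, o.mk_src_tgt]
    exact e.2
  have hS : ∀ v ∈ S, v ∈ Λ.verts := by
    intro v hv
    rcases Finset.mem_union.1 hv with hv | hv
    · obtain ⟨e, -, rfl⟩ := Finset.mem_image.1 hv
      exact Λ.mem_verts_of_adj _ _ (hne e).symm
    · obtain ⟨e, -, rfl⟩ := Finset.mem_image.1 hv
      exact Λ.mem_verts_of_adj _ _ (hne e)
  have hinc : ∀ e : E, h (o.tgt e) - h (o.src e) = ∑ v ∈ S, incidence o v e * h v := by
    intro e
    have h1 : ∀ v, incidence o v e * h v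
        = (if o.tgt e = v then h v else 0) - if o.src e = v then h v else 0 := by
      intro v
      have := (hne e).ne
      by_cases ht : o.tgt e = v
      · have hs : o.src e ≠ v := fun hs => this (hs.trans ht.symm)
        simp [incidence, ht, hs]
      · by_cases hs : o.src e = v <;> simp [incidence, ht, hs]
    simp only [h1, Finset.sum_sub_distrib, Finset.sum_ite_eq]
    rw [if_pos (Finset.mem_union_left _ (Finset.mem_image_of_mem _ (Finset.mem_univ e))),
      if_pos (Finset.mem_union_right _ (Finset.mem_image_of_mem _ (Finset.mem_univ e)))]
  simp only [hinc, Finset.mul_sum]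
  rw [Finset.sum_comm]
  refine Finset.sum_eq_zero fun v hv => ?_
  have h1 := congrArg (fun y : E3 => y k) (hI.2 v (hS v hv))
  simp only [WithLp.ofLp_sum, Finset.sum_apply, PiLp.smul_apply, smul_eq_mul, PiLp.zero_apply] at h1
  calc ∑ e : E, I e k * (incidence o v e * h v) = (∑ e : E, incidence o v e * I e k) * h v := by
        rw [Finset.sum_mul]
        exact Finset.sum_congr rfl fun e _ => by ring
    _ = 0 := by rw [h1, zero_mul]

/-- The vector potential of a current obtained from the cones over the edges. -/
def coneField (φ : E3 → ℝ) (I : E → E3) : MatrixField := fun x =>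
  Matrix.of fun j k => ∑ e : E, I e k * crossVec (o.src e) (o.tgt e - o.src e) j *
    smear φ (coneMeasure o e) x

/-- The Poincaré lemma in explicit form. By Stokes' theorem each cone contributes its edge minus two
rays from the origin; the rays at every vertex cancel by Kirchhoff's law. -/
theorem isAdmissible_coneField {Γ : Submodule ℤ E3} {φ : E3 → ℝ} (hφ : ContDiff ℝ ∞ φ)
    (hc : HasCompactSupport φ) {I : E → E3} (hI : I ∈ currents Γ o E) :
    IsAdmissible (burgers o φ I) (coneField o φ I) := by
  have hcs : ∀ e : Λ.Edge, HasCompactSupport (smear φ (coneMeasure o e)) := fun e =>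
    hasCompactSupport_smear hc (isCompact_Icc.image (contDiff_conePoint o e).continuous)
      (coneMeasure_compl o e)
  refine ⟨fun j k => ?_, hasCompactSupport_of_components fun j k => ?_, ?_⟩
  · simp only [coneField, Matrix.of_apply]
    exact ContDiff.sum fun e _ => contDiff_const.mul (contDiff_smear hφ hc)
  · simp only [coneField, Matrix.of_apply]
    exact hasCompactSupport_sum _ fun e _ => (hcs e).mul_left
  · funext x i j k
    have hpd : ∀ i j, partialDeriv i (fun y => coneField o φ I y j k) x
        = ∑ e : E, I e k * crossVec (o.src e) (o.tgt e - o.src e) j *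
          smear (partialDeriv i φ) (coneMeasure o e) x := by
      intro i j
      simp only [coneField, Matrix.of_apply]
      have hdiff : ∀ e : E, DifferentiableAt ℝ (smear φ (coneMeasure o e)) x := fun e =>
        (contDiff_smear hφ hc).differentiable (by simp) x
      rw [partialDeriv, fderiv_fun_sum fun e _ => (hdiff e).const_mul _,
        sum_apply]
      refine Finset.sum_congr rfl fun e _ => ?_
      rw [fderiv_const_mul (hdiff e), smul_apply, smul_eq_mul,
        ← partialDeriv_smear hφ hc]
      rfl
    rw [d1, hpd, hpd, ← Finset.sum_sub_distrib]
    have hcd : ∀ m, Continuous (partialDeriv m φ) := fun m =>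
      (contDiff_partialDeriv hφ m).continuous
    have hterm : ∀ e : E, crossVec (o.src e) (o.tgt e - o.src e) j *
          smear (partialDeriv i φ) (coneMeasure o e) x
        - crossVec (o.src e) (o.tgt e - o.src e) i *
          smear (partialDeriv j φ) (coneMeasure o e) x
        = ∑ l, leviCivita i j l * (unitVec o e l * smear φ (edgeMeasure o e) x
          - (o.tgt e l * (∫ s in (0 : ℝ)..1, φ (x - s • o.tgt e))
            - o.src e l * ∫ s in (0 : ℝ)..1, φ (x - s • o.src e))) := by
      intro e
      have hint : ∀ f : ℝ × ℝ → ℝ, Continuous f →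
          Integrable f (volume.restrict (Set.Icc (0 : ℝ × ℝ) 1)) := fun f hf =>
        hf.continuousOn.integrableOn_compact isCompact_Icc
      have hcc := (contDiff_conePoint o (e : Λ.Edge)).continuous
      have hce := continuous_edgePoint o (e : Λ.Edge)
      simp only [unitVec_mul_smear o hφ.continuous, ← integral_cone o hφ]
      rw [smear_coneMeasure o (hcd i), smear_coneMeasure o (hcd j), ← integral_const_mul,
        ← integral_const_mul, ← integral_sub]
      · simp only [← integral_const_mul]
        rw [← integral_finsetSum]
        · refine integral_congr_ae (ae_of_all _ fun p => ?_)
          have := mul_crossVec_sub (fun m => partialDeriv m φ (x - conePoint o e p))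
            (edgePoint o e p.2) (o.tgt e - o.src e) i j
          simp only [crossVec_edgePoint] at this
          calc _ = p.1 * (partialDeriv i φ (x - conePoint o e p)
                  * crossVec (o.src e) (o.tgt e - o.src e) j
                - partialDeriv j φ (x - conePoint o e p)
                  * crossVec (o.src e) (o.tgt e - o.src e) i) := by ring
            _ = _ := by
              rw [this, Finset.mul_sum]
              exact Finset.sum_congr rfl fun l _ => by ring
        · exact fun l _ => hint _ (by fun_prop)
      · exact hint _ (by fun_prop)
      · exact hint _ (by fun_prop)
    have hB := fun l : Fin 3 => sum_kirchhoff o hI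
      (fun v => v l * ∫ s in (0 : ℝ)..1, φ (x - s • v)) k
    simp only [burgers, smoothedCurrent_apply]
    calc _ = ∑ e : E, I e k * ∑ l, leviCivita i j l * (unitVec o e l * smear φ (edgeMeasure o e) x
          - (o.tgt e l * (∫ s in (0 : ℝ)..1, φ (x - s • o.tgt e))
            - o.src e l * ∫ s in (0 : ℝ)..1, φ (x - s • o.src e))) :=
          Finset.sum_congr rfl fun e _ => by rw [← hterm]; ring
      _ = ∑ l, leviCivita i j l * ((∑ e : E, unitVec o e l * I e k * smear φ (edgeMeasure o e) x)
          - ∑ e : E, I e k * (o.tgt e l * (∫ s in (0 : ℝ)..1, φ (x - s • o.tgt e))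
            - o.src e l * ∫ s in (0 : ℝ)..1, φ (x - s • o.src e))) := by
          simp only [Finset.mul_sum]
          rw [Finset.sum_comm]
          refine Finset.sum_congr rfl fun l _ => ?_
          rw [← Finset.sum_sub_distrib, Finset.mul_sum]
          exact Finset.sum_congr rfl fun e _ => by ring
      _ = _ := by simp only [hB, sub_zero]

end Cone

/-! ### Uniform geometry of a mesoscopic lattice -/

section Geometry

variable (Λ : MesoscopicLattice)

/-- The translations preserving the graph form a group containing the period lattice, and the
lattice translation by minus the integer part moves any point into a fundamental cell. -/
theorem exists_translation_to_ball : ∃ r : ℝ, 0 ≤ r ∧ ∀ x : E3, ∃ z : E3, ‖z + x‖ ≤ r ∧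
    (∀ v, z + v ∈ Λ.verts ↔ v ∈ Λ.verts) ∧
    ∀ v w, Λ.graph.Adj (z + v) (z + w) ↔ Λ.graph.Adj v w := by
  obtain ⟨a, ha⟩ := Λ.periodic
  let H : AddSubgroup E3 :=
    { carrier := {z | (∀ v, z + v ∈ Λ.verts ↔ v ∈ Λ.verts) ∧
        ∀ v w, Λ.graph.Adj (z + v) (z + w) ↔ Λ.graph.Adj v w}
      zero_mem' := by simp
      add_mem' := by
        rintro y z ⟨h1, h2⟩ ⟨h3, h4⟩
        exact ⟨fun v => by rw [add_assoc, h1, h3], fun v w => by rw [add_assoc, add_assoc, h2, h4]⟩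
      neg_mem' := by
        rintro z ⟨h1, h2⟩
        exact ⟨fun v => by rw [← h1 (-z + v), add_neg_cancel_left],
          fun v w => by rw [← h2 (-z + v), add_neg_cancel_left, add_neg_cancel_left]⟩ }
  have hH : Submodule.span ℤ (Set.range a) ≤ H.toIntSubmodule := by
    rw [Submodule.span_le]
    rintro _ ⟨k, rfl⟩
    exact ha k
  refine ⟨∑ i, ‖a i‖, Finset.sum_nonneg fun _ _ => norm_nonneg _, fun x => ?_⟩
  have hz : -(ZSpan.floor a x : E3) ∈ H := H.neg_mem (hH (ZSpan.floor a x).2)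
  refine ⟨-(ZSpan.floor a x : E3), ?_, hz⟩
  have := ZSpan.norm_fract_le (K := ℝ) a x
  rwa [ZSpan.fract_apply, sub_eq_neg_add] at this

/-- Up to symmetry every edge starts in a fixed ball, which contains finitely many vertices, each of
finite degree. -/
theorem exists_edge_length_le : ∃ L : ℝ, 0 ≤ L ∧ ∀ x y, Λ.graph.Adj x y → ‖y - x‖ ≤ L := by
  obtain ⟨r, hr, h⟩ := exists_translation_to_ball Λ
  obtain ⟨M, hM⟩ := Λ.boundedDegree
  have hfin : (⋃ x ∈ Λ.verts ∩ Metric.closedBall 0 r,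
      (fun y => ‖y - x‖) '' Λ.graph.neighborSet x).Finite := by
    refine (Λ.locallyFinite r).biUnion fun x _ => Set.Finite.image _ ?_
    exact Set.encard_lt_top_iff.1 ((hM x).trans_lt (ENat.natCast_lt_top M))
  obtain ⟨L, hL⟩ := hfin.bddAbove
  refine ⟨max L 0, le_max_right _ _, fun x y hxy => ?_⟩
  obtain ⟨z, hz, hv, ha⟩ := h x
  refine (hL ?_).trans (le_max_left _ _)
  simp only [Set.mem_iUnion]
  refine ⟨z + x, ⟨(hv x).2 (Λ.mem_verts_of_adj _ _ hxy), by simpa using hz⟩, z + y,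
    (ha x y).2 hxy, by simp⟩

/-- After a translation the sources lie in a fixed finite set of vertices, and each of them belongs
to at most M edges. -/
theorem exists_card_edges_near_le (R : ℝ) : ∃ N : ℕ, ∀ (o : CountingDirection Λ)
    (E : Finset Λ.Edge) (x : E3) (S : Finset E), (∀ e ∈ S, ‖x - o.src e‖ ≤ R) → S.card ≤ N := by
  classical
  obtain ⟨r, hr, h⟩ := exists_translation_to_ball Λ
  obtain ⟨M, hM⟩ := Λ.boundedDegree
  have hfin := Λ.locallyFinite (r + R)
  refine ⟨M * hfin.toFinset.card, fun o E x S hS => ?_⟩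
  obtain ⟨z, hz, hv, -⟩ := h x
  refine Finset.card_le_mul_card_image_of_maps_to (f := fun e : E => z + o.src e)
    (fun e he => ?_) M fun v _ => ?_
  · rw [Set.Finite.mem_toFinset]
    refine ⟨(hv _).2 (Λ.mem_verts_of_adj _ (o.tgt e) ?_), ?_⟩
    · rw [← SimpleGraph.mem_edgeSet, o.mk_src_tgt]
      exact (e : Λ.Edge).2
    · have h1 : z + o.src e = (z + x) - (x - o.src e) := by abel
      rw [mem_closedBall_zero_iff, h1]
      exact (norm_sub_le _ _).trans (add_le_add hz (hS e he))
  · rw [← Finset.card_map (Function.Embedding.subtype _)]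
    refine card_edges_at_le hM (v - z) _ fun f hf => ?_
    obtain ⟨e, he, rfl⟩ := Finset.mem_map.1 hf
    have h1 : z + o.src e = v := (Finset.mem_filter.1 he).2
    rw [← h1, add_sub_cancel_left]
    exact src_mem o e

end Geometry

/-! ### A uniform bound for the Burgers vector densities -/

section Bounds

variable {Λ : MesoscopicLattice}

theorem norm_sub_edgePoint_le {o : CountingDirection Λ} {e : Λ.Edge} {L : ℝ}
    (hL : ‖o.tgt e - o.src e‖ ≤ L) {t : ℝ} (ht : t ∈ Set.Icc (0 : ℝ) 1) :
    ‖edgePoint o e t - o.src e‖ ≤ L := by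
  rw [edgePoint, add_sub_cancel_left, norm_smul, Real.norm_eq_abs, abs_of_nonneg ht.1]
  exact (mul_le_of_le_one_left (norm_nonneg _) ht.2).trans hL

theorem CountingDirection.adj (o : CountingDirection Λ) (e : Λ.Edge) :
    Λ.graph.Adj (o.src e) (o.tgt e) := by
  rw [← SimpleGraph.mem_edgeSet, o.mk_src_tgt]
  exact e.2

theorem integrable_sq_of_hasCompactSupport {g : E3 → ℝ} (hg : Continuous g)
    (hc : HasCompactSupport g) : Integrable fun x => g x ^ 2 := by
  simp only [sq]
  exact (hg.mul hg).integrable_of_hasCompactSupport hc.mul_right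

/-- Sums of smeared edges are almost orthogonal in `L²`. -/
theorem exists_integral_sum_smear_sq_le (Λ : MesoscopicLattice) {f : E3 → ℝ} (hf : ContDiff ℝ ∞ f)
    (hc : HasCompactSupport f) : ∃ A : ℝ, 0 ≤ A ∧ ∀ (o : CountingDirection Λ) (E : Finset Λ.Edge)
      (r : E → ℝ), ∫ x, (∑ e, r e * smear f (edgeMeasure o e) x) ^ 2 ≤ A * ∑ e, r e ^ 2 := by
  classical
  obtain ⟨L, hL0, hL⟩ := exists_edge_length_le Λ
  obtain ⟨C, hC⟩ := hf.continuous.bounded_above_of_compact_support hc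
  have hC0 : 0 ≤ C := (norm_nonneg _).trans (hC 0)
  obtain ⟨R, hR⟩ := hc.isCompact.isBounded.subset_closedBall 0
  obtain ⟨N, hN⟩ := exists_card_edges_near_le Λ (R + L)
  set V : ℝ := (volume (Metric.closedBall (0 : E3) (R + L))).toReal
  refine ⟨N * ((L * C) ^ 2 * V), by positivity, fun o E r => ?_⟩
  have hbd : ∀ (e : Λ.Edge) x, |smear f (edgeMeasure o e) x| ≤ L * C := by
    intro e x
    rw [smear_edgeMeasure o hf.continuous, abs_mul, abs_norm]
    refine mul_le_mul (hL _ _ (o.adj e)) ?_ (abs_nonneg _) hL0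
    have := intervalIntegral.norm_integral_le_of_norm_le_const (a := (0 : ℝ)) (b := 1)
      (f := fun t => f (x - edgePoint o e t)) (C := C) fun t _ => hC _
    simpa using this
  have hsupp : ∀ (e : Λ.Edge) x, R + L < ‖x - o.src e‖ → smear f (edgeMeasure o e) x = 0 := by
    intro e x hx
    rw [smear_edgeMeasure o hf.continuous]
    have : ∫ t in (0 : ℝ)..1, f (x - edgePoint o e t) = ∫ _t in (0 : ℝ)..1, (0 : ℝ) := by
      refine intervalIntegral.integral_congr fun t ht => ?_
      rw [Set.uIcc_of_le zero_le_one] at ht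
      refine image_eq_zero_of_notMem_tsupport fun hmem => ?_
      have h1 : ‖x - edgePoint o e t‖ ≤ R := by simpa using hR hmem
      have h2 := norm_sub_edgePoint_le (hL _ _ (o.adj e)) ht
      have h3 := norm_add_le (x - edgePoint o e t) (edgePoint o e t - o.src e)
      rw [sub_add_sub_cancel] at h3
      linarith
    rw [this]
    simp
  -- At each point at most N smeared edges are nonzero, so Cauchy–Schwarz costs only the factor N,
  -- whatever the size of E.
  have hpt : ∀ x, (∑ e, r e * smear f (edgeMeasure o e) x) ^ 2
      ≤ N * ∑ e : E, r e ^ 2 *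
        (Metric.closedBall (o.src e) (R + L)).indicator (fun _ => (L * C) ^ 2) x := by
    intro x
    set S : Finset E := Finset.univ.filter fun e => ‖x - o.src e‖ ≤ R + L
    have h1 : ∑ e, r e * smear f (edgeMeasure o e) x
        = ∑ e ∈ S, r e * smear f (edgeMeasure o e) x := by
      refine (Finset.sum_subset (Finset.subset_univ S) fun e _ he => ?_).symm
      rw [hsupp e x, mul_zero]
      simpa [S] using he
    have h2 : S.card ≤ N := hN o E x S fun e he => (Finset.mem_filter.1 he).2
    rw [h1]
    refine sq_sum_le_card_mul_sum_sq.trans ?_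
    refine mul_le_mul (by exact_mod_cast h2) ?_ (Finset.sum_nonneg fun _ _ => sq_nonneg _)
      (Nat.cast_nonneg N)
    calc ∑ e ∈ S, (r e * smear f (edgeMeasure o e) x) ^ 2
        ≤ ∑ e ∈ S, r e ^ 2 *
          (Metric.closedBall (o.src e) (R + L)).indicator (fun _ => (L * C) ^ 2) x := by
          refine Finset.sum_le_sum fun e he => ?_
          have hmem : x ∈ Metric.closedBall (o.src e) (R + L) := by
            rw [Metric.mem_closedBall, dist_eq_norm]
            exact (Finset.mem_filter.1 he).2
          rw [mul_pow, Set.indicator_of_mem hmem]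
          refine mul_le_mul_of_nonneg_left ?_ (sq_nonneg _)
          exact sq_le_sq' (by linarith [(abs_le.1 (hbd e x)).1]) (abs_le.1 (hbd e x)).2
      _ ≤ _ := Finset.sum_le_sum_of_subset_of_nonneg (Finset.subset_univ S) fun e _ _ =>
          mul_nonneg (sq_nonneg _) (Set.indicator_nonneg (fun _ _ => by positivity) _)
  have hind : ∀ e : E, Integrable ((Metric.closedBall (o.src e) (R + L)).indicator
      fun _ => (L * C) ^ 2) := fun e =>
    (integrable_indicator_iff measurableSet_closedBall).2
      (integrableOn_const (isCompact_closedBall _ _).measure_lt_top.ne)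
  have hcs : ∀ e : E, HasCompactSupport (smear f (edgeMeasure o e)) := fun e =>
    hasCompactSupport_smear hc (isCompact_Icc.image (continuous_edgePoint o e))
      (edgeMeasure_compl o e)
  have hleft : Integrable fun x => (∑ e, r e * smear f (edgeMeasure o e) x) ^ 2 := by
    have hcont : Continuous fun x => ∑ e, r e * smear f (edgeMeasure o e) x :=
      continuous_finsetSum _ fun e _ => continuous_const.mul (contDiff_smear hf hc).continuous
    have hsup : HasCompactSupport fun x => ∑ e, r e * smear f (edgeMeasure o e) x :=
      hasCompactSupport_sum _ fun e _ => (hcs e).mul_left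
    exact integrable_sq_of_hasCompactSupport hcont hsup
  have hright := (integrable_finsetSum (Finset.univ : Finset E) fun e _ =>
    (hind e).const_mul (r e ^ 2)).const_mul (N : ℝ)
  refine (integral_mono hleft hright hpt).trans_eq ?_
  have hvol : ∀ e : E, ∫ x, r e ^ 2 *
      (Metric.closedBall (o.src e) (R + L)).indicator (fun _ => (L * C) ^ 2) x
      = (L * C) ^ 2 * V * r e ^ 2 := by
    intro e
    have hV : volume.real (Metric.closedBall (o.src e) (R + L)) = V := by
      rw [measureReal_def, Measure.addHaar_closedBall_center]
    rw [integral_const_mul, integral_indicator measurableSet_closedBall, setIntegral_const,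
      hV, smul_eq_mul]
    ring
  rw [integral_const_mul, integral_finsetSum _ fun e _ => (hind e).const_mul _,
    Finset.sum_congr rfl fun e _ => hvol e, ← Finset.mul_sum]
  ring

theorem abs_leviCivita_le (i j l : Fin 3) : |leviCivita i j l| ≤ 1 := by
  unfold leviCivita
  fin_cases i <;> fin_cases j <;> fin_cases l <;> simp [Matrix.det_fin_three]

theorem abs_unitVec_le (o : CountingDirection Λ) (e : Λ.Edge) (l : Fin 3) :
    |unitVec o e l| ≤ 1 := by
  refine (abs_coord_le_norm _ l).trans ?_
  rw [unitVec, norm_smul, norm_inv, norm_norm]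
  exact inv_mul_le_one

theorem burgers_eq_sum (o : CountingDirection Λ) (φ : E3 → ℝ) {E : Finset Λ.Edge} (I : E → E3)
    (x : E3) (i j k : Fin 3) : burgers o φ I x i j k
      = ∑ e : E, (∑ l, leviCivita i j l * unitVec o e l) * I e k
        * smear φ (edgeMeasure o e) x := by
  simp only [burgers, smoothedCurrent_apply, Finset.mul_sum, Finset.sum_mul]
  rw [Finset.sum_comm]
  exact Finset.sum_congr rfl fun e _ => Finset.sum_congr rfl fun l _ => by ring

/-- Plancherel's theorem for b and its first derivatives. The factor 27 is the number of components
in Cauchy–Schwarz; the factor (2π)² from differentiation is at least 1. -/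
theorem IsBurgersField.integral_weight_mul_tensorSize_sq_le {b : TensorField}
    (hb : IsBurgersField b) :
    ∫ ξ, (1 + ‖ξ‖ ^ 2) * tensorSize (tensorFourier b ξ) ^ 2
      ≤ 27 * ∑ i, ∑ j, ∑ k, ((∫ x, b x i j k ^ 2)
        + ∑ m, ∫ x, partialDeriv m (fun x => b x i j k) x ^ 2) := by
  have hp : ∀ i j k, IsFourierPair (fun x => b x i j k) (realFourier fun x => b x i j k) :=
    fun i j k => isFourierPair_realFourier (hb.smooth i j k) (hb.compactSupport i j k)
  have hpm : ∀ i j k m, IsFourierPair (partialDeriv m fun x => b x i j k)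
      (realFourier (partialDeriv m fun x => b x i j k)) := fun i j k m =>
    isFourierPair_realFourier (contDiff_partialDeriv (hb.smooth i j k) m)
      (hasCompactSupport_partialDeriv (hb.compactSupport i j k) m)
  have hsq : ∀ {g : E3 → ℂ}, MemLp g 2 → Integrable fun ξ => ‖g ξ‖ ^ 2 := fun hg =>
    (memLp_two_iff_integrable_sq_norm hg.aestronglyMeasurable).1 hg
  have hG : ∀ i j k, Integrable fun ξ => ‖realFourier (fun x => b x i j k) ξ‖ ^ 2
      + ∑ m, ‖realFourier (partialDeriv m fun x => b x i j k) ξ‖ ^ 2 := fun i j k =>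
    (hsq (hp i j k).memLp).add (integrable_finsetSum _ fun m _ => hsq (hpm i j k m).memLp)
  have hpt : ∀ ξ, (1 + ‖ξ‖ ^ 2) * tensorSize (tensorFourier b ξ) ^ 2
      ≤ 27 * ∑ i, ∑ j, ∑ k, (‖realFourier (fun x => b x i j k) ξ‖ ^ 2
      + ∑ m, ‖realFourier (partialDeriv m fun x => b x i j k) ξ‖ ^ 2) := by
    intro ξ
    have h1 : tensorSize (tensorFourier b ξ) ^ 2
        ≤ 27 * ∑ i, ∑ j, ∑ k, ‖realFourier (fun x => b x i j k) ξ‖ ^ 2 := by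
      have := sq_sum_le_card_mul_sum_sq (s := (Finset.univ : Finset (Fin 3 × Fin 3 × Fin 3)))
        (f := fun a => ‖realFourier (fun x => b x a.1 a.2.1 a.2.2) ξ‖)
      simp only [Fintype.sum_prod_type] at this
      simpa [tensorSize, tensorFourier] using this
    have h2 : ∀ i j k, (1 + ‖ξ‖ ^ 2) * ‖realFourier (fun x => b x i j k) ξ‖ ^ 2
        ≤ ‖realFourier (fun x => b x i j k) ξ‖ ^ 2
          + ∑ m, ‖realFourier (partialDeriv m fun x => b x i j k) ξ‖ ^ 2 := by
      intro i j k
      have h3 : ∑ m, ‖realFourier (partialDeriv m fun x => b x i j k) ξ‖ ^ 2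
          = (2 * Real.pi) ^ 2 * (‖ξ‖ ^ 2 * ‖realFourier (fun x => b x i j k) ξ‖ ^ 2) := by
        rw [normSq_sum_three, Fin.sum_univ_three]
        simp only [realFourier_partialDeriv (hb.smooth i j k) (hb.compactSupport i j k), norm_mul,
          Complex.norm_real, Complex.norm_I, Complex.norm_ofNat, mul_pow, Real.norm_eq_abs, sq_abs]
        ring
      have h4 : (1 : ℝ) ≤ (2 * Real.pi) ^ 2 := by nlinarith [Real.pi_gt_three]
      have h5 : 0 ≤ ‖ξ‖ ^ 2 * ‖realFourier (fun x => b x i j k) ξ‖ ^ 2 := by positivity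
      rw [h3]
      nlinarith
    calc _ ≤ (1 + ‖ξ‖ ^ 2) * (27 * ∑ i, ∑ j, ∑ k, ‖realFourier (fun x => b x i j k) ξ‖ ^ 2) := by
          gcongr
      _ = 27 * ∑ i, ∑ j, ∑ k, (1 + ‖ξ‖ ^ 2) * ‖realFourier (fun x => b x i j k) ξ‖ ^ 2 := by
          simp only [Finset.mul_sum]
          exact Finset.sum_congr rfl fun i _ => Finset.sum_congr rfl fun j _ =>
            Finset.sum_congr rfl fun k _ => by ring
      _ ≤ _ := by
          gcongr with i _ j _ k _
          exact h2 i j k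
  have hGs := integrable_finsetSum Finset.univ fun i _ => integrable_finsetSum Finset.univ
    fun j _ => integrable_finsetSum Finset.univ fun k _ => hG i j k
  refine (integral_mono hb.integrable_weight_mul_tensorSize_sq (hGs.const_mul 27) hpt).trans_eq ?_
  rw [integral_const_mul, integral_finsetSum _ fun i _ => integrable_finsetSum Finset.univ
    fun j _ => integrable_finsetSum Finset.univ fun k _ => hG i j k]
  congr 1
  refine Finset.sum_congr rfl fun i _ => ?_
  rw [integral_finsetSum _ fun j _ => integrable_finsetSum Finset.univ fun k _ => hG i j k]
  refine Finset.sum_congr rfl fun j _ => ?_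
  rw [integral_finsetSum _ fun k _ => hG i j k]
  refine Finset.sum_congr rfl fun k _ => ?_
  rw [integral_add (hsq (hp i j k).memLp) (integrable_finsetSum _ fun m _ =>
    hsq (hpm i j k m).memLp), integral_finsetSum _ fun m _ => hsq (hpm i j k m).memLp,
    (hp i j k).integral_sq]
  congr 1
  exact Finset.sum_congr rfl fun m _ => ((hpm i j k m).integral_sq).symm

/-- The Sobolev norm of the Burgers vector density is controlled by the `ℓ²` norm of the current,
uniformly in the finite set of edges. -/
theorem exists_burgers_bound (Λ : MesoscopicLattice) {φ : E3 → ℝ} (hφ : ContDiff ℝ ∞ φ)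
    (hc : HasCompactSupport φ) : ∃ B : ℝ, 0 < B ∧ ∀ (o : CountingDirection Λ) (E : Finset Λ.Edge)
      (I : E → E3), ∫ ξ, (1 + ‖ξ‖ ^ 2) * tensorSize (tensorFourier (burgers o φ I) ξ) ^ 2
        ≤ B * ∑ e : E, ∑ k, I e k ^ 2 := by
  obtain ⟨A₀, hA₀, h₀⟩ := exists_integral_sum_smear_sq_le Λ hφ hc
  choose A₁ hA₁ h₁ using fun m => exists_integral_sum_smear_sq_le Λ (contDiff_partialDeriv hφ m)
    (hasCompactSupport_partialDeriv hc m)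
  set A := A₀ + ∑ m, A₁ m
  have hA : 0 ≤ A := add_nonneg hA₀ (Finset.sum_nonneg fun m _ => hA₁ m)
  -- One 9 squares the bound 3 on the contraction of ε_{ijl} with the unit vector, the other counts
  -- the pairs (i, j); adding 1 makes the constant strictly positive.
  refine ⟨27 * (9 * (9 * A)) + 1, by positivity, fun o E I => ?_⟩
  refine (isBurgersField_burgers o hφ hc I).integral_weight_mul_tensorSize_sq_le.trans ?_
  set r : Fin 3 → Fin 3 → Fin 3 → E → ℝ := fun i j k e =>
    (∑ l, leviCivita i j l * unitVec o e l) * I e k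
  have hpd : ∀ i j k m x, partialDeriv m (fun x => burgers o φ I x i j k) x
      = ∑ e, r i j k e * smear (partialDeriv m φ) (edgeMeasure o e) x := by
    intro i j k m x
    simp only [burgers_eq_sum]
    have hdiff : ∀ e : E, DifferentiableAt ℝ (smear φ (edgeMeasure o e)) x := fun e =>
      (contDiff_smear hφ hc).differentiable (by simp) x
    rw [partialDeriv, fderiv_fun_sum fun e _ => (hdiff e).const_mul _, sum_apply]
    refine Finset.sum_congr rfl fun e _ => ?_
    rw [fderiv_const_mul (hdiff e), smul_apply, smul_eq_mul, ← partialDeriv_smear hφ hc]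
    rfl
  have hr : ∀ i j k e, r i j k e ^ 2 ≤ 9 * I e k ^ 2 := by
    intro i j k e
    have h1 : |∑ l, leviCivita i j l * unitVec o e l| ≤ 3 := by
      refine (Finset.abs_sum_le_sum_abs _ _).trans ?_
      calc ∑ l, |leviCivita i j l * unitVec o e l| ≤ ∑ _l : Fin 3, (1 : ℝ) := by
            refine Finset.sum_le_sum fun l _ => ?_
            rw [abs_mul]
            exact mul_le_one₀ (abs_leviCivita_le i j l) (abs_nonneg _) (abs_unitVec_le o e l)
        _ = 3 := by simp
    have h2 : (∑ l, leviCivita i j l * unitVec o e l) ^ 2 ≤ 9 := by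
      rw [← sq_abs]
      nlinarith [abs_nonneg (∑ l, leviCivita i j l * unitVec o e l)]
    rw [mul_pow]
    exact mul_le_mul_of_nonneg_right h2 (sq_nonneg _)
  have hterm : ∀ i j k, (∫ x, burgers o φ I x i j k ^ 2)
      + ∑ m, ∫ x, partialDeriv m (fun x => burgers o φ I x i j k) x ^ 2
      ≤ 9 * A * ∑ e : E, I e k ^ 2 := by
    intro i j k
    have hsum : ∑ e, r i j k e ^ 2 ≤ 9 * ∑ e : E, I e k ^ 2 := by
      rw [Finset.mul_sum]
      exact Finset.sum_le_sum fun e _ => hr i j k e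
    simp only [hpd]
    have e0 : ∫ x, burgers o φ I x i j k ^ 2 ≤ A₀ * ∑ e, r i j k e ^ 2 := by
      simp only [burgers_eq_sum]
      exact h₀ o E (r i j k)
    calc _ ≤ A₀ * ∑ e, r i j k e ^ 2 + ∑ m, A₁ m * ∑ e, r i j k e ^ 2 :=
          add_le_add e0 (Finset.sum_le_sum fun m _ => h₁ m o E (r i j k))
      _ = A * ∑ e, r i j k e ^ 2 := by rw [← Finset.sum_mul, ← add_mul]
      _ ≤ A * (9 * ∑ e : E, I e k ^ 2) := mul_le_mul_of_nonneg_left hsum hA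
      _ = _ := by ring
  have hS : 0 ≤ ∑ e : E, ∑ k, I e k ^ 2 :=
    Finset.sum_nonneg fun _ _ => Finset.sum_nonneg fun _ _ => sq_nonneg _
  calc _ ≤ 27 * ∑ _i : Fin 3, ∑ _j : Fin 3, ∑ k, 9 * A * ∑ e : E, I e k ^ 2 := by
        gcongr with i _ j _ k _
        exact hterm i j k
    _ = 27 * (9 * (9 * A)) * ∑ e : E, ∑ k, I e k ^ 2 := by
        rw [Finset.sum_comm (s := (Finset.univ : Finset E)), ← Finset.mul_sum]
        simp
        ring
    _ ≤ _ := by linarith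

end Bounds

/-! ### Dependence of the minimizer on the current -/

section Linearity

variable {Λ : MesoscopicLattice} {E : Finset Λ.Edge} (o : CountingDirection Λ) (φ : E3 → ℝ)

open Classical in
/-- The field on one edge with one nonzero component. -/
def unitCurrent (a : E × Fin 3) : E → E3 := Pi.single a.1 (EuclideanSpace.single a.2 1)

theorem sum_unitCurrent (I : E → E3) (e : E) (k : Fin 3) :
    ∑ a : E × Fin 3, I a.1 a.2 * unitCurrent a e k = I e k := by
  classical
  rw [Fintype.sum_eq_single (e, k)]
  · simp [unitCurrent]
  · rintro ⟨f, l⟩ hne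
    by_cases hf : f = e
    · subst hf
      have : l ≠ k := fun h => hne (by rw [h])
      simp [unitCurrent, this.symm]
    · have : e ≠ f := fun h => hf h.symm
      simp [unitCurrent, this]

theorem burgers_eq_sum_unitCurrent (I : E → E3) (x : E3) (i j k : Fin 3) :
    burgers o φ I x i j k
      = ∑ a : E × Fin 3, I a.1 a.2 * burgers o φ (unitCurrent a) x i j k := by
  simp only [burgers_eq_sum, Finset.mul_sum]
  rw [Finset.sum_comm]
  refine Finset.sum_congr rfl fun e _ => ?_
  rw [← sum_unitCurrent I e k, Finset.mul_sum, Finset.sum_mul]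
  exact Finset.sum_congr rfl fun a _ => by ring

theorem realFourier_finset_sum {ι : Type*} (s : Finset ι) (r : ι → ℝ) {f : ι → E3 → ℝ}
    (hf : ∀ a, Integrable (f a)) (ξ : E3) :
    realFourier (fun x => ∑ a ∈ s, r a * f a x) ξ = ∑ a ∈ s, (r a : ℂ) * realFourier (f a) ξ := by
  classical
  induction s using Finset.induction_on with
  | empty =>
    have := realFourier_const_mul 0 (fun _ => (0 : ℝ)) ξ
    simpa using this
  | insert a s ha ih =>
    simp only [Finset.sum_insert ha]
    rw [realFourier_add ((hf a).const_mul _) (integrable_finsetSum _ fun b _ =>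
      (hf b).const_mul _), realFourier_const_mul, ih]

/-- The choice r = 1/(2B) lets the quadratic term absorb only half of the linear one. -/
theorem sq_sum_le_of_linear_bound {S W B : ℝ} (hB : 0 < B)
    (h : ∀ r : ℝ, r * S ≤ W + B * (r ^ 2 * S)) : S ≤ 4 * B * W := by
  have h1 := h (2 * B)⁻¹
  have h2 : (2 * B)⁻¹ * S = 2 * (B * ((2 * B)⁻¹ ^ 2 * S)) := by field_simp
  have h3 : (2 * B)⁻¹ * S ≤ 2 * W := by linarith
  rw [inv_mul_le_iff₀ (by positivity)] at h3
  linarith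

variable {φ} (hφ : ContDiff ℝ ∞ φ) (hc : HasCompactSupport φ)
include hφ hc

theorem minimizerFourier_eq_sum (κ : ℝ) (I : E → E3) (i j : Fin 3) (ξ : E3) :
    minimizerFourier κ (burgers o φ I) i j ξ = ∑ a : E × Fin 3, (I a.1 a.2 : ℂ) *
      minimizerFourier κ (burgers o φ (unitCurrent a)) i j ξ := by
  rw [minimizerFourier]
  simp only [minimizerFourier]
  rw [← minimizerSymbol_sum]
  congr 1
  funext i j k
  have hb := fun a : E × Fin 3 => isBurgersField_burgers o hφ hc (unitCurrent a)
  simp only [tensorFourier]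
  rw [← realFourier_finset_sum _ (fun a : E × Fin 3 => I a.1 a.2) fun a =>
    ((hb a).smooth i j k).continuous.integrable_of_hasCompactSupport ((hb a).compactSupport i j k)]
  congr 1
  funext x
  exact burgers_eq_sum_unitCurrent o φ I x i j k

theorem minimizerField_eq_sum {κ : ℝ} (hκ : |κ| ≤ 1) (I : E → E3) (x : E3) (i j : Fin 3) :
    minimizerField κ (burgers o φ I) x i j = ∑ a : E × Fin 3, I a.1 a.2 *
      minimizerField κ (burgers o φ (unitCurrent a)) x i j := by
  have hb := fun I : E → E3 => isBurgersField_burgers o hφ hc I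
  have p := (hb I).isFourierPair_minimizer hκ i j
  have ps := IsFourierPair.finset_sum Finset.univ fun a : E × Fin 3 =>
    ((hb (unitCurrent a)).isFourierPair_minimizer hκ i j).const_mul (I a.1 a.2)
  have h : minimizerFourier κ (burgers o φ I) i j = fun ξ => ∑ a : E × Fin 3, (I a.1 a.2 : ℂ) *
      minimizerFourier κ (burgers o φ (unitCurrent a)) i j ξ :=
    funext (minimizerFourier_eq_sum o hφ hc κ I i j)
  have h1 := p.eq x
  rw [h, ← ps.eq x] at h1
  exact_mod_cast h1

/-- The coefficients of the observable. -/
def observableCoeff (φ : E3 → ℝ) (κ : ℝ) (x y : E3) (i j : Fin 3) (a : E × Fin 3) : ℝ :=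
  minimizerField κ (burgers o φ (unitCurrent a)) x i j
    - minimizerField κ (burgers o φ (unitCurrent a)) y i j

theorem realPairing_observableCoeff {κ : ℝ} (hκ : |κ| ≤ 1) (I : E → E3) (x y : E3) (i j : Fin 3) :
    realPairing (observableCoeff o φ κ x y i j) I
      = minimizerField κ (burgers o φ I) x i j - minimizerField κ (burgers o φ I) y i j := by
  rw [minimizerField_eq_sum o hφ hc hκ, minimizerField_eq_sum o hφ hc hκ,
    ← Finset.sum_sub_distrib, realPairing]
  exact Finset.sum_congr rfl fun a _ => by rw [observableCoeff]; ring

/-- The square sum of the coefficients is bounded uniformly in the finite set of edges. -/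
theorem exists_sum_observableCoeff_sq_le (Λ : MesoscopicLattice) :
    ∃ B : ℝ, 0 ≤ B ∧ ∀ (o : CountingDirection Λ) (E : Finset Λ.Edge) (κ : ℝ), |κ| ≤ 1 →
      ∀ (x y : E3) (i j : Fin 3),
        ∑ a : E × Fin 3, observableCoeff o φ κ x y i j a ^ 2 ≤ B := by
  obtain ⟨B, hB, hbound⟩ := exists_burgers_bound Λ hφ hc
  set W := ∫ ξ : E3, (‖ξ‖ ^ 2 * (1 + ‖ξ‖ ^ 2))⁻¹ with hW
  have hW0 : 0 ≤ W := integral_nonneg fun ξ => by positivity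
  -- Each of the values at x and y is bounded with the constant 7/2, which gives 7W and 7B in the
  -- absorption lemma.
  refine ⟨4 * (7 * B) * (7 * W), by positivity, fun o E κ hκ x y i j => ?_⟩
  set σ := observableCoeff (E := E) o φ κ x y i j
  refine sq_sum_le_of_linear_bound (by positivity) fun r => ?_
  -- Self-dual test: the coefficient vector itself serves as current. It need not be lattice valued
  -- or satisfy Kirchhoff's law, because the Fourier formula for the field makes sense for every I.
  set I : E → E3 := fun e => WithLp.toLp 2 fun k => r * σ (e, k)
  have h1 : realPairing σ I = r * ∑ a, σ a ^ 2 := by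
    rw [realPairing, Finset.mul_sum]
    exact Finset.sum_congr rfl fun a _ => by simp only [I]; ring
  have h2 : ∑ e : E, ∑ k, I e k ^ 2 = r ^ 2 * ∑ a, σ a ^ 2 := by
    rw [Fintype.sum_prod_type, Finset.mul_sum]
    refine Finset.sum_congr rfl fun e _ => ?_
    rw [Finset.mul_sum]
    exact Finset.sum_congr rfl fun k _ => by simp only [I]; ring
  have hb := isBurgersField_burgers o hφ hc I
  have h3 := hb.integral_norm_minimizerFourier_le hκ i j
  have h4 := hbound o E I
  rw [h2] at h4
  have hx := (hb.isFourierPair_minimizer hκ i j).abs_le x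
  have hy := (hb.isFourierPair_minimizer hκ i j).abs_le y
  rw [← h1, realPairing_observableCoeff o hφ hc hκ]
  have h5 := le_abs_self (minimizerField κ (burgers o φ I) x i j)
  have h6 := neg_abs_le (minimizerField κ (burgers o φ I) y i j)
  linarith

end Linearity

/-! ### The quadratic form of the minimal elastic energy -/

section EnergyForm

/-- The polarization of `complexForm`. -/
def complexBilin (lam mu : ℝ) (U V : Matrix (Fin 3) (Fin 3) ℂ) : ℝ :=
  2 * lam * (U.trace.re * V.trace.re + U.trace.im * V.trace.im) +
    mu * ∑ i, ∑ j, ((U i j + U j i).re * (V i j + V j i).re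
      + (U i j + U j i).im * (V i j + V j i).im)

theorem complexBilin_comm (lam mu : ℝ) (U V : Matrix (Fin 3) (Fin 3) ℂ) :
    complexBilin lam mu U V = complexBilin lam mu V U := by
  simp only [complexBilin, mul_comm]

/-- Polarization reduces integrability of the bilinear form to that of the quadratic form. -/
theorem complexBilin_eq (lam mu : ℝ) (U V : Matrix (Fin 3) (Fin 3) ℂ) :
    complexBilin lam mu U V
      = 1 / 2 * (complexForm lam mu (U + V) - complexForm lam mu U - complexForm lam mu V) := by
  simp only [complexBilin, complexForm, complex_norm_sq, Matrix.trace, Matrix.diag,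
    Fin.sum_univ_three, Matrix.add_apply, Complex.add_re, Complex.add_im, Complex.mul_re,
    Complex.mul_im, Complex.re_ofNat, Complex.im_ofNat]
  ring

theorem norm_sq_sum_ofReal_mul {ι : Type*} (s : Finset ι) (r : ι → ℝ) (z : ι → ℂ) :
    ‖∑ a ∈ s, (r a : ℂ) * z a‖ ^ 2
      = ∑ a ∈ s, ∑ c ∈ s, r a * ((z a).re * (z c).re + (z a).im * (z c).im) * r c := by
  rw [complex_norm_sq, Complex.re_sum, Complex.im_sum, sq, sq, Finset.sum_mul_sum,
    Finset.sum_mul_sum, ← Finset.sum_add_distrib]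
  refine Finset.sum_congr rfl fun a _ => ?_
  rw [← Finset.sum_add_distrib]
  refine Finset.sum_congr rfl fun c _ => ?_
  simp only [Complex.re_ofReal_mul, Complex.im_ofReal_mul]
  ring

theorem complexForm_sum {ι : Type*} (s : Finset ι) (lam mu : ℝ) (r : ι → ℝ)
    (U : ι → Matrix (Fin 3) (Fin 3) ℂ) :
    complexForm lam mu (Matrix.of fun i j => ∑ a ∈ s, (r a : ℂ) * U a i j)
      = ∑ a ∈ s, ∑ c ∈ s, r a * complexBilin lam mu (U a) (U c) * r c := by
  have htr : 2 * (Matrix.of fun i j => ∑ a ∈ s, (r a : ℂ) * U a i j).trace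
      = ∑ a ∈ s, (r a : ℂ) * (2 * (U a).trace) := by
    simp only [Matrix.trace, Matrix.diag, Matrix.of_apply, Finset.mul_sum]
    rw [Finset.sum_comm]
    exact Finset.sum_congr rfl fun a _ => Finset.sum_congr rfl fun i _ => by ring
  have hsym : ∀ i j, (∑ a ∈ s, (r a : ℂ) * U a i j) + ∑ a ∈ s, (r a : ℂ) * U a j i
      = ∑ a ∈ s, (r a : ℂ) * (U a i j + U a j i) := by
    intro i j
    rw [← Finset.sum_add_distrib]
    exact Finset.sum_congr rfl fun a _ => by ring
  rw [complexForm, htr]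
  simp only [Matrix.of_apply, hsym, norm_sq_sum_ofReal_mul]
  have hswap : ∑ i : Fin 3, ∑ j : Fin 3, ∑ a ∈ s, ∑ c ∈ s, r a *
      ((U a i j + U a j i).re * (U c i j + U c j i).re
        + (U a i j + U a j i).im * (U c i j + U c j i).im) * r c
      = ∑ a ∈ s, ∑ c ∈ s, r a * (∑ i : Fin 3, ∑ j : Fin 3,
      ((U a i j + U a j i).re * (U c i j + U c j i).re
        + (U a i j + U a j i).im * (U c i j + U c j i).im)) * r c := by
    simp only [Fin.sum_univ_three, ← Finset.sum_add_distrib]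
    exact Finset.sum_congr rfl fun a _ => Finset.sum_congr rfl fun c _ => by ring
  rw [hswap, Finset.mul_sum, Finset.mul_sum, ← Finset.sum_add_distrib]
  refine Finset.sum_congr rfl fun a _ => ?_
  rw [Finset.mul_sum, Finset.mul_sum, ← Finset.sum_add_distrib]
  refine Finset.sum_congr rfl fun c _ => ?_
  simp only [complexBilin, Complex.mul_re, Complex.mul_im, Complex.re_ofNat, Complex.im_ofNat]
  ring

variable {Λ : MesoscopicLattice} {E : Finset Λ.Edge} (o : CountingDirection Λ) (φ : E3 → ℝ)

/-- The Fourier transform of the minimizer belonging to one component on one edge. -/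
def unitFourier (κ : ℝ) (a : E × Fin 3) (ξ : E3) : Matrix (Fin 3) (Fin 3) ℂ :=
  Matrix.of fun i j => minimizerFourier κ (burgers o φ (unitCurrent a)) i j ξ

/-- The matrix of the minimal elastic energy. -/
def energyMatrix (lam mu : ℝ) : Matrix (E × Fin 3) (E × Fin 3) ℝ := Matrix.of fun a c =>
  ∫ ξ, complexBilin lam mu (unitFourier o φ (lam / (lam + 2 * mu)) a ξ)
    (unitFourier o φ (lam / (lam + 2 * mu)) c ξ)

variable {φ} (hφ : ContDiff ℝ ∞ φ) (hc : HasCompactSupport φ) {lam mu : ℝ} (hmu : 0 < mu)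
  (h : 0 < mu + 3 * lam / 2)
include hφ hc hmu h

theorem sum_mul_energyMatrix (r : E × Fin 3 → ℝ) :
    ∑ a, ∑ c, r a * energyMatrix o φ lam mu a c * r c
      = ∫ ξ, complexForm lam mu (Matrix.of fun i j => ∑ a : E × Fin 3, (r a : ℂ) *
        minimizerFourier (lam / (lam + 2 * mu)) (burgers o φ (unitCurrent a)) i j ξ) := by
  set κ := lam / (lam + 2 * mu) with hκdef
  have hκ : |κ| ≤ 1 := abs_lame_ratio_le hmu h
  have hL : ∀ (a : E × Fin 3) i j, MemLp (minimizerFourier κ (burgers o φ (unitCurrent a)) i j) 2 :=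
    fun a i j => (isBurgersField_burgers o hφ hc _).memLp_minimizerFourier hκ i j
  have hint : ∀ a c : E × Fin 3, Integrable fun ξ =>
      complexBilin lam mu (unitFourier o φ κ a ξ) (unitFourier o φ κ c ξ) := by
    intro a c
    simp only [complexBilin_eq]
    refine Integrable.const_mul ?_ _
    exact ((integrable_complexForm fun i j => (hL a i j).add (hL c i j)).sub
      (integrable_complexForm (hL a))).sub (integrable_complexForm (hL c))
  have hpt : ∀ ξ, complexForm lam mu (Matrix.of fun i j => ∑ a : E × Fin 3, (r a : ℂ) *
        minimizerFourier κ (burgers o φ (unitCurrent a)) i j ξ)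
      = ∑ a, ∑ c, r a * complexBilin lam mu (unitFourier o φ κ a ξ) (unitFourier o φ κ c ξ)
        * r c := fun ξ =>
    complexForm_sum Finset.univ lam mu r fun a => unitFourier o φ κ a ξ
  simp only [hpt]
  rw [integral_finsetSum _ fun a _ => integrable_finsetSum _ fun c _ =>
    ((hint a c).const_mul _).mul_const _]
  refine Finset.sum_congr rfl fun a _ => ?_
  rw [integral_finsetSum _ fun c _ => ((hint a c).const_mul _).mul_const _]
  refine Finset.sum_congr rfl fun c _ => ?_
  rw [integral_mul_const, integral_const_mul]
  rfl

/-- The quadratic form is an integral of nonnegative energy densities, even at vectors that violate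
Kirchhoff's law; the Gaussian mixture needs this on the whole space. -/
theorem posSemidef_energyMatrix : (energyMatrix (E := E) o φ lam mu).PosSemidef := by
  refine Matrix.PosSemidef.of_dotProduct_mulVec_nonneg ?_ fun r => ?_
  · ext a c
    simp only [Matrix.conjTranspose_apply, energyMatrix, Matrix.of_apply, star_trivial]
    exact integral_congr_ae (ae_of_all _ fun ξ => complexBilin_comm _ _ _ _)
  · have h1 : star r ⬝ᵥ (energyMatrix o φ lam mu).mulVec r
        = ∑ a, ∑ c, r a * energyMatrix o φ lam mu a c * r c := by
      simp only [dotProduct, Matrix.mulVec, Finset.mul_sum, star_trivial, mul_assoc]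
    rw [h1, sum_mul_energyMatrix o hφ hc hmu h]
    exact integral_nonneg fun ξ => complexForm_nonneg hmu h _

/-- Kirchhoff's law enters only through the cone field, which guarantees that the infimum runs over
a nonempty set. -/
theorem minElasticEnergy_burgers {Γ : Submodule ℤ E3} {I : E → E3} (hI : I ∈ currents Γ o E) :
    minElasticEnergy lam mu (burgers o φ I)
      = ENNReal.ofReal (currentForm (energyMatrix o φ lam mu) I) := by
  rw [(isBurgersField_burgers o hφ hc I).minElasticEnergy_eq (isAdmissible_coneField o hφ hc hI)
    hmu h, currentForm, sum_mul_energyMatrix o hφ hc hmu h (fun a => I a.1 a.2)]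
  simp only [minimizerFourier_eq_sum o hφ hc _ I]

end EnergyForm

end

end DislocationLines

open DislocationLines in
theorem theorem1 (Γ : Submodule ℤ E3) [DiscreteTopology Γ] [IsZLattice ℝ Γ]
    (Λ : MesoscopicLattice) (φ : E3 → ℝ) (hφ : IsFormFunction φ) (c : ℝ) (hc : 0 < c) :
    ∃ c₂ : ℝ, 0 < c₂ ∧ ∃ β₀ : ℝ,
      ∀ (o : CountingDirection Λ) (Hd : TensorField → ℝ≥0∞), IsDislocationEnergy Γ o φ c Hd →
      ∀ lam mu : ℝ, 0 < mu → 0 < mu + 3 * lam / 2 →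
        (∀ (E : Finset Λ.Edge), ∀ I ∈ currents Γ o E,
          ∃! w : MatrixField, IsEnergyMinimizer lam mu (burgers o φ I) w) ∧
        ∀ β : ℝ, β₀ < β → ∀ (E : Finset Λ.Edge) (x y : E3) (i j : Fin 3),
          (∀ t : ℝ,
            (∫ I, Complex.exp (Complex.I * t * observable Γ o φ lam mu E x y i j I)
              ∂(gibbsMeasure Γ o φ Hd lam mu β E)).im = 0 ∧
            Real.exp (-(t ^ 2 / 2 * Real.exp (-(c₂ * β)))) ≤
              (∫ I, Complex.exp (Complex.I * t * observable Γ o φ lam mu E x y i j I)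
                ∂(gibbsMeasure Γ o φ Hd lam mu β E)).re) ∧
          MemLp (observable Γ o φ lam mu E x y i j) 2 (gibbsMeasure Γ o φ Hd lam mu β E) ∧
          variance (observable Γ o φ lam mu E x y i j) (gibbsMeasure Γ o φ Hd lam mu β E)
            ≤ Real.exp (-(c₂ * β)) := by
  have hs := hφ.smooth
  have hcs := hφ.compactSupport
  -- The bound B depends only on the mesoscopic lattice and φ, so c₂ and β₀ are fixed before the
  -- counting direction, the dislocation energy and the moduli appear.
  obtain ⟨B, hB, hσ⟩ := exists_sum_observableCoeff_sq_le hs hcs Λ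
  obtain ⟨c₂, hc₂, β₀, hβ₀⟩ := exists_gibbs_constants Γ Λ hc hB
  refine ⟨c₂, hc₂, β₀, fun o Hd hH lam mu hmu h => ⟨fun E I hI => ?_, fun β hβ E x y i j => ?_⟩⟩
  · exact (isBurgersField_burgers o hs hcs I).existsUnique_isEnergyMinimizer
      (isAdmissible_coneField o hs hcs hI) hmu h
  · obtain ⟨hβ, q, D, hD, hq, hqD, hε⟩ := hβ₀ β hβ
    have hκ := abs_lame_ratio_le hmu h
    refine gibbsMeasure_bounds hH hβ (posSemidef_energyMatrix o hs hcs hmu h)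
      (fun I hI => minElasticEnergy_burgers o hs hcs hmu h hI) (hD E) hq hqD (fun I => ?_)
      (hε _ (hσ o E _ hκ x y i j))
    rw [observable, realPairing_observableCoeff o hs hcs hκ,
      (isBurgersField_burgers o hs hcs I.1).wStar_eq (isAdmissible_coneField o hs hcs I.2) hmu h]
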